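/- Let $\mathbb K$ be a perfect field, $\mathbb L$ a field extension of $\mathbb K$, and $F\in\mathbb K[[x]][y]$ a square-free Weierstrass polynomial (monic in $y$, all other coefficients vanishing at $x=0$) whose degree $d$ is not divisible by the characteristic of $\mathbb K$ (so $d\ge 1$). **Algorithm** $\texttt{Irreducible}(F,\mathbb L)$. Initialise $k=0$, $N=d$, $V=(v_{-1},v_0)=(1,0)$, $\Lambda=(\lambda_{-1},\lambda_0)=(1,1)$, $\Psi=(\psi_{-1})$ with $\psi_{-1}=x$. While $N>1$ do: 1. Append to $\Psi$ the $N$-th approximate root $\psi_k$ of $F$, i.e. the monic polynomial of degree $d/N$ with $\deg(F-\psi_k^N)<d-d/N$. 2. Compute the $\Psi$-adic expansion $F=\sum_B f_B\Psi^B$, where $f_B\in\mathbb K$, $\Psi^B=\prod_{i=-1}^k\psi_i^{b_i}$ and $B=(b_{-1},\dots,b_k)\in\mathbb N^{k+2}$ satisfies $b_{i-1}<\deg\psi_i/\deg\psi_{i-1}$ for $1\le i\le k$. 3. Put $w_i=\min\{\langle B,V\rangle : b_k=i,\ f_B\neq 0\}-Nv_k$ for $0\le i\le N$ ($w_i=\infty$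 if there is no such $B$). Let $\Delta$ be the lowest edge (the one with right end point $(N,w_N)$) of the lower convex hull of the points $(i,w_i)$, and form the boundary polynomial $$\bar H=\sum_{(i,w_i)\in\Delta}\Big(\sum_{b_k=i,\ \langle B,V\rangle=w_i+Nv_k} f_B\,\Lambda^{B-B_0}\Big)x^{w_i}y^i\in\mathbb L[x,y],\qquad B_0=(0,\dots,0,N).$$ 4. If $\bar H$ is not degenerated over $\mathbb L$, return $\texttt{False}$. Here $\bar H$ is degenerated, with edge data $(q,m,P,N')$, if $\bar H=c\,\big(P(y^q/x^m)\,x^{m\deg P}\big)^{N'}$ with $c\in\mathbb L^\times$, $q>0$ and $m\ge 0$ coprime, $P\in\mathbb L[Z]$ monic and irreducible, and $N'\ge1$ (with the convention $(q,m)=(1,0)$ if $P=Z$). 5. Otherwise let $\ell=\deg P$, $z=Z \bmod P\in\mathbb L_P:=\mathbb L[Z]/(P)$, and let $s,t$ be the integers with $qs-mt=1$, $0\le t<q$. Replace $V=(v_i)$ by $V'$ and $\Lambda=(\lambda_i)$ by $\Lambda'$, where $$v'_i=qv_i\ (i<k),\quad v'_k=qv_k+m,\quad v'_{k+1}=q\ell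 v'_k,$$ $$\lambda'_i=\lambda_i z^{tv_i}\ (i<k),\quad \lambda'_k=\lambda_kz^{tv_k+s},\quad \lambda'_{k+1}=q\,z^{1-s-\ell}P'(z)\,(\lambda'_k)^{q\ell};$$ replace $\mathbb L$ by $\mathbb L_P$, $N$ by $N'$ and $k$ by $k+1$. When the loop is left, return $\texttt{True}$. **Theorem.** The algorithm is correct: $\texttt{Irreducible}(F,\mathbb L)$ terminates and returns $\texttt{True}$ if and only if $F$ is irreducible in $\mathbb L[[x]][y]$, and it terminates and returns $\texttt{False}$ if and only if $F$ is not irreducible in $\mathbb L[[x]][y]$. -/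

import Mathlib

open scoped Polynomial PowerSeries

namespace ApproxRootTest

universe u v

/-- `ψ` is the `N`-th approximate root of `F`: it is monic of degree `deg F / N` and
`deg (F - ψ ^ N) < deg F - deg F / N`. -/
def IsApproxRoot {A : Type*} [CommRing A] (F : A[X]) (N : ℕ) (ψ : A[X]) : Prop :=
  ψ.Monic ∧ ψ.natDegree * N = F.natDegree ∧
    (F - ψ ^ N).degree < ((F.natDegree - F.natDegree / N : ℕ) : WithBot ℕ)

/-- The coefficients of a `Ψ`-adic expansion for `Ψ = (ψ₋₁ = x, ψ₀, …, ψₖ)`. The powers of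
`ψ₋₁ = x` are collected in power series: `c b ∈ K⟦x⟧` is the coefficient of
`ψ₀ ^ b₀ ⋯ ψₖ ^ bₖ`. -/
abbrev Expansion (K : Type*) [Field K] (k : ℕ) := (Fin (k + 1) → ℕ) →₀ K⟦X⟧

/-- The coefficient `f_B ∈ K` of `Ψ ^ B`, where `B = (b₋₁, b₀, …, bₖ)`. -/
noncomputable def Expansion.f {K : Type*} [Field K] {k : ℕ} (c : Expansion K k)
    (B : Fin (k + 2) → ℕ) : K :=
  PowerSeries.coeff (B 0) (c (Fin.tail B))

/-- `c` is the `(x, ψ₀, …, ψₖ)`-adic expansion of `F`, that is `F = ∑ f_B Ψ ^ B` with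
`bᵢ < deg ψᵢ₊₁ / deg ψᵢ` for `0 ≤ i < k` (and no condition on `b₋₁` and `bₖ`).
In the algorithm `deg ψᵢ₊₁ = qᵢ₊₁ ℓᵢ₊₁ deg ψᵢ`, so that the bound is `bᵢ < qᵢ₊₁ ℓᵢ₊₁`. -/
def IsExpansion {K : Type*} [Field K] {k : ℕ} (F : K⟦X⟧[X]) (Ψ : Fin (k + 1) → K⟦X⟧[X])
    (c : Expansion K k) : Prop :=
  (∀ b ∈ c.support, ∀ i : Fin k,
      b i.castSucc * (Ψ i.castSucc).natDegree < (Ψ i.succ).natDegree) ∧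
    F = c.sum fun b a => Polynomial.C a * ∏ i, Ψ i ^ b i

/-- The scalar product `⟨B, V⟩`. -/
def pairing {n : ℕ} (B V : Fin n → ℕ) : ℕ := ∑ i, B i * V i

/-- `min {⟨B, V⟩ | bₖ = i, f_B ≠ 0}`, which is `⊤` if there is no such `B`. -/
noncomputable def minVal {K : Type*} [Field K] {k : ℕ} (V : Fin (k + 2) → ℕ)
    (c : Expansion K k) (i : ℕ) : ℕ∞ :=
  ⨅ (B : Fin (k + 2) → ℕ) (_ : B (Fin.last (k + 1)) = i ∧ c.f B ≠ 0), (pairing B V : ℕ∞)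

/-- The ordinate `wᵢ = min {⟨B, V⟩ | bₖ = i, f_B ≠ 0} - vₖ(F)` of the generalised Newton polygon,
where `vₖ(F) = N * vₖ(ψₖ)`. -/
noncomputable def ordinate {K : Type*} [Field K] {k : ℕ} (N : ℕ) (V : Fin (k + 2) → ℕ)
    (c : Expansion K k) (i : ℕ) : WithTop ℤ :=
  (minVal V c i).map fun n => (n : ℤ) - N * V (Fin.last (k + 1))

/-- The point `(i, wᵢ)` lies on the lowest edge of the lower convex hull of the points `(j, wⱼ)`,
`0 ≤ j ≤ N`. The lowest edge is the one that starts from the rightmost point `(N, w_N)`; it goes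
to the points for which `(wⱼ - w_N) / (N - j)` is minimal. If no other `wⱼ` is finite, it is
reduced to `(N, w_N)`. -/
def OnLowestEdge (w : ℕ → WithTop ℤ) (N i : ℕ) : Prop :=
  i ≤ N ∧ ∃ a a' : ℤ, w i = a ∧ w N = a' ∧
    ∀ j ≤ N, ∀ b : ℤ, w j = b → (a - a') * ((N : ℤ) - j) ≤ (b - a') * ((N : ℤ) - i)

/-- The sum of the `f_B Λ ^ (B - B₀)` over the `B` with `bₖ = i` and `⟨B, V⟩ = n`, where
`B₀ = (0, …, 0, N)`. It is a finite sum, because the entry `v₋₁` of `V` is positive. -/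
noncomputable def boundaryCoeff {K : Type u} [Field K] {L : Type v} [Field L] [Algebra K L] {k : ℕ}
    (N : ℕ) (V : Fin (k + 2) → ℕ) (Λ : Fin (k + 2) → L) (c : Expansion K k) (i n : ℕ) : L :=
  ∑ᶠ (B : Fin (k + 2) → ℕ) (_ : B (Fin.last (k + 1)) = i ∧ pairing B V = n),
    algebraMap K L (c.f B) * ((∏ j, Λ j ^ B j) / Λ (Fin.last (k + 1)) ^ N)

open Classical in
/-- The lowest boundary polynomial, in `L[x][y]`: the sum of
`(∑ f_B Λ ^ (B - B₀)) x ^ wᵢ y ^ i` over the points `(i, wᵢ)` of the lowest edge, where the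
inner sum is over the `B` with `bₖ = i` and `⟨B, V⟩ = wᵢ + vₖ(F)`. -/
noncomputable def boundaryPol {K : Type u} [Field K] {L : Type v} [Field L] [Algebra K L] {k : ℕ}
    (N : ℕ) (V : Fin (k + 2) → ℕ) (Λ : Fin (k + 2) → L) (c : Expansion K k) : L[X][X] :=
  ∑ i ∈ Finset.range (N + 1),
    if OnLowestEdge (ordinate N V c) N i then
      Polynomial.C (Polynomial.C (boundaryCoeff N V Λ c i (minVal V c i).toNat) *
        Polynomial.X ^ ((ordinate N V c i).untopD 0).toNat) * Polynomial.X ^ i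
    else 0

/-- The quasi-homogeneous polynomial `P (y ^ q / x ^ m) x ^ (m deg P)` of `L[x][y]`. -/
noncomputable def quasiHom {L : Type v} [Field L] (q m : ℕ) (P : L[X]) : L[X][X] :=
  ∑ j ∈ Finset.range (P.natDegree + 1),
    Polynomial.C (Polynomial.C (P.coeff j) * Polynomial.X ^ (m * (P.natDegree - j))) *
      Polynomial.X ^ (q * j)

/-- `(q, m, P, N)` is the edge data of `H`: `q > 0` and `m` are coprime, `P` is monic and
irreducible over `L`, and `H = c (P (y ^ q / x ^ m) x ^ (m deg P)) ^ N` with `c ∈ Lˣ`; by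
convention `(q, m) = (1, 0)` when the Newton polygon of `H` is a point (that is, `P = Z`). -/
def IsEdgeData {L : Type v} [Field L] (H : L[X][X]) (q m : ℕ) (P : L[X]) (N : ℕ) : Prop :=
  0 < q ∧ q.Coprime m ∧ P.Monic ∧ Irreducible P ∧ 0 < N ∧
    (P = Polynomial.X → q = 1 ∧ m = 0) ∧
    ∃ c : L, c ≠ 0 ∧ H = Polynomial.C (Polynomial.C c) * quasiHom q m P ^ N

/-- The quasi-homogeneous polynomial `H` is degenerated over `L`. -/
def Degenerated {L : Type v} [Field L] (H : L[X][X]) : Prop :=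
  ∃ (q m : ℕ) (P : L[X]) (N : ℕ), IsEdgeData H q m P N

/-- The update of `V = (vₖ,₋₁, …, vₖ,ₖ)`: the old entries are multiplied by `q`, with `m` added to
the last one, and the new last entry is `q ℓ` times the one before it. -/
def updateV {k : ℕ} (q m ℓ : ℕ) (V : Fin (k + 2) → ℕ) : Fin (k + 3) → ℕ :=
  Fin.snoc (α := fun _ => ℕ) (fun i => if i = Fin.last (k + 1) then q * V i + m else q * V i)
    (q * ℓ * (q * V (Fin.last (k + 1)) + m))

/-- The update of `Λ`, with values in `L_P = L[Z] / (P)`, where `z = Z mod P` and `V` is the list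
before its update: an old entry `λᵢ` becomes `λᵢ z ^ (t vᵢ)`, with a factor `z ^ s` added for the
last one, which gives `λ'`; the new last entry is `q z ^ (1 - s - ℓ) P'(z) λ' ^ (q ℓ)`. -/
noncomputable def updateΛ {L : Type v} [Field L] {k : ℕ} (q s t : ℕ) (P : L[X])
    [Fact (Irreducible P)] (V : Fin (k + 2) → ℕ) (Λ : Fin (k + 2) → L) :
    Fin (k + 3) → AdjoinRoot P :=
  let z := AdjoinRoot.root P
  let Λ' : Fin (k + 2) → AdjoinRoot P := fun i =>
    if i = Fin.last (k + 1) then AdjoinRoot.of P (Λ i) * z ^ (t * V i + s)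
    else AdjoinRoot.of P (Λ i) * z ^ (t * V i)
  Fin.snoc (α := fun _ => AdjoinRoot P) Λ'
    ((q : AdjoinRoot P) * z ^ (1 - (s : ℤ) - (P.natDegree : ℤ)) *
      Polynomial.aeval z (Polynomial.derivative P) *
      Λ' (Fin.last (k + 1)) ^ (q * P.natDegree))

/-- The list `Ψ ∪ ψ`. -/
def append {A : Type*} {k : ℕ} (Ψ : Fin k → A) (ψ : A) : Fin (k + 1) → A :=
  Fin.snoc (α := fun _ => A) Ψ ψ

/-- Execution of the `while` loop of the algorithm on the input `F`. `LoopReturns F L k N V Λ Ψ r`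
says that the loop, entered after `k` rounds with the current residue field `L` and the current
values `N`, `V`, `Λ`, `Ψ` of the variables, stops and that the value returned is `r`. The entry
`ψ₋₁ = x` of the list `Ψ` is not stored.

* If `N ≤ 1` then `true` is returned.
* If `N > 1`, the `N`-th approximate root `ψ` of `F` is appended to `Ψ`, the `Ψ`-adic expansion
  of `F` and the boundary polynomial are computed. If the latter is not degenerated over `L`,
  then `false` is returned.
* Otherwise `(q, m, P, N')` is its edge data, `V` and `Λ` are updated with the integers `s`, `t`
  such that `q s - m t = 1` and `0 ≤ t < q`, the field `L` is replaced by `L_P = L[Z] / (P)` and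
  `N` by `N'`, and the next round begins. -/
inductive LoopReturns {K : Type u} [Field K] (F : K⟦X⟧[X]) :
    (L : Type v) → [Field L] → [Algebra K L] → (k N : ℕ) → (Fin (k + 2) → ℕ) →
      (Fin (k + 2) → L) → (Fin k → K⟦X⟧[X]) → Bool → Prop
  | exit (L : Type v) [Field L] [Algebra K L] (k N : ℕ) (V : Fin (k + 2) → ℕ)
      (Λ : Fin (k + 2) → L) (Ψ : Fin k → K⟦X⟧[X]) (hN : N ≤ 1) :
      LoopReturns F L k N V Λ Ψ true
  | notDegenerated (L : Type v) [Field L] [Algebra K L] (k N : ℕ) (V : Fin (k + 2) → ℕ)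
      (Λ : Fin (k + 2) → L) (Ψ : Fin k → K⟦X⟧[X]) (hN : 1 < N)
      (ψ : K⟦X⟧[X]) (hψ : IsApproxRoot F N ψ)
      (c : Expansion K k) (hc : IsExpansion F (append Ψ ψ) c)
      (hH : ¬ Degenerated (boundaryPol N V Λ c)) :
      LoopReturns F L k N V Λ Ψ false
  | next (L : Type v) [Field L] [Algebra K L] (k N : ℕ) (V : Fin (k + 2) → ℕ)
      (Λ : Fin (k + 2) → L) (Ψ : Fin k → K⟦X⟧[X]) (hN : 1 < N)
      (ψ : K⟦X⟧[X]) (hψ : IsApproxRoot F N ψ)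
      (c : Expansion K k) (hc : IsExpansion F (append Ψ ψ) c)
      (q m : ℕ) (P : L[X]) (N' : ℕ) [Fact (Irreducible P)]
      (hH : IsEdgeData (boundaryPol N V Λ c) q m P N')
      (s t : ℕ) (hst : q * s = m * t + 1) (ht : t < q) (r : Bool)
      (h : LoopReturns F (AdjoinRoot P) (k + 1) N' (updateV q m P.natDegree V)
        (updateΛ q s t P V Λ) (append Ψ ψ) r) :
      LoopReturns F L k N V Λ Ψ r

/-- The call `Irreducible(F, L)` of the algorithm stops and returns `r`: the loop is entered with
`N = deg F`, `V = (1, 0)`, `Λ = (1, 1)` and `Ψ = (x)`. -/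
def AlgorithmReturns {K : Type u} [Field K] (F : K⟦X⟧[X]) (L : Type v) [Field L] [Algebra K L]
    (r : Bool) : Prop :=
  LoopReturns F L 0 F.natDegree ![1, 0] ![1, 1] Fin.elim0 r

end ApproxRootTest

/-!
The algorithm computes, without any substitution, the discrete data of a sequence of Puiseux
substitutions `x ↦ ζ₁ x ^ q`, `y ↦ x ^ m (y + ζ₂)`, and the proof follows these substitutions. Let
`κ` be the current residue field and `π : L⟦x⟧[y] → κ⟦x⟧[y]` the composition of the substitutions of
the previous rounds. The invariant `IsState` says that `V` and `Λ` contain the orders in `x` and the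
leading coefficients of the images under `π` of `x`, of the approximate roots found so far and of
the next one, that `κ⟦x⟧` is generated by `d / N` elements over `L⟦x⟧`, and that the degree of every
monic factor of `F` is a multiple of `d / N`. It holds at the start (`isState_initial`).

In one round, Hensel's lemma provides a root in `x κ⟦x⟧` of the image of the new approximate root
`ψₖ`, up to a power of `x`, and a translation of `y` moves this root to zero
(`IsState.exists_isFrame`). The image of a monomial in `x, ψ₀, …, ψₖ` is then known up to terms of
higher order, and the leading coefficients `Λ ^ B` of the terms of equal weight and equal exponent
of `ψₖ` are linearly independent over `L` (`IsIndep`), so that no cancellation occurs in an adic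
expansion. Therefore the boundary polynomial is the weighted leading form of the image of `F` for
the slope of the lowest edge (`IsFrame.exists_boundary`). As `F` is squarefree, it is not a power of
`ψₖ`, and the edge is not reduced to a point.

* If the boundary polynomial is degenerated, the leading form is a power of `P(y ^ q)`, up to a
  constant. The substitution with `ζ₁ = z ^ t` and `ζ₂ = z ^ s`, where `z` is a root of `P`, gives
  the next state (`IsState.next`). The main point is that the leading form of an approximate root of
  `F` is an approximate root of the leading form (`IsFrame.lead_approxRoot`), which uses that `d` is
  not zero in `κ`. The root `z` is simple because `deg P` divides `d`. Moreover `N` decreases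
  (`IsFrame.one_lt_mul`): if `q deg P` were `1`, the leading form of `ψₖ` would be `P`, up to a
  constant, but its image is divisible by `y`. Hence the algorithm stops (`exists_loopReturns`).
* If it is not degenerated, the leading form is a product of two coprime quasi-homogeneous factors
  (`exists_coprime_factors`), and a graded form of Hensel's lemma lifts them to a factor `G` of the
  image of `F` with `0 < deg G < N` (`exists_factor_of_hasLead`). The image of `y` modulo `G` is
  integral over `L⟦x⟧`, of degree at most `deg G * d / N < d`, so that `F` is reducible
  (`IsState.not_irreducible_of_dvd`).
* If `N = 1`, the degree of every factor of `F` is a multiple of `d`, and `F` is irreducible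
  (`IsState.irreducible`).
-/

namespace ApproxRootTest

/-! ### Orders and leading forms with respect to `x` -/

section Lead

variable {κ κ' : Type*} [Field κ] [Field κ']

/-- `x ^ n` divides `p ∈ κ⟦x⟧[y]` and `h ∈ κ[y]` is the coefficient of `x ^ n` in `p`. The form `h`
may be zero, so that `n` is only a lower bound for the order of `p` in `x`. -/
def HasLead (n : ℕ) (h : κ[X]) (p : κ⟦X⟧[X]) : Prop :=
  ∃ p₁ : κ⟦X⟧[X], p = Polynomial.C (PowerSeries.X ^ n) * p₁ ∧
    p₁.map PowerSeries.constantCoeff = h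

lemma C_X_pow_ne_zero (n : ℕ) : (Polynomial.C (PowerSeries.X ^ n) : κ⟦X⟧[X]) ≠ 0 :=
  Polynomial.C_ne_zero.2 (pow_ne_zero _ PowerSeries.X_ne_zero)

lemma hasLead_C_mul_iff {a n : ℕ} {h : κ[X]} {p : κ⟦X⟧[X]} :
    HasLead (a + n) h (Polynomial.C (PowerSeries.X ^ a) * p) ↔ HasLead n h p := by
  constructor
  · rintro ⟨p₁, h1, h2⟩
    refine ⟨p₁, ?_, h2⟩
    rw [pow_add, Polynomial.C_mul, mul_assoc] at h1
    exact mul_left_cancel₀ (C_X_pow_ne_zero a) h1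
  · rintro ⟨p₁, rfl, h2⟩
    exact ⟨p₁, by rw [pow_add, Polynomial.C_mul, mul_assoc], h2⟩

lemma hasLead_zero_iff {h : κ[X]} {p : κ⟦X⟧[X]} :
    HasLead 0 h p ↔ p.map PowerSeries.constantCoeff = h := by
  constructor
  · rintro ⟨p₁, rfl, h2⟩
    simpa using h2
  · intro h
    exact ⟨p, by simp, h⟩

lemma HasLead.mul {n n' : ℕ} {h h' : κ[X]} {p p' : κ⟦X⟧[X]} (H : HasLead n h p)
    (H' : HasLead n' h' p') : HasLead (n + n') (h * h') (p * p') := by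
  obtain ⟨p₁, rfl, rfl⟩ := H
  obtain ⟨p₂, rfl, rfl⟩ := H'
  exact ⟨p₁ * p₂, by rw [pow_add, Polynomial.C_mul]; ring, by rw [Polynomial.map_mul]⟩

lemma HasLead.one : HasLead 0 (1 : κ[X]) 1 := hasLead_zero_iff.2 (by simp)

lemma HasLead.pow {n : ℕ} {h : κ[X]} {p : κ⟦X⟧[X]} (H : HasLead n h p) (k : ℕ) :
    HasLead (k * n) (h ^ k) (p ^ k) := by
  induction k with
  | zero => simpa using HasLead.one
  | succ k ih =>
    rw [Nat.succ_mul, pow_succ, pow_succ]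
    exact ih.mul H

lemma HasLead.prod {α : Type*} {s : Finset α} {n : α → ℕ} {h : α → κ[X]} {p : α → κ⟦X⟧[X]}
    (H : ∀ a ∈ s, HasLead (n a) (h a) (p a)) :
    HasLead (∑ a ∈ s, n a) (∏ a ∈ s, h a) (∏ a ∈ s, p a) := by
  classical
  induction s using Finset.induction_on with
  | empty => simpa using HasLead.one
  | insert a s ha ih =>
    rw [Finset.sum_insert ha, Finset.prod_insert ha, Finset.prod_insert ha]
    exact (H a (by simp)).mul (ih fun b hb => H b (by simp [hb]))

lemma HasLead.zero (n : ℕ) : HasLead n (0 : κ[X]) 0 := ⟨0, by simp, by simp⟩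

lemma HasLead.add {n : ℕ} {h h' : κ[X]} {p p' : κ⟦X⟧[X]} (H : HasLead n h p)
    (H' : HasLead n h' p') : HasLead n (h + h') (p + p') := by
  obtain ⟨p₁, rfl, rfl⟩ := H
  obtain ⟨p₂, rfl, rfl⟩ := H'
  exact ⟨p₁ + p₂, by ring, by rw [Polynomial.map_add]⟩

lemma HasLead.sub {n : ℕ} {h h' : κ[X]} {p p' : κ⟦X⟧[X]} (H : HasLead n h p)
    (H' : HasLead n h' p') : HasLead n (h - h') (p - p') := by
  obtain ⟨p₁, rfl, rfl⟩ := H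
  obtain ⟨p₂, rfl, rfl⟩ := H'
  exact ⟨p₁ - p₂, by ring, by rw [Polynomial.map_sub]⟩

lemma HasLead.sum {α : Type*} {s : Finset α} {n : ℕ} {h : α → κ[X]} {p : α → κ⟦X⟧[X]}
    (H : ∀ a ∈ s, HasLead n (h a) (p a)) :
    HasLead n (∑ a ∈ s, h a) (∑ a ∈ s, p a) := by
  classical
  induction s using Finset.induction_on with
  | empty => simpa using HasLead.zero n
  | insert a s ha ih =>
    rw [Finset.sum_insert ha, Finset.sum_insert ha]
    exact (H a (by simp)).add (ih fun b hb => H b (by simp [hb]))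

lemma HasLead.of_lt {n n' : ℕ} {h : κ[X]} {p : κ⟦X⟧[X]} (H : HasLead n h p) (hn : n' < n) :
    HasLead n' 0 p := by
  obtain ⟨p₁, rfl, rfl⟩ := H
  obtain ⟨d, rfl⟩ := Nat.exists_eq_add_of_lt hn
  refine ⟨Polynomial.C (PowerSeries.X ^ (d + 1)) * p₁, ?_, ?_⟩
  · rw [add_assoc, pow_add, Polynomial.C_mul, mul_assoc]
  · simp

lemma HasLead.unique {n : ℕ} {h h' : κ[X]} {p : κ⟦X⟧[X]} (H : HasLead n h p)
    (H' : HasLead n h' p) : h = h' := by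
  obtain ⟨p₁, rfl, rfl⟩ := H
  obtain ⟨p₂, h2, rfl⟩ := H'
  rw [mul_left_cancel₀ (C_X_pow_ne_zero n) h2]

lemma HasLead.order_le {n n' : ℕ} {h h' : κ[X]} {p : κ⟦X⟧[X]} (H : HasLead n h p)
    (H' : HasLead n' h' p) (h0 : h ≠ 0) : n' ≤ n := by
  by_contra! hlt
  exact h0 (H.unique (H'.of_lt hlt))

lemma HasLead.order_eq {n n' : ℕ} {h h' : κ[X]} {p : κ⟦X⟧[X]} (H : HasLead n h p)
    (H' : HasLead n' h' p) (h0 : h ≠ 0) (h0' : h' ≠ 0) : n = n' :=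
  le_antisymm (H'.order_le H h0') (H.order_le H' h0)

lemma hasLead_C {n : ℕ} {f : κ⟦X⟧} (hf : PowerSeries.X ^ n ∣ f) :
    HasLead n (Polynomial.C (PowerSeries.coeff n f)) (Polynomial.C f) := by
  obtain ⟨g, rfl⟩ := hf
  refine ⟨Polynomial.C g, by rw [Polynomial.C_mul], ?_⟩
  rw [Polynomial.map_C]
  congr 1
  have := PowerSeries.coeff_X_pow_mul g n 0
  rw [zero_add] at this
  rw [this, PowerSeries.coeff_zero_eq_constantCoeff]

lemma HasLead.dvd_coeff {n : ℕ} {h : κ[X]} {p : κ⟦X⟧[X]} (H : HasLead n h p) (i : ℕ) :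
    PowerSeries.X ^ n ∣ p.coeff i := by
  obtain ⟨p₁, rfl, rfl⟩ := H
  rw [Polynomial.coeff_C_mul]
  exact dvd_mul_right _ _

lemma HasLead.coeff_coeff {n : ℕ} {h : κ[X]} {p : κ⟦X⟧[X]} (H : HasLead n h p) (i : ℕ) :
    PowerSeries.coeff n (p.coeff i) = h.coeff i := by
  obtain ⟨p₁, rfl, rfl⟩ := H
  have := PowerSeries.coeff_X_pow_mul (p₁.coeff i) n 0
  rw [zero_add] at this
  rw [Polynomial.coeff_C_mul, this, Polynomial.coeff_map, PowerSeries.coeff_zero_eq_constantCoeff]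

lemma exists_hasLead {p : κ⟦X⟧[X]} (hp : p ≠ 0) : ∃ n h, h ≠ 0 ∧ HasLead n h p := by
  have hfin : FiniteMultiplicity (Polynomial.C (PowerSeries.X : κ⟦X⟧)) p := by
    refine FiniteMultiplicity.of_not_isUnit ?_ hp
    rw [Polynomial.isUnit_C]
    exact PowerSeries.X_prime.not_isUnit
  obtain ⟨c, hc, hndvd⟩ := hfin.exists_eq_pow_mul_and_not_dvd
  refine ⟨multiplicity (Polynomial.C (PowerSeries.X : κ⟦X⟧)) p, c.map PowerSeries.constantCoeff,
    ?_, c, ?_, rfl⟩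
  · intro h0
    apply hndvd
    rw [Polynomial.C_dvd_iff_dvd_coeff]
    intro i
    rw [PowerSeries.X_dvd_iff, ← Polynomial.coeff_map, h0, Polynomial.coeff_zero]
  · rw [Polynomial.C_pow]
    exact hc

end Lead

/-! ### Monomial substitutions -/

section Substitution

variable {L κ κ' : Type*} [Field L] [Field κ] [Field κ']

/-- The substitution `x ↦ a x ^ v` from `L⟦x⟧` to `κ⟦x⟧`, over a map `ι : L → κ`. -/
noncomputable def monSubst (ι : L →+* κ) (a : κ) (v : ℕ) (hv : v ≠ 0) : L⟦X⟧ →+* κ⟦X⟧ :=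
  ((PowerSeries.expand v hv : κ⟦X⟧ →ₐ[κ] κ⟦X⟧) : κ⟦X⟧ →+* κ⟦X⟧).comp
    ((PowerSeries.rescale a).comp (PowerSeries.map ι))

lemma coeff_monSubst_mul (ι : L →+* κ) (a : κ) (v : ℕ) (hv : v ≠ 0) (f : L⟦X⟧) (n : ℕ) :
    PowerSeries.coeff (v * n) (monSubst ι a v hv f) = ι (PowerSeries.coeff n f) * a ^ n := by
  simp [monSubst, PowerSeries.coeff_expand_mul, PowerSeries.coeff_rescale, mul_comm]

lemma coeff_monSubst_of_not_dvd (ι : L →+* κ) (a : κ) (v : ℕ) (hv : v ≠ 0) (f : L⟦X⟧) {n : ℕ}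
    (h : ¬ v ∣ n) : PowerSeries.coeff n (monSubst ι a v hv f) = 0 := by
  simp [monSubst, PowerSeries.coeff_expand_of_not_dvd _ _ _ h]

lemma constantCoeff_monSubst (ι : L →+* κ) (a : κ) (v : ℕ) (hv : v ≠ 0) (f : L⟦X⟧) :
    PowerSeries.constantCoeff (monSubst ι a v hv f) = ι (PowerSeries.constantCoeff f) := by
  have := coeff_monSubst_mul ι a v hv f 0
  simpa using this

lemma monSubst_injective (ι : L →+* κ) {a : κ} (ha : a ≠ 0) (v : ℕ) (hv : v ≠ 0) :
    Function.Injective (monSubst ι a v hv) := by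
  rw [injective_iff_map_eq_zero]
  intro f hf
  ext n
  have := coeff_monSubst_mul ι a v hv f n
  rw [hf, map_zero] at this
  simpa [ha] using this.symm

lemma monSubst_X (ι : L →+* κ) (a : κ) (v : ℕ) (hv : v ≠ 0) :
    monSubst ι a v hv PowerSeries.X = PowerSeries.C a * PowerSeries.X ^ v := by
  simp [monSubst, PowerSeries.rescale_X, PowerSeries.expand_C]

lemma monSubst_monSubst (ι : L →+* κ) (a : κ) (v : ℕ) (hv : v ≠ 0) (ι' : κ →+* κ') (a' : κ')
    (v' : ℕ) (hv' : v' ≠ 0) (f : L⟦X⟧) :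
    monSubst ι' a' v' hv' (monSubst ι a v hv f) =
      monSubst (ι'.comp ι) (ι' a * a' ^ v) (v' * v) (mul_ne_zero hv' hv) f := by
  ext n
  by_cases h : v' ∣ n
  · obtain ⟨n, rfl⟩ := h
    rw [coeff_monSubst_mul]
    by_cases h : v ∣ n
    · obtain ⟨n, rfl⟩ := h
      rw [coeff_monSubst_mul, ← mul_assoc v' v n, coeff_monSubst_mul]
      simp only [map_mul, map_pow, RingHom.comp_apply]
      ring
    · rw [coeff_monSubst_of_not_dvd _ _ _ _ _ h, coeff_monSubst_of_not_dvd]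
      · simp
      · rwa [Nat.mul_dvd_mul_iff_left (Nat.pos_of_ne_zero hv')]
  · rw [coeff_monSubst_of_not_dvd _ _ _ _ _ h, coeff_monSubst_of_not_dvd]
    exact fun h' => h (dvd_trans (dvd_mul_right _ _) h')

lemma monSubst_congr (ι : L →+* κ) {a a' : κ} (ha : a = a') {v v' : ℕ} (h : v = v') (hv : v ≠ 0)
    (f : L⟦X⟧) : monSubst ι a v hv f = monSubst ι a' v' (h ▸ hv) f := by
  subst h ha
  rfl

lemma monSubst_id (f : κ⟦X⟧) : monSubst (RingHom.id κ) 1 1 one_ne_zero f = f := by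
  ext n
  have := coeff_monSubst_mul (RingHom.id κ) 1 1 one_ne_zero f n
  simpa using this

/-- The substitution `x ↦ ζ₁ x ^ q`, `y ↦ x ^ m (y + ζ₂)` from `κ⟦x⟧[y]` to `κ'⟦x⟧[y]`. -/
noncomputable def puiseux (ι : κ →+* κ') (ζ₁ ζ₂ : κ') (q : ℕ) (hq : q ≠ 0) (m : ℕ) :
    κ⟦X⟧[X] →+* κ'⟦X⟧[X] :=
  Polynomial.eval₂RingHom (Polynomial.C.comp (monSubst ι ζ₁ q hq))
    (Polynomial.C (PowerSeries.X ^ m) * (Polynomial.X + Polynomial.C (PowerSeries.C ζ₂)))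

/-- The substitution `x ↦ x ^ q`, `y ↦ x ^ m y`. -/
noncomputable abbrev weightSubst (κ : Type*) [Field κ] (q : ℕ) (hq : q ≠ 0) (m : ℕ) :
    κ⟦X⟧[X] →+* κ⟦X⟧[X] :=
  puiseux (RingHom.id κ) 1 0 q hq m

@[simp] lemma puiseux_C (ι : κ →+* κ') (ζ₁ ζ₂ : κ') (q : ℕ) (hq : q ≠ 0) (m : ℕ) (f : κ⟦X⟧) :
    puiseux ι ζ₁ ζ₂ q hq m (Polynomial.C f) = Polynomial.C (monSubst ι ζ₁ q hq f) := by
  simp [puiseux]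

@[simp] lemma puiseux_X (ι : κ →+* κ') (ζ₁ ζ₂ : κ') (q : ℕ) (hq : q ≠ 0) (m : ℕ) :
    puiseux ι ζ₁ ζ₂ q hq m Polynomial.X =
      Polynomial.C (PowerSeries.X ^ m) * (Polynomial.X + Polynomial.C (PowerSeries.C ζ₂)) := by
  simp [puiseux]

lemma puiseux_C_X_pow (ι : κ →+* κ') (ζ₁ ζ₂ : κ') (q : ℕ) (hq : q ≠ 0) (m : ℕ) (n : ℕ) :
    puiseux ι ζ₁ ζ₂ q hq m (Polynomial.C (PowerSeries.X ^ n)) =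
      Polynomial.C (PowerSeries.X ^ (q * n)) *
        Polynomial.C (PowerSeries.C (ζ₁ ^ n)) := by
  rw [puiseux_C, map_pow, monSubst_X, ← Polynomial.C_mul]
  congr 1
  rw [mul_pow, ← pow_mul, map_pow, mul_comm]

lemma puiseux_apply (ι : κ →+* κ') (ζ₁ ζ₂ : κ') (q : ℕ) (hq : q ≠ 0) (m : ℕ) (p : κ⟦X⟧[X])
    {D : ℕ} (hD : p.natDegree ≤ D) :
    puiseux ι ζ₁ ζ₂ q hq m p = ∑ i ∈ Finset.range (D + 1),
      Polynomial.C (monSubst ι ζ₁ q hq (p.coeff i) * PowerSeries.X ^ (m * i)) *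
        (Polynomial.X + Polynomial.C (PowerSeries.C ζ₂)) ^ i := by
  conv_lhs => rw [p.as_sum_range' (D + 1) (by omega)]
  rw [map_sum]
  refine Finset.sum_congr rfl fun i _ => ?_
  rw [← Polynomial.C_mul_X_pow_eq_monomial, map_mul, map_pow, puiseux_C, puiseux_X, mul_pow,
    ← Polynomial.C_pow, ← pow_mul, Polynomial.C_mul, mul_assoc]

lemma coeff_weightSubst (q : ℕ) (hq : q ≠ 0) (m : ℕ) (p : κ⟦X⟧[X]) (i : ℕ) :
    (weightSubst κ q hq m p).coeff i =
      PowerSeries.X ^ (m * i) * monSubst (RingHom.id κ) 1 q hq (p.coeff i) := by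
  rw [puiseux_apply _ _ _ _ _ _ p (le_max_left p.natDegree i)]
  simp only [map_zero, add_zero, Polynomial.finsetSum_coeff, Polynomial.coeff_C_mul,
    Polynomial.coeff_X_pow]
  rw [Finset.sum_eq_single i]
  · simp [mul_comm]
  · intro b _ hb
    simp [hb.symm]
  · intro h
    exact absurd (Finset.mem_range.2 (by omega)) h

lemma weightSubst_injective (q : ℕ) (hq : q ≠ 0) (m : ℕ) :
    Function.Injective (weightSubst κ q hq m) := by
  rw [injective_iff_map_eq_zero]
  intro p hp
  ext1 i
  have := coeff_weightSubst q hq m p i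
  rw [hp, Polynomial.coeff_zero, eq_comm, mul_eq_zero] at this
  rcases this with h | h
  · exact absurd h (pow_ne_zero _ PowerSeries.X_ne_zero)
  · rw [Polynomial.coeff_zero]
    exact monSubst_injective (RingHom.id κ) one_ne_zero q hq (h.trans (map_zero _).symm)

/-- When `m > 0`, only the constant term of a leading form survives. -/
lemma HasLead.map_puiseux {v : ℕ} {h : κ[X]} {p : κ⟦X⟧[X]} (H : HasLead v h p)
    (ι : κ →+* κ') (ζ₁ ζ₂ : κ') (q : ℕ) (hq : q ≠ 0) {m : ℕ} (hm : m ≠ 0) :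
    HasLead (q * v) (Polynomial.C (ι (h.coeff 0) * ζ₁ ^ v))
      (puiseux ι ζ₁ ζ₂ q hq m p) := by
  obtain ⟨p₁, rfl, rfl⟩ := H
  refine ⟨Polynomial.C (PowerSeries.C (ζ₁ ^ v)) * puiseux ι ζ₁ ζ₂ q hq m p₁, ?_, ?_⟩
  · rw [map_mul, puiseux_C_X_pow, mul_assoc]
  · have key : ((Polynomial.mapRingHom PowerSeries.constantCoeff).comp
        (puiseux ι ζ₁ ζ₂ q hq m)) =
        (Polynomial.C.comp (ι.comp (PowerSeries.constantCoeff.comp Polynomial.constantCoeff)) :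
          κ⟦X⟧[X] →+* κ'[X]) := by
      apply Polynomial.ringHom_ext
      · intro f
        simp [constantCoeff_monSubst]
      · simp [hm]
    have := congrArg (fun φ => φ p₁) key
    simp only [RingHom.comp_apply, Polynomial.coe_mapRingHom] at this
    rw [Polynomial.map_mul, this]
    simp [mul_comm]

/-- The leading form of a generic substitution `x ↦ ζ₁ x ^ q`, `y ↦ x ^ m (y + ζ₂)` is determined
by that of `x ↦ x ^ q`, `y ↦ x ^ m y`: both come from the same weighted homogeneous part. -/
lemma HasLead.puiseux_of_weightSubst {q m J n₀ : ℕ} {hq : q ≠ 0} {c : κ} {R : κ[X]}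
    {p : κ⟦X⟧[X]} (hR : R.natDegree ≤ J)
    (H : HasLead (q * n₀ + m * (q * J)) (Polynomial.C c * Polynomial.expand κ q R)
      (weightSubst κ q hq m p))
    (ι : κ →+* κ') {ζ₁ : κ'} (hζ : ζ₁ ≠ 0) (ζ₂ : κ') :
    HasLead (q * n₀ + m * (q * J))
      (Polynomial.C (ι c * ζ₁ ^ n₀) * (Polynomial.C (ζ₁ ^ (m * J)) *
        (R.map ι).comp (Polynomial.C ((ζ₁ ^ m)⁻¹) *
          (Polynomial.X + Polynomial.C ζ₂) ^ q)))
      (puiseux ι ζ₁ ζ₂ q hq m p) := by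
  -- every power of `y + ζ₂` occurs with a coefficient of order at least `n`, and the coefficient of
  -- `x ^ n` in it is that of the substitution `x ↦ x ^ q`, `y ↦ x ^ m y`, up to a power of `ζ₁`
  set n := q * n₀ + m * (q * J) with hn
  set D := max p.natDegree (q * J) with hD
  have hq0 : 0 < q := Nat.pos_of_ne_zero hq
  rw [puiseux_apply _ _ _ _ _ _ p (le_max_left p.natDegree (q * J))]
  have hmain : ∀ i ∈ Finset.range (D + 1), HasLead n
      (Polynomial.C (PowerSeries.coeff n
          (monSubst ι ζ₁ q hq (p.coeff i) * PowerSeries.X ^ (m * i))) *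
        (Polynomial.X + Polynomial.C ζ₂) ^ i)
      (Polynomial.C (monSubst ι ζ₁ q hq (p.coeff i) * PowerSeries.X ^ (m * i)) *
        (Polynomial.X + Polynomial.C (PowerSeries.C ζ₂)) ^ i) := by
    intro i _
    have h2 : HasLead 0 (Polynomial.X + Polynomial.C ζ₂)
        (Polynomial.X + Polynomial.C (PowerSeries.C ζ₂)) :=
      hasLead_zero_iff.2 (by simp)
    have h3 := h2.pow i
    rw [mul_zero] at h3
    have h4 : PowerSeries.X ^ n ∣
        monSubst ι ζ₁ q hq (p.coeff i) * PowerSeries.X ^ (m * i) := by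
      have h5 := H.dvd_coeff i
      rw [coeff_weightSubst] at h5
      rw [PowerSeries.X_pow_dvd_iff] at h5 ⊢
      intro a ha
      have h6 := h5 a ha
      rw [mul_comm] at h6
      rw [PowerSeries.coeff_mul_X_pow'] at h6 ⊢
      split_ifs at h6 ⊢ with hle
      · by_cases hdvd : q ∣ a - m * i
        · obtain ⟨b, hb⟩ := hdvd
          rw [hb, coeff_monSubst_mul] at h6 ⊢
          simp at h6
          simp [h6]
        · rw [coeff_monSubst_of_not_dvd _ _ _ _ _ hdvd]
      · rfl
    have := (hasLead_C h4).mul h3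
    simpa using this
  have hsum := HasLead.sum hmain
  convert hsum using 1
  -- both sides are compared term by term in the powers of `y + ζ₂`
  have hcoef : ∀ i, PowerSeries.coeff n
      (monSubst ι ζ₁ q hq (p.coeff i) * PowerSeries.X ^ (m * i)) =
      if q ∣ i then (if i / q ≤ J then ι (c * R.coeff (i / q)) *
        ζ₁ ^ (n₀ + m * (J - i / q)) else 0) else 0 := by
    intro i
    have h5 := H.coeff_coeff i
    rw [coeff_weightSubst, mul_comm, Polynomial.coeff_C_mul, Polynomial.coeff_expand hq0] at h5
    rw [PowerSeries.coeff_mul_X_pow'] at h5 ⊢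
    have hzero : PowerSeries.coeff n
        (PowerSeries.X ^ (m * i) * monSubst (RingHom.id κ) 1 q hq (p.coeff i)) = 0 →
        (if m * i ≤ n then PowerSeries.coeff (n - m * i) (monSubst ι ζ₁ q hq (p.coeff i))
          else 0) = 0 := by
      rw [mul_comm, PowerSeries.coeff_mul_X_pow']
      split_ifs with hle
      · by_cases hdvd : q ∣ n - m * i
        · obtain ⟨b, hb⟩ := hdvd
          rw [hb, coeff_monSubst_mul, coeff_monSubst_mul]
          intro h
          simp at h
          simp [h]
        · intro _
          rw [coeff_monSubst_of_not_dvd _ _ _ _ _ hdvd]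
      · simp
    by_cases hqi : q ∣ i
    · rw [if_pos hqi] at h5 ⊢
      obtain ⟨j, rfl⟩ := hqi
      rw [Nat.mul_div_cancel_left _ hq0] at h5 ⊢
      by_cases hj : j ≤ J
      · rw [if_pos hj]
        have e1 : n - m * (q * j) = q * (n₀ + m * (J - j)) := by
          obtain ⟨d, rfl⟩ := Nat.exists_eq_add_of_le hj
          rw [Nat.add_sub_cancel_left, hn]
          apply Nat.sub_eq_of_eq_add
          ring
        have e2 : m * (q * j) ≤ n := by
          rw [hn]
          have : m * (q * j) ≤ m * (q * J) := by gcongr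
          omega
        rw [if_pos e2, e1, coeff_monSubst_mul] at h5 ⊢
        simp at h5
        rw [← h5]
      · rw [if_neg hj]
        apply hzero
        rw [mul_comm, PowerSeries.coeff_mul_X_pow', h5,
          Polynomial.coeff_eq_zero_of_natDegree_lt (by omega), mul_zero]
    · rw [if_neg hqi] at h5 ⊢
      apply hzero
      rw [mul_comm, PowerSeries.coeff_mul_X_pow', h5, mul_zero]
  simp only [hcoef]
  rw [Polynomial.comp, Polynomial.eval₂_eq_sum_range' _
    (show (R.map ι).natDegree < J + 1 from
      lt_of_le_of_lt Polynomial.natDegree_map_le (by omega)), Finset.mul_sum, Finset.mul_sum]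
  symm
  refine Finset.sum_bij_ne_zero (fun i _ _ => i / q) ?_ ?_ ?_ ?_
  · intro i _ hi
    by_cases h1 : q ∣ i
    · by_cases h2 : i / q ≤ J
      · exact Finset.mem_range.2 (by omega)
      · simp [h1, h2] at hi
    · simp [h1] at hi
  · intro i _ hi j _ hj hij
    have h1 : q ∣ i := by by_contra h; simp [h] at hi
    have h2 : q ∣ j := by by_contra h; simp [h] at hj
    rw [← Nat.mul_div_cancel' h1, ← Nat.mul_div_cancel' h2, hij]
  · intro j hj hne
    have hj' : j ≤ J := by have := Finset.mem_range.1 hj; omega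
    have hle : q * j ≤ q * J := Nat.mul_le_mul_left q hj'
    refine ⟨q * j, Finset.mem_range.2 ?_, ?_, Nat.mul_div_cancel_left _ hq0⟩
    · have := le_max_right p.natDegree (q * J)
      omega
    · simp only [dvd_mul_right, if_true, Nat.mul_div_cancel_left _ hq0, hj']
      refine mul_ne_zero ?_ (pow_ne_zero _ (Polynomial.X_add_C_ne_zero _))
      rw [Polynomial.C_ne_zero, map_mul]
      have h1 : ι c ≠ 0 := by rintro h; simp [h] at hne
      have h2 : ι (R.coeff j) ≠ 0 := by intro h; simp [h] at hne
      exact mul_ne_zero (mul_ne_zero h1 h2) (pow_ne_zero _ hζ)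
  · intro i _ hi
    have h1 : q ∣ i := by by_contra h; simp [h] at hi
    have h2 : i / q ≤ J := by by_contra h; simp [h] at hi
    obtain ⟨j, rfl⟩ := h1
    rw [Nat.mul_div_cancel_left _ hq0] at h2 ⊢
    simp only [dvd_mul_right, if_true, h2]
    rw [mul_pow, ← pow_mul, Polynomial.coeff_map, ← mul_assoc, ← mul_assoc, ← mul_assoc]
    congr 1
    rw [← Polynomial.C_pow, ← Polynomial.C_mul, ← Polynomial.C_mul, ← Polynomial.C_mul]
    congr 1
    obtain ⟨d, rfl⟩ := Nat.exists_eq_add_of_le h2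
    have hinv : ζ₁ ^ (m * j) * ((ζ₁ ^ m)⁻¹) ^ j = 1 := by
      rw [inv_pow, ← pow_mul, mul_inv_cancel₀ (pow_ne_zero _ hζ)]
    rw [Nat.add_sub_cancel_left, map_mul, mul_add, pow_add, pow_add]
    linear_combination (-(ι c * ζ₁ ^ n₀ * ζ₁ ^ (m * d) * ι (R.coeff j))) * hinv

end Substitution

/-! ### Graded Hensel lifting -/

section Hensel

variable {κ : Type*} [Field κ]

/-- All the exponents `i` of `p` satisfy `m i = c` in `ZMod q`. -/
def IsGraded (q m : ℕ) (c : ZMod q) (p : κ[X]) : Prop :=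
  ∀ i, p.coeff i ≠ 0 → (m * i : ZMod q) = c

open Classical in
/-- The part of `p` made of the monomials `y ^ i` with `m i = c` in `ZMod q`. -/
noncomputable def gradedPart (q m : ℕ) (c : ZMod q) (p : κ[X]) : κ[X] :=
  ∑ i ∈ Finset.range (p.natDegree + 1),
    if (m * i : ZMod q) = c then Polynomial.monomial i (p.coeff i) else 0

open Classical in
lemma coeff_gradedPart (q m : ℕ) (c : ZMod q) (p : κ[X]) (i : ℕ) :
    (gradedPart q m c p).coeff i = if (m * i : ZMod q) = c then p.coeff i else 0 := by
  rw [gradedPart, Polynomial.finsetSum_coeff, Finset.sum_eq_single i]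
  · split_ifs <;> simp
  · intro b _ hb
    split_ifs
    · rw [Polynomial.coeff_monomial, if_neg hb]
    · simp
  · intro h
    have : p.coeff i = 0 := Polynomial.coeff_eq_zero_of_natDegree_lt (by
      rw [Finset.mem_range] at h; omega)
    rw [this]
    simp

lemma isGraded_gradedPart (q m : ℕ) (c : ZMod q) (p : κ[X]) :
    IsGraded q m c (gradedPart q m c p) := by
  intro i hi
  rw [coeff_gradedPart] at hi
  by_contra h
  simp [h] at hi

lemma IsGraded.gradedPart_eq {q m : ℕ} {c : ZMod q} {p : κ[X]} (hp : IsGraded q m c p) :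
    gradedPart q m c p = p := by
  ext i
  rw [coeff_gradedPart]
  split_ifs with h
  · rfl
  · by_contra h'
    exact h (hp i (Ne.symm h'))

lemma gradedPart_add (q m : ℕ) (c : ZMod q) (p p' : κ[X]) :
    gradedPart q m c (p + p') = gradedPart q m c p + gradedPart q m c p' := by
  ext i
  simp only [coeff_gradedPart, Polynomial.coeff_add]
  split_ifs <;> simp

lemma gradedPart_mul {q m : ℕ} {c₁ : ZMod q} {h : κ[X]} (hh : IsGraded q m c₁ h) (c : ZMod q)
    (p : κ[X]) : gradedPart q m c (h * p) = h * gradedPart q m (c - c₁) p := by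
  ext i
  rw [coeff_gradedPart, Polynomial.coeff_mul, Polynomial.coeff_mul]
  have key : ∀ x ∈ Finset.HasAntidiagonal.antidiagonal i,
      h.coeff x.1 * (gradedPart q m (c - c₁) p).coeff x.2 =
      if (m * i : ZMod q) = c then h.coeff x.1 * p.coeff x.2 else 0 := by
    rintro ⟨a, b⟩ hab
    rw [Finset.HasAntidiagonal.mem_antidiagonal] at hab
    simp only at hab ⊢
    rw [coeff_gradedPart]
    by_cases ha : h.coeff a = 0
    · simp [ha]
    · have h1 := hh a ha
      have h2 : (m * b : ZMod q) = c - c₁ ↔ (m * i : ZMod q) = c := by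
        rw [← hab, eq_sub_iff_add_eq, ← h1]
        push_cast
        rw [mul_add, add_comm]
      simp only [h2]
      split_ifs <;> simp
  rw [Finset.sum_congr rfl key]
  split_ifs <;> simp

lemma IsGraded.mul {q m : ℕ} {c₁ c₂ : ZMod q} {p p' : κ[X]} (h : IsGraded q m c₁ p)
    (h' : IsGraded q m c₂ p') : IsGraded q m (c₁ + c₂) (p * p') := by
  have := gradedPart_mul h (c₁ + c₂) p'
  rw [add_sub_cancel_left, h'.gradedPart_eq] at this
  rw [← this]
  exact isGraded_gradedPart _ _ _ _

lemma IsGraded.sub {q m : ℕ} {c : ZMod q} {p p' : κ[X]} (h : IsGraded q m c p)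
    (h' : IsGraded q m c p') : IsGraded q m c (p - p') := by
  intro i hi
  rw [Polynomial.coeff_sub] at hi
  by_cases h0 : p.coeff i = 0
  · exact h' i (by rintro h1; simp [h0, h1] at hi)
  · exact h i h0

lemma IsGraded.sum {q m : ℕ} {c : ZMod q} {α : Type*} {s : Finset α} {p : α → κ[X]}
    (h : ∀ a ∈ s, IsGraded q m c (p a)) : IsGraded q m c (∑ a ∈ s, p a) := by
  intro i hi
  rw [Polynomial.finsetSum_coeff] at hi
  obtain ⟨a, ha, hne⟩ := Finset.exists_ne_zero_of_sum_ne_zero hi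
  exact h a ha i hne

/-- A Bézout relation between graded polynomials can be chosen graded. -/
lemma exists_graded_bezout {q m : ℕ} {c₁ c₂ c : ZMod q} {h₁ h₂ w : κ[X]} (hm : h₁.Monic)
    (hc : IsCoprime h₁ h₂) (g₁ : IsGraded q m c₁ h₁) (g₂ : IsGraded q m c₂ h₂)
    (gw : IsGraded q m (c₁ + c₂ + c) w) {D : ℕ} (hD : h₁.natDegree + h₂.natDegree ≤ D)
    (hw : w.natDegree ≤ D) :
    ∃ g r : κ[X], h₁ * r + h₂ * g = w ∧ g.degree < h₁.degree ∧ r.natDegree ≤ D - h₁.natDegree ∧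
      IsGraded q m (c₁ + c) g ∧ IsGraded q m (c₂ + c) r := by
  obtain ⟨u, v, huv⟩ := hc
  set g := gradedPart q m (c₁ + c) ((v * w) %ₘ h₁) with hg
  set r := gradedPart q m (c₂ + c) (u * w + h₂ * ((v * w) /ₘ h₁)) with hr
  have heq : h₁ * r + h₂ * g = w := by
    have e1 := gradedPart_mul g₁ (c₁ + c₂ + c) (u * w + h₂ * ((v * w) /ₘ h₁))
    have e2 := gradedPart_mul g₂ (c₁ + c₂ + c) ((v * w) %ₘ h₁)
    rw [show c₁ + c₂ + c - c₁ = c₂ + c by ring] at e1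
    rw [show c₁ + c₂ + c - c₂ = c₁ + c by ring] at e2
    rw [hg, hr, ← e1, ← e2, ← gradedPart_add]
    conv_rhs => rw [← gw.gradedPart_eq]
    congr 1
    have := Polynomial.modByMonic_add_div (v * w) h₁
    linear_combination w * huv + h₂ * this
  have hdeg : g.degree < h₁.degree := by
    refine lt_of_le_of_lt ?_ (Polynomial.degree_modByMonic_lt (v * w) hm)
    rw [Polynomial.degree_le_iff_coeff_zero]
    intro i hi
    rw [hg, coeff_gradedPart, Polynomial.coeff_eq_zero_of_degree_lt hi]
    simp
  refine ⟨g, r, heq, hdeg, ?_, isGraded_gradedPart _ _ _ _, isGraded_gradedPart _ _ _ _⟩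
  by_cases hr0 : r = 0
  · simp [hr0]
  have h1 : (h₁ * r).natDegree = h₁.natDegree + r.natDegree :=
    hm.natDegree_mul' hr0
  have h2 : h₁ * r = w - h₂ * g := by rw [← heq]; ring
  have h3 : (h₂ * g).natDegree ≤ D := by
    by_cases hg0 : g = 0
    · simp [hg0]
    have := Polynomial.natDegree_lt_natDegree hg0 hdeg
    have := Polynomial.natDegree_mul_le (p := h₂) (q := g)
    omega
  have h4 := Polynomial.natDegree_sub_le_of_le hw h3
  rw [← h2, h1, max_self] at h4
  omega

/-- The sequence defined by `s₀ = a` and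
`sₙ₊₁ = S (n + 1) (w (n + 1) - ∑ (sᵢ).1 (sⱼ).2)`, where the sum is over the `i, j > 0` such that
`i + j = n + 1`: the coefficients of the two factors in Hensel's lemma. -/
noncomputable def liftSeq (S : ℕ → κ[X] → κ[X] × κ[X]) (w : ℕ → κ[X]) (a : κ[X] × κ[X]) :
    ℕ → κ[X] × κ[X]
  | 0 => a
  | n + 1 => S (n + 1) (w (n + 1) -
      ∑ i : Fin n, (liftSeq S w a (i + 1)).1 * (liftSeq S w a (n - i)).2)
  termination_by n => n
  decreasing_by
    · have := i.2; omega
    · omega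

lemma exists_liftSeq (S : ℕ → κ[X] → κ[X] × κ[X]) (w : ℕ → κ[X]) (a : κ[X] × κ[X]) :
    ∃ s : ℕ → κ[X] × κ[X], s 0 = a ∧ ∀ n, s (n + 1) = S (n + 1) (w (n + 1) -
      ∑ i : Fin n, (s (i + 1)).1 * (s (n - i)).2) :=
  ⟨liftSeq S w a, by rw [liftSeq], fun n => by rw [liftSeq]⟩

/-- The polynomial over `κ⟦x⟧` with coefficient `s b ∈ κ[y]` of `x ^ b`, cut at degree `D`. -/
noncomputable def ofSlices (D : ℕ) (s : ℕ → κ[X]) : κ⟦X⟧[X] :=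
  ∑ i ∈ Finset.range (D + 1), Polynomial.monomial i (PowerSeries.mk fun b => (s b).coeff i)

lemma coeff_ofSlices {D : ℕ} {s : ℕ → κ[X]} (hs : ∀ b, (s b).natDegree ≤ D) (i : ℕ) :
    (ofSlices D s).coeff i = PowerSeries.mk fun b => (s b).coeff i := by
  rw [ofSlices, Polynomial.finsetSum_coeff, Finset.sum_eq_single i]
  · simp
  · intro b _ hb
    rw [Polynomial.coeff_monomial, if_neg hb]
  · intro h
    rw [Polynomial.coeff_monomial, if_pos rfl]
    ext b
    rw [PowerSeries.coeff_mk, map_zero]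
    refine Polynomial.coeff_eq_zero_of_natDegree_lt (lt_of_le_of_lt (hs b) ?_)
    rw [Finset.mem_range] at h
    omega

/-- The coefficient in `κ[y]` of `x ^ b`. -/
noncomputable def slice (W : κ⟦X⟧[X]) (b : ℕ) : κ[X] :=
  ∑ i ∈ Finset.range (W.natDegree + 1), Polynomial.monomial i (PowerSeries.coeff b (W.coeff i))

lemma coeff_slice (W : κ⟦X⟧[X]) (b i : ℕ) :
    (slice W b).coeff i = PowerSeries.coeff b (W.coeff i) := by
  rw [slice, Polynomial.finsetSum_coeff, Finset.sum_eq_single i]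
  · simp
  · intro b _ hb
    rw [Polynomial.coeff_monomial, if_neg hb]
  · intro h
    rw [Polynomial.coeff_monomial, if_pos rfl, Polynomial.coeff_eq_zero_of_natDegree_lt, map_zero]
    rw [Finset.mem_range] at h
    omega

lemma natDegree_slice_le (W : κ⟦X⟧[X]) (b : ℕ) : (slice W b).natDegree ≤ W.natDegree := by
  rw [Polynomial.natDegree_le_iff_coeff_eq_zero]
  intro i hi
  rw [coeff_slice, Polynomial.coeff_eq_zero_of_natDegree_lt hi, map_zero]

/-- Hensel's lemma for a factorisation `W(0, y) = h₁ h₂` into coprime factors, where `W` need not be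
monic. If `W` is homogeneous for the grading of `κ⟦x⟧[y]` by `ZMod q` in which `x` has degree `-1`
and `y` has degree `m`, and so are `h₁` and `h₂`, then the lifted factor is homogeneous as well. -/
theorem exists_graded_factor {q m : ℕ} {c₁ c₂ : ZMod q} {W : κ⟦X⟧[X]} {h₁ h₂ : κ[X]}
    (hW : W.map PowerSeries.constantCoeff = h₁ * h₂) (hm : h₁.Monic) (hc : IsCoprime h₁ h₂)
    (g₁ : IsGraded q m c₁ h₁) (g₂ : IsGraded q m c₂ h₂)
    (gW : ∀ b : ℕ, IsGraded q m (c₁ + c₂ + b) (slice W b)) :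
    ∃ G : κ⟦X⟧[X], G.Monic ∧ G.natDegree = h₁.natDegree ∧
      G.map PowerSeries.constantCoeff = h₁ ∧ G ∣ W ∧
      ∀ b : ℕ, IsGraded q m (c₁ + b) (slice G b) := by
  -- the cofactor need not have degree `deg h₂`, but its slices have degree at most `D`
  set D := max W.natDegree (h₁.natDegree + h₂.natDegree) with hD
  have hS : ∀ (b : ℕ) (w : κ[X]), ∃ s : κ[X] × κ[X], IsGraded q m (c₁ + c₂ + b) w →
      w.natDegree ≤ D → h₁ * s.2 + h₂ * s.1 = w ∧ s.1.degree < h₁.degree ∧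
        s.2.natDegree ≤ D - h₁.natDegree ∧ IsGraded q m (c₁ + b) s.1 ∧
        IsGraded q m (c₂ + b) s.2 := by
    intro b w
    by_cases h : IsGraded q m (c₁ + c₂ + b) w ∧ w.natDegree ≤ D
    · obtain ⟨g, r, h⟩ := exists_graded_bezout hm hc g₁ g₂ h.1 (le_max_right _ _) h.2
      exact ⟨(g, r), fun _ _ => h⟩
    · exact ⟨0, fun h1 h2 => absurd ⟨h1, h2⟩ h⟩
  choose S hS using hS
  obtain ⟨s, s0, hs⟩ := exists_liftSeq S (slice W) (h₁, h₂)
  have hD1 : h₁.natDegree ≤ D := le_trans (Nat.le_add_right _ _) (le_max_right _ _)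
  have hdeg1 : ∀ g : κ[X], g.degree < h₁.degree → g.natDegree ≤ h₁.natDegree := fun g hg =>
    Polynomial.natDegree_le_natDegree hg.le
  have main : ∀ n : ℕ, (0 < n → (s n).1.degree < h₁.degree) ∧
      (s n).2.natDegree ≤ D - h₁.natDegree ∧ IsGraded q m (c₁ + n) (s n).1 ∧
        IsGraded q m (c₂ + n) (s n).2 ∧
      (0 < n → h₁ * (s n).2 + h₂ * (s n).1 = slice W n -
        ∑ i : Fin (n - 1), (s (i + 1)).1 * (s (n - 1 - i)).2) := by
    intro n
    induction n using Nat.strong_induction_on with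
    | _ n ih =>
    rcases n with _ | n
    · rw [s0]
      refine ⟨by simp, ?_, by simpa using g₁, by simpa using g₂, by simp⟩
      have := le_max_right W.natDegree (h₁.natDegree + h₂.natDegree)
      simp only
      omega
    · have hsn : s (n + 1) = S (n + 1) (slice W (n + 1) -
          ∑ i : Fin n, (s (i + 1)).1 * (s (n - i)).2) := hs n
      have hg : IsGraded q m (c₁ + c₂ + (n + 1 : ℕ)) (slice W (n + 1) -
          ∑ i : Fin n, (s (i + 1)).1 * (s (n - i)).2) := by
        refine (gW (n + 1)).sub (IsGraded.sum fun i _ => ?_)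
        have h1 := (ih (i + 1) (by have := i.2; omega)).2.2.1
        have h2 := (ih (n - i) (by omega)).2.2.2.1
        have h3 := h1.mul h2
        convert h3 using 1
        have : (n + 1 : ℕ) = (i + 1 : ℕ) + (n - i : ℕ) := by have := i.2; omega
        rw [this]
        push_cast
        ring
      have hd : (slice W (n + 1) -
          ∑ i : Fin n, (s (i + 1)).1 * (s (n - i)).2).natDegree ≤ D := by
        refine le_trans (Polynomial.natDegree_sub_le_of_le (natDegree_slice_le W (n + 1))
          (Polynomial.natDegree_sum_le_of_forall_le (n := D) _ _ fun i _ => ?_)) ?_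
        · have h1 := (ih (i + 1) (by have := i.2; omega)).1 (by omega)
          have h2 := (ih (n - i) (by omega)).2.1
          have h3 := hdeg1 _ h1
          have := Polynomial.natDegree_mul_le (p := (s (i + 1)).1) (q := (s (n - i)).2)
          omega
        · exact max_le (le_max_left _ _) le_rfl
      obtain ⟨e1, e2, e3, e4, e5⟩ := hS (n + 1) _ hg hd
      rw [← hsn] at e1 e2 e3 e4 e5
      exact ⟨fun _ => e2, e3, e4, e5, fun _ => e1⟩
  have hsum : ∀ n, ∑ x ∈ Finset.HasAntidiagonal.antidiagonal n, (s x.1).1 * (s x.2).2 =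
      slice W n := by
    intro n
    rcases n with _ | n
    · simp only [Finset.Nat.antidiagonal_zero, Finset.sum_singleton, s0]
      rw [← hW]
      ext i
      rw [coeff_slice, Polynomial.coeff_map, PowerSeries.coeff_zero_eq_constantCoeff]
    · have h := (main (n + 1)).2.2.2.2 (by omega)
      rw [Nat.add_sub_cancel] at h
      rw [Finset.Nat.sum_antidiagonal_eq_sum_range_succ (fun i j => (s i).1 * (s j).2),
        Finset.sum_range_succ', Finset.sum_range_succ]
      simp only [s0, Nat.sub_self, Nat.sub_zero, Nat.add_sub_add_right]
      rw [Finset.sum_range (fun i => (s (i + 1)).1 * (s (n - i)).2)]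
      rw [eq_sub_iff_add_eq] at h
      rw [← h]
      ring
  have hG : ∀ b, (s b).1.natDegree ≤ h₁.natDegree := by
    intro b
    rcases b with _ | b
    · rw [s0]
    · exact hdeg1 _ ((main (b + 1)).1 (by omega))
  have hR : ∀ b, (s b).2.natDegree ≤ D := fun b => le_trans (main b).2.1 (Nat.sub_le _ _)
  set G := ofSlices h₁.natDegree (fun b => (s b).1) with hGdef
  have cG : ∀ i, G.coeff i = PowerSeries.mk fun b => (s b).1.coeff i := coeff_ofSlices hG
  have cR := coeff_ofSlices (s := fun b => (s b).2) hR
  have hle : G.natDegree ≤ h₁.natDegree := by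
    rw [Polynomial.natDegree_le_iff_coeff_eq_zero]
    intro i hi
    rw [cG]
    ext b
    rw [PowerSeries.coeff_mk, map_zero]
    exact Polynomial.coeff_eq_zero_of_natDegree_lt (lt_of_le_of_lt (hG b) hi)
  have hone : G.coeff h₁.natDegree = 1 := by
    rw [cG]
    ext b
    rw [PowerSeries.coeff_mk, PowerSeries.coeff_one]
    rcases b with _ | b
    · rw [s0]
      simpa using hm.leadingCoeff
    · rw [if_neg (by omega)]
      refine Polynomial.coeff_eq_zero_of_degree_lt ?_
      rw [← Polynomial.degree_eq_natDegree hm.ne_zero]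
      exact (main (b + 1)).1 (by omega)
  have hmon := Polynomial.monic_of_natDegree_le_of_coeff_eq_one _ hle hone
  refine ⟨G, hmon, ?_, ?_, ⟨ofSlices D (fun b => (s b).2), ?_⟩, ?_⟩
  · refine le_antisymm hle (Polynomial.le_natDegree_of_ne_zero ?_)
    rw [hone]
    exact one_ne_zero
  · ext i
    rw [Polynomial.coeff_map, cG, ← PowerSeries.coeff_zero_eq_constantCoeff_apply,
      PowerSeries.coeff_mk, s0]
  · ext i b
    rw [Polynomial.coeff_mul, map_sum, ← coeff_slice, ← hsum, Polynomial.finsetSum_coeff]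
    simp only [PowerSeries.coeff_mul, Polynomial.coeff_mul, cG, cR, PowerSeries.coeff_mk]
    rw [Finset.sum_comm]
  · intro b i hi
    rw [coeff_slice, cG, PowerSeries.coeff_mk] at hi
    exact (main b).2.2.1 i hi

/-- A polynomial over `κ⟦x⟧` whose reduction has a simple root at `0` has a root in `x κ⟦x⟧`: this
is the lifting of factors for the trivial grading, by `ZMod 1`. -/
lemma exists_root_of_simple {W : κ⟦X⟧[X]} {u : κ[X]}
    (hW : W.map PowerSeries.constantCoeff = Polynomial.X * u) (hu : u.coeff 0 ≠ 0) :
    ∃ β : κ⟦X⟧, PowerSeries.constantCoeff β = 0 ∧ W.eval β = 0 := by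
  have hc : IsCoprime (Polynomial.X : κ[X]) u := by
    rw [Polynomial.irreducible_X.coprime_iff_not_dvd, Polynomial.X_dvd_iff]
    exact hu
  obtain ⟨G, hG, hdeg, hred, hdvd, -⟩ := exists_graded_factor (q := 1) (m := 0) (c₁ := 0) (c₂ := 0)
    hW Polynomial.monic_X hc (fun _ _ => Subsingleton.elim _ _) (fun _ _ => Subsingleton.elim _ _)
    (fun _ _ _ => Subsingleton.elim _ _)
  rw [Polynomial.natDegree_X] at hdeg
  have hGX := hG.eq_X_add_C hdeg
  refine ⟨-G.coeff 0, ?_, ?_⟩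
  · rw [map_neg, ← Polynomial.coeff_map, hred]
    simp
  · refine Polynomial.eval_eq_zero_of_dvd_of_eval_eq_zero hdvd ?_
    rw [hGX]
    simp

/-- The lowest weighted form of `W` is quasi-homogeneous, so that a coprime factorisation of it
into forms in `y ^ q`, up to powers of `y`, lifts to a factor of `W` over `κ⟦x⟧` itself, and not
just over `κ⟦x ^ (1/q)⟧`. -/
theorem exists_factor_of_hasLead {q m : ℕ} (hq : q ≠ 0) {W : κ⟦X⟧[X]} {h₁ h₂ : κ[X]}
    (hW : HasLead (m * (h₁.natDegree + h₂.natDegree)) (h₁ * h₂) (weightSubst κ q hq m W))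
    (hm : h₁.Monic) (hc : IsCoprime h₁ h₂)
    (g₁ : IsGraded q m (m * h₁.natDegree) h₁) (g₂ : IsGraded q m (m * h₂.natDegree) h₂) :
    ∃ G : κ⟦X⟧[X], G.Monic ∧ G.natDegree = h₁.natDegree ∧ G ∣ W := by
  have hq0 : 0 < q := Nat.pos_of_ne_zero hq
  obtain ⟨W₁, h1, h2⟩ := hW
  set n₁ := h₁.natDegree with hn₁
  set n₂ := h₂.natDegree with hn₂
  have gW : ∀ b : ℕ, IsGraded q m ((m * n₁ : ZMod q) + m * n₂ + b) (slice W₁ b) := by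
    intro b i hi
    rw [coeff_slice] at hi
    have e1 : PowerSeries.coeff (b + m * (n₁ + n₂)) ((weightSubst κ q hq m W).coeff i) ≠ 0 := by
      rwa [h1, Polynomial.coeff_C_mul, PowerSeries.coeff_X_pow_mul]
    rw [coeff_weightSubst, PowerSeries.coeff_X_pow_mul'] at e1
    split_ifs at e1 with hle
    · by_cases hdvd : q ∣ b + m * (n₁ + n₂) - m * i
      · obtain ⟨a, ha⟩ := hdvd
        have : b + m * (n₁ + n₂) = q * a + m * i := by omega
        have h3 := congrArg (Nat.cast : ℕ → ZMod q) this
        push_cast at h3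
        rw [ZMod.natCast_self, zero_mul, zero_add] at h3
        rw [← h3]
        ring
      · exact absurd (coeff_monSubst_of_not_dvd _ _ _ _ _ hdvd) e1
    · exact absurd rfl e1
  obtain ⟨G, hG, hdeg, -, hdvd, gG⟩ := exists_graded_factor h2 hm hc g₁ g₂ gW
  -- `G(x, y)` becomes `x ^ (-m n₁) G₀(x ^ q, x ^ m y)`, with `G₀ ∈ κ⟦x⟧[y]` by homogeneity
  have hexp : ∀ b i, PowerSeries.coeff b (G.coeff i) ≠ 0 → i ≤ n₁ ∧
      q ∣ b + m * (n₁ - i) := by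
    intro b i hi
    have hle : i ≤ n₁ := by
      by_contra! hlt
      rw [Polynomial.coeff_eq_zero_of_natDegree_lt (by omega)] at hi
      simp at hi
    refine ⟨hle, ?_⟩
    have h3 := gG b i (by rwa [coeff_slice])
    rw [← ZMod.natCast_eq_zero_iff]
    push_cast [Nat.cast_sub hle]
    linear_combination -h3
  set G₀ : κ⟦X⟧[X] := ∑ i ∈ Finset.range (n₁ + 1), Polynomial.monomial i
    (PowerSeries.mk fun a => if m * (n₁ - i) ≤ q * a then
      PowerSeries.coeff (q * a - m * (n₁ - i)) (G.coeff i) else 0) with hG₀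
  have cG₀ : ∀ i, i ≤ n₁ → G₀.coeff i = PowerSeries.mk fun a => if m * (n₁ - i) ≤ q * a then
      PowerSeries.coeff (q * a - m * (n₁ - i)) (G.coeff i) else 0 := by
    intro i hi
    rw [hG₀, Polynomial.finsetSum_coeff, Finset.sum_eq_single i]
    · simp
    · intro b _ hb
      rw [Polynomial.coeff_monomial, if_neg hb]
    · intro h
      exact absurd (Finset.mem_range.2 (by omega)) h
  have cG₀' : ∀ i, n₁ < i → G₀.coeff i = 0 := by
    intro i hi
    rw [hG₀, Polynomial.finsetSum_coeff]
    refine Finset.sum_eq_zero fun b hb => ?_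
    have := Finset.mem_range.1 hb
    rw [Polynomial.coeff_monomial, if_neg (by omega)]
  have hsubst : weightSubst κ q hq m G₀ = Polynomial.C (PowerSeries.X ^ (m * n₁)) * G := by
    ext i b
    rw [coeff_weightSubst, Polynomial.coeff_C_mul, PowerSeries.coeff_X_pow_mul',
      PowerSeries.coeff_X_pow_mul']
    by_cases hi : i ≤ n₁
    · have hmi : m * (n₁ - i) = m * n₁ - m * i := Nat.mul_sub _ _ _
      have hmle : m * i ≤ m * n₁ := Nat.mul_le_mul_left _ hi
      by_cases hb : m * i ≤ b
      · rw [if_pos hb]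
        by_cases hdvd : q ∣ b - m * i
        · obtain ⟨a, ha⟩ := hdvd
          rw [ha, coeff_monSubst_mul, cG₀ i hi, PowerSeries.coeff_mk]
          simp only [RingHom.id_apply, one_pow, mul_one]
          have : m * (n₁ - i) ≤ q * a ↔ m * n₁ ≤ b := by omega
          simp only [this]
          split_ifs
          · congr 2
            omega
          · rfl
        · rw [coeff_monSubst_of_not_dvd _ _ _ _ _ hdvd]
          split_ifs with hle
          · by_contra hne
            have := (hexp _ _ (Ne.symm hne)).2
            apply hdvd
            convert this using 1
            omega
          · rfl
      · rw [if_neg hb, if_neg (by omega)]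
    · rw [cG₀' i (by omega), Polynomial.coeff_eq_zero_of_natDegree_lt (p := G) (by omega)]
      simp
  have hle : G₀.natDegree ≤ n₁ := by
    rw [Polynomial.natDegree_le_iff_coeff_eq_zero]
    exact cG₀'
  have hone : G₀.coeff n₁ = 1 := by
    rw [cG₀ n₁ le_rfl]
    have hlead : G.coeff n₁ = 1 := by rw [hn₁, ← hdeg]; exact hG
    ext a
    rw [PowerSeries.coeff_mk, hlead, PowerSeries.coeff_one, PowerSeries.coeff_one]
    simp [hq]
  have hmon := Polynomial.monic_of_natDegree_le_of_coeff_eq_one _ hle hone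
  have hdeg₀ : G₀.natDegree = n₁ := le_antisymm hle (Polynomial.le_natDegree_of_ne_zero (by
    rw [hone]; exact one_ne_zero))
  refine ⟨G₀, hmon, hdeg₀, ?_⟩
  -- the remainder of `W` modulo `G₀` is divisible by `G` after the substitution, up to a power
  -- of `x`, and has smaller degree
  rw [← Polynomial.modByMonic_eq_zero_iff_dvd hmon]
  by_contra hr
  have e1 := Polynomial.modByMonic_add_div W G₀
  set r := W %ₘ G₀ with hrdef
  have hrdeg : r.degree < G₀.degree := Polynomial.degree_modByMonic_lt W hmon
  have hdvd2 : G ∣ weightSubst κ q hq m r := by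
    have e2 : weightSubst κ q hq m r = weightSubst κ q hq m W -
        weightSubst κ q hq m G₀ * weightSubst κ q hq m (W /ₘ G₀) := by
      rw [← map_mul, ← map_sub]
      congr 1
      exact eq_sub_of_add_eq e1
    rw [e2, hsubst, h1]
    exact dvd_sub (dvd_mul_of_dvd_right hdvd _) (dvd_mul_of_dvd_left (dvd_mul_left _ _) _)
  have hne : weightSubst κ q hq m r ≠ 0 := by
    intro h
    exact hr (weightSubst_injective q hq m (h.trans (map_zero _).symm))
  have hd2 : (weightSubst κ q hq m r).degree < G.degree := by
    refine lt_of_le_of_lt ?_ (lt_of_lt_of_eq hrdeg ?_)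
    · rw [Polynomial.degree_le_iff_coeff_zero]
      intro i hi
      rw [coeff_weightSubst, Polynomial.coeff_eq_zero_of_degree_lt hi]
      simp
    · rw [Polynomial.degree_eq_natDegree hmon.ne_zero, Polynomial.degree_eq_natDegree hG.ne_zero,
        hdeg₀, hdeg]
  exact hG.not_dvd_of_degree_lt hne hd2 hdvd2

end Hensel

/-! ### Approximate roots -/

section ApproxRoot

variable {A : Type*} [CommRing A]

lemma natDegree_geom_sum_le {p p₀ : A[X]} {M : ℕ} (hp : p.natDegree ≤ M) (hp₀ : p₀.natDegree ≤ M)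
    (n : ℕ) : (∑ i ∈ Finset.range n, p ^ i * p₀ ^ (n - 1 - i)).natDegree ≤ (n - 1) * M := by
  refine Polynomial.natDegree_sum_le_of_forall_le _ _ fun i hi => ?_
  have hi := Finset.mem_range.1 hi
  refine le_trans Polynomial.natDegree_mul_le ?_
  have h1 := Polynomial.natDegree_pow_le_of_le i hp
  have h2 := Polynomial.natDegree_pow_le_of_le (n - 1 - i) hp₀
  calc _ ≤ i * M + (n - 1 - i) * M := add_le_add h1 h2
    _ = (n - 1) * M := by rw [← add_mul]; congr 1; omega

lemma coeff_geom_sum {p p₀ : A[X]} {M : ℕ} (hp : p.natDegree ≤ M) (hp₀ : p₀.natDegree ≤ M)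
    (hc : p.coeff M = p₀.coeff M) (n : ℕ) :
    (∑ i ∈ Finset.range n, p ^ i * p₀ ^ (n - 1 - i)).coeff ((n - 1) * M) =
      n * p₀.coeff M ^ (n - 1) := by
  rw [Polynomial.finsetSum_coeff]
  have : ∀ i ∈ Finset.range n, (p ^ i * p₀ ^ (n - 1 - i)).coeff ((n - 1) * M) =
      p₀.coeff M ^ (n - 1) := by
    intro i hi
    have hi := Finset.mem_range.1 hi
    have e : n - 1 = i + (n - 1 - i) := by omega
    have e2 : (n - 1) * M = i * M + (n - 1 - i) * M := by rw [← add_mul, ← e]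
    rw [e2, Polynomial.coeff_mul_add_eq_of_natDegree_le (Polynomial.natDegree_pow_le_of_le i hp)
      (Polynomial.natDegree_pow_le_of_le _ hp₀), Polynomial.coeff_pow_of_natDegree_le hp,
      Polynomial.coeff_pow_of_natDegree_le hp₀, hc, ← pow_add, ← e]
  rw [Finset.sum_congr rfl this]
  simp

/-- Uniqueness of approximate roots, for polynomials over a domain which need not be monic. -/
lemma eq_of_degree_pow_sub_pow_lt [IsDomain A] {p p₀ : A[X]} {M n : ℕ} (hp : p.natDegree ≤ M)
    (hp₀ : p₀.natDegree ≤ M) (hc : p.coeff M = p₀.coeff M) (h0 : p₀.coeff M ≠ 0)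
    (hn : (n : A) ≠ 0) (hlt : (p ^ n - p₀ ^ n).degree < (((n - 1) * M : ℕ) : WithBot ℕ)) :
    p = p₀ := by
  by_contra hne
  have hS := coeff_geom_sum hp hp₀ hc n
  have hne' : (∑ i ∈ Finset.range n, p ^ i * p₀ ^ (n - 1 - i)).coeff ((n - 1) * M) ≠ 0 := by
    rw [hS]
    exact mul_ne_zero hn (pow_ne_zero _ h0)
  rw [← (Commute.all p p₀).geom_sum₂_mul, Polynomial.degree_mul] at hlt
  have h1 := Polynomial.le_degree_of_ne_zero hne'
  have h2 : (0 : WithBot ℕ) ≤ (p - p₀).degree :=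
    Polynomial.zero_le_degree_iff.2 (sub_ne_zero.2 hne)
  have := add_le_add h1 h2
  rw [add_zero] at this
  exact absurd hlt (not_lt.2 this)

lemma isApproxRoot_one [Nontrivial A] {F : A[X]} (hF : F.Monic) :
    IsApproxRoot F 1 F :=
  ⟨hF, by simp, by rw [pow_one, sub_self, Polynomial.degree_zero]; exact WithBot.bot_lt_coe _⟩

/-- The coefficients of an approximate root are determined one after the other, starting from the
top, by those of `F`. -/
lemma exists_isApproxRoot [Nontrivial A] {F : A[X]} (hF : F.Monic)
    {N : ℕ} (hN : N ∣ F.natDegree) (hu : IsUnit (N : A)) : ∃ ψ, IsApproxRoot F N ψ := by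
  obtain ⟨D, hD⟩ := hN
  have hN0 : 0 < N := by
    rcases Nat.eq_zero_or_pos N with rfl | h
    · simp at hu
    · exact h
  obtain ⟨v, hv⟩ := hu.exists_right_inv
  have hdiv : F.natDegree / N = D := by rw [hD, Nat.mul_div_cancel_left _ hN0]
  have hND : N * D = D + (N - 1) * D := by
    conv_lhs => rw [show N = 1 + (N - 1) by omega, add_mul, one_mul]
  have key : ∀ j ≤ D, ∃ ψ : A[X], ψ.Monic ∧ ψ.natDegree = D ∧
      (F - ψ ^ N).degree < ((F.natDegree - j : ℕ) : WithBot ℕ) := by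
    intro j
    induction j with
    | zero =>
      intro _
      refine ⟨Polynomial.X ^ D, Polynomial.monic_X_pow D, Polynomial.natDegree_X_pow D, ?_⟩
      have h1 : (Polynomial.X ^ D : A[X]) ^ N = Polynomial.X ^ F.natDegree := by
        rw [← pow_mul, hD, mul_comm]
      rw [h1, Nat.sub_zero, ← Polynomial.degree_eq_natDegree hF.ne_zero]
      refine Polynomial.degree_sub_lt_left ?_ hF.ne_zero ?_
      · rw [Polynomial.degree_X_pow, Polynomial.degree_eq_natDegree hF.ne_zero]
      · rw [hF.leadingCoeff, (Polynomial.monic_X_pow _).leadingCoeff]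
    | succ j ih =>
      intro hj
      obtain ⟨ψ, hψ, hdeg, hlt⟩ := ih (by omega)
      set e := D - (j + 1) with he
      set a := v * (F - ψ ^ N).coeff (F.natDegree - (j + 1)) with ha
      have hdeglt : (Polynomial.C a * Polynomial.X ^ e).degree < ψ.degree := by
        refine lt_of_le_of_lt (Polynomial.degree_C_mul_X_pow_le _ _) ?_
        rw [Polynomial.degree_eq_natDegree hψ.ne_zero, hdeg]
        exact_mod_cast (by omega : e < D)
      set ψ' := ψ + Polynomial.C a * Polynomial.X ^ e with hψ'
      have hmon : ψ'.Monic := hψ.add_of_left hdeglt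
      have hnd : ψ'.natDegree = D := by
        rw [hψ', Polynomial.natDegree_add_eq_left_of_degree_lt hdeglt, hdeg]
      refine ⟨ψ', hmon, hnd, ?_⟩
      have h1 := natDegree_geom_sum_le hnd.le hdeg.le N
      have h2 := coeff_geom_sum hnd.le hdeg.le (by
        rw [← hnd, hmon.coeff_natDegree, hnd, ← hdeg, hψ.coeff_natDegree]) N
      set S := ∑ i ∈ Finset.range N, ψ' ^ i * ψ ^ (N - 1 - i) with hS
      have h3 : S * (ψ' - ψ) = ψ' ^ N - ψ ^ N := (Commute.all ψ' ψ).geom_sum₂_mul N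
      have h4 : F - ψ' ^ N = (F - ψ ^ N) - Polynomial.C a * (S * Polynomial.X ^ e) := by
        have : ψ' - ψ = Polynomial.C a * Polynomial.X ^ e := by rw [hψ']; ring
        rw [this] at h3
        linear_combination h3
      rw [Polynomial.degree_lt_iff_coeff_zero] at hlt ⊢
      intro i hi
      rw [h4, Polynomial.coeff_sub, Polynomial.coeff_C_mul, Polynomial.coeff_mul_X_pow',
        if_pos (by omega)]
      by_cases hij : F.natDegree - j ≤ i
      · rw [hlt i hij, Polynomial.coeff_eq_zero_of_natDegree_lt (p := S) (by omega)]
        simp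
      · have hi' : i = F.natDegree - (j + 1) := by omega
        have hie : i - e = (N - 1) * D := by omega
        rw [hie, h2, ← hdeg, hψ.coeff_natDegree, hi', ha]
        linear_combination (-(F - ψ ^ N).coeff (F.natDegree - (j + 1))) * hv
  obtain ⟨ψ, hψ, hdeg, hlt⟩ := key D le_rfl
  exact ⟨ψ, hψ, by rw [hdeg, hD, mul_comm], by rwa [hdiv]⟩

lemma IsApproxRoot.map {B : Type*} [CommRing B] [Nontrivial B] (f : A →+* B) {F ψ : A[X]} {N : ℕ}
    (hF : F.Monic) (h : IsApproxRoot F N ψ) : IsApproxRoot (F.map f) N (ψ.map f) := by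
  obtain ⟨h1, h2, h3⟩ := h
  refine ⟨h1.map f, ?_, ?_⟩
  · rw [h1.natDegree_map, hF.natDegree_map, h2]
  · rw [hF.natDegree_map, ← Polynomial.map_pow, ← Polynomial.map_sub]
    exact lt_of_le_of_lt Polynomial.degree_map_le h3

lemma IsApproxRoot.natDegree_eq {F ψ : A[X]} {N : ℕ} (h : IsApproxRoot F N ψ) (hN : 0 < N) :
    ψ.natDegree = F.natDegree / N := by
  rw [← h.2.1, Nat.mul_div_cancel _ hN]

end ApproxRoot

/-! ### Adic expansions -/

section Expansion

/-- `b` can be the exponent of a term of a `Ψ`-adic expansion, where `D` is the list of the degrees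
of `Ψ`. -/
def IsAdmissible {k : ℕ} (D b : Fin (k + 1) → ℕ) : Prop :=
  ∀ i : Fin k, b i.castSucc * D i.castSucc < D i.succ

/-- The admissible exponents are the digits of the natural numbers in the mixed radix system of base
`D`. -/
lemma exists_isAdmissible {k : ℕ} (D : Fin (k + 1) → ℕ) (h0 : D 0 = 1) (hpos : ∀ i, 0 < D i)
    (n : ℕ) : ∃ b, IsAdmissible D b ∧ ∑ i, b i * D i = n := by
  induction k generalizing n with
  | zero =>
    refine ⟨fun _ => n, fun i => i.elim0, ?_⟩
    simp [h0]
  | succ k ih =>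
    obtain ⟨b, hb, hsum⟩ := ih (fun i => D i.castSucc) (by simpa using h0) (fun i => hpos _)
      (n % D (Fin.last (k + 1)))
    refine ⟨Fin.snoc (α := fun _ => ℕ) b (n / D (Fin.last (k + 1))), ?_, ?_⟩
    · intro i
      rw [Fin.snoc_castSucc]
      refine Fin.lastCases ?_ (fun j => ?_) i
      · have h1 : b (Fin.last k) * D (Fin.last k).castSucc ≤ n % D (Fin.last (k + 1)) := by
          rw [← hsum]
          exact Finset.single_le_sum (f := fun i => b i * D i.castSucc) (fun _ _ => Nat.zero_le _)
            (Finset.mem_univ (Fin.last k))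
        exact lt_of_le_of_lt h1 (Nat.mod_lt _ (hpos _))
      · exact hb j
    · rw [Fin.sum_univ_castSucc]
      simp only [Fin.snoc_castSucc, Fin.snoc_last]
      rw [hsum, mul_comm]
      exact Nat.mod_add_div _ _

lemma IsAdmissible.castSucc {k : ℕ} {D b : Fin (k + 2) → ℕ} (h : IsAdmissible D b) :
    IsAdmissible (fun i : Fin (k + 1) => D i.castSucc) (fun i => b i.castSucc) :=
  fun i => h i.castSucc

lemma IsAdmissible.sum_lt {k : ℕ} {D b : Fin (k + 1) → ℕ} (h : IsAdmissible D b) (h0 : 0 < D 0)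
    (hdvd : ∀ i : Fin k, D i.castSucc ∣ D i.succ) :
    ∑ i : Fin k, b i.castSucc * D i.castSucc < D (Fin.last k) := by
  induction k with
  | zero => simpa using h0
  | succ k ih =>
    rw [Fin.sum_univ_castSucc]
    have h1 := ih h.castSucc h0 fun i => hdvd i.castSucc
    have h2 := h (Fin.last k)
    obtain ⟨e, he⟩ := hdvd (Fin.last k)
    rw [Fin.succ_last] at h2 he
    rw [he, mul_comm (D _)] at h2
    have h3 : b (Fin.last k).castSucc + 1 ≤ e := lt_of_mul_lt_mul_right h2 (Nat.zero_le _)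
    have h4 := Nat.mul_le_mul_right (D (Fin.last k).castSucc) h3
    rw [he, mul_comm (D _) e]
    rw [add_mul, one_mul] at h4
    have h5 : ∑ i : Fin k, b i.castSucc.castSucc * D i.castSucc.castSucc <
      D (Fin.last k).castSucc := h1
    omega

/-- Uniqueness of the digits in the mixed radix system of base `D`. -/
lemma IsAdmissible.injective {k : ℕ} {D b b' : Fin (k + 1) → ℕ} (h : IsAdmissible D b)
    (h' : IsAdmissible D b') (h0 : 0 < D 0) (hdvd : ∀ i : Fin k, D i.castSucc ∣ D i.succ)
    (heq : ∑ i, b i * D i = ∑ i, b' i * D i) : b = b' := by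
  induction k with
  | zero =>
    funext i
    have h1 : i = 0 := Fin.fin_one_eq_zero i
    subst h1
    have heq' : b 0 * D 0 = b' 0 * D 0 := by simpa using heq
    exact Nat.eq_of_mul_eq_mul_right h0 heq'
  | succ k ih =>
    rw [Fin.sum_univ_castSucc, Fin.sum_univ_castSucc (fun i => b' i * D i)] at heq
    have h1 := h.sum_lt h0 hdvd
    have h2 := h'.sum_lt h0 hdvd
    have hlast : b (Fin.last (k + 1)) = b' (Fin.last (k + 1)) := by
      have e1 := congrArg (· / D (Fin.last (k + 1))) heq
      beta_reduce at e1
      rwa [Nat.add_mul_div_right _ _ (by omega), Nat.add_mul_div_right _ _ (by omega),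
        Nat.div_eq_of_lt h1, Nat.div_eq_of_lt h2, zero_add, zero_add] at e1
    rw [hlast] at heq
    have e2 := ih h.castSucc h'.castSucc h0 (fun i => hdvd i.castSucc) (Nat.add_right_cancel heq)
    funext i
    refine Fin.lastCases hlast (fun j => ?_) i
    exact congrFun e2 j

variable {L : Type*} [Field L] {k : ℕ}

lemma natDegree_prod_pow {Ψ : Fin (k + 1) → L⟦X⟧[X]} (hΨ : ∀ i, (Ψ i).Monic)
    (b : Fin (k + 1) → ℕ) : (∏ i, Ψ i ^ b i).natDegree = ∑ i, b i * (Ψ i).natDegree := by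
  rw [Polynomial.natDegree_prod_of_monic _ _ fun i _ => (hΨ i).pow _]
  exact Finset.sum_congr rfl fun i _ => (hΨ i).natDegree_pow _

lemma monic_prod_pow {Ψ : Fin (k + 1) → L⟦X⟧[X]} (hΨ : ∀ i, (Ψ i).Monic)
    (b : Fin (k + 1) → ℕ) : (∏ i, Ψ i ^ b i).Monic :=
  Polynomial.monic_prod_of_monic _ _ fun i _ => (hΨ i).pow _

/-- The term of highest degree is removed by means of the product of the `Ψᵢ` of this degree. -/
lemma exists_isExpansion {Ψ : Fin (k + 1) → L⟦X⟧[X]} (hΨ : ∀ i, (Ψ i).Monic)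
    (h0 : (Ψ 0).natDegree = 1) (hpos : ∀ i, 0 < (Ψ i).natDegree) (g : L⟦X⟧[X]) :
    ∃ c, IsExpansion g Ψ c := by
  classical
  have key : ∀ (n : ℕ) (g : L⟦X⟧[X]), g.degree < n → ∃ c, IsExpansion g Ψ c := by
    intro n
    induction n with
    | zero =>
      intro g hg
      have : g = 0 := by
        rw [← Polynomial.degree_eq_bot]
        exact Nat.WithBot.lt_zero_iff.1 (by simpa using hg)
      exact ⟨0, by simp, by simp [this]⟩
    | succ n ih =>
      intro g hg
      obtain ⟨b, hb, hsum⟩ := exists_isAdmissible (fun i => (Ψ i).natDegree) h0 hpos n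
      have hd := natDegree_prod_pow hΨ b
      have hm := monic_prod_pow hΨ b
      rw [hsum] at hd
      obtain ⟨c, hc1, hc2⟩ := ih (g - Polynomial.C (g.coeff n) * ∏ i, Ψ i ^ b i) (by
        rw [Polynomial.degree_lt_iff_coeff_zero] at hg ⊢
        intro i hi
        rw [Polynomial.coeff_sub, Polynomial.coeff_C_mul]
        rcases hi.eq_or_lt with rfl | hi
        · have : (∏ i, Ψ i ^ b i).coeff n = 1 := by rw [← hd]; exact hm.coeff_natDegree
          rw [this]
          ring
        · rw [hg i hi, Polynomial.coeff_eq_zero_of_natDegree_lt (p := ∏ i, Ψ i ^ b i) (by omega)]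
          ring)
      refine ⟨c + Finsupp.single b (g.coeff n), ?_, ?_⟩
      · intro b' hb'
        rcases Finset.mem_union.1 (Finsupp.support_add hb') with h | h
        · exact hc1 b' h
        · have := Finsupp.support_single_subset h
          rw [Finset.mem_singleton] at this
          rw [this]
          exact hb
      · rw [Finsupp.sum_add_index', Finsupp.sum_single_index, ← hc2]
        · ring
        · simp
        · simp
        · intros
          rw [map_add]
          ring
  obtain ⟨n, hn⟩ : ∃ n : ℕ, g.degree < n :=
    ⟨g.natDegree + 1, lt_of_le_of_lt Polynomial.degree_le_natDegree
      (by exact_mod_cast Nat.lt_succ_self _)⟩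
  exact key n g hn

variable {Ψ : Fin (k + 1) → L⟦X⟧[X]} {g : L⟦X⟧[X]} {c : Expansion L k}

/-- The terms of an expansion have distinct degrees, so that the leading ones do not cancel. -/
lemma IsExpansion.coeff_eq (hc : IsExpansion g Ψ c) (hΨ : ∀ i, (Ψ i).Monic)
    (h0 : 0 < (Ψ 0).natDegree) (hdvd : ∀ i : Fin k, (Ψ i.castSucc).natDegree ∣ (Ψ i.succ).natDegree)
    {b : Fin (k + 1) → ℕ} (hb : b ∈ c.support)
    (hmax : ∀ b' ∈ c.support, ∑ i, b' i * (Ψ i).natDegree ≤ ∑ i, b i * (Ψ i).natDegree) :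
    g.coeff (∑ i, b i * (Ψ i).natDegree) = c b := by
  rw [hc.2, Finsupp.sum, Polynomial.finsetSum_coeff, Finset.sum_eq_single b]
  · rw [Polynomial.coeff_C_mul, ← natDegree_prod_pow hΨ, (monic_prod_pow hΨ b).coeff_natDegree,
      mul_one]
  · intro b' hb' hne
    rw [Polynomial.coeff_C_mul, Polynomial.coeff_eq_zero_of_natDegree_lt, mul_zero]
    rw [natDegree_prod_pow hΨ]
    refine lt_of_le_of_ne (hmax b' hb') fun h => hne ?_
    exact IsAdmissible.injective (D := fun i => (Ψ i).natDegree) (hc.1 b' hb') (hc.1 b hb) h0 hdvd h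
  · intro h
    exact absurd hb h

lemma IsExpansion.weight_le (hc : IsExpansion g Ψ c) (hΨ : ∀ i, (Ψ i).Monic)
    (h0 : 0 < (Ψ 0).natDegree) (hdvd : ∀ i : Fin k, (Ψ i.castSucc).natDegree ∣ (Ψ i.succ).natDegree)
    {b : Fin (k + 1) → ℕ} (hb : b ∈ c.support) :
    ∑ i, b i * (Ψ i).natDegree ≤ g.natDegree := by
  obtain ⟨b₁, hb₁, hmax⟩ := Finset.exists_max_image c.support
    (fun b => ∑ i, b i * (Ψ i).natDegree) ⟨b, hb⟩
  refine le_trans (hmax b hb) (Polynomial.le_natDegree_of_ne_zero ?_)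
  rw [hc.coeff_eq hΨ h0 hdvd hb₁ hmax]
  exact Finsupp.mem_support_iff.1 hb₁

lemma IsExpansion.last_lt (hc : IsExpansion g Ψ c) (hΨ : ∀ i, (Ψ i).Monic)
    (h0 : 0 < (Ψ 0).natDegree) (hdvd : ∀ i : Fin k, (Ψ i.castSucc).natDegree ∣ (Ψ i.succ).natDegree)
    {M : ℕ} (hM : g.degree < ((M * (Ψ (Fin.last k)).natDegree : ℕ) : WithBot ℕ))
    {b : Fin (k + 1) → ℕ} (hb : b ∈ c.support) : b (Fin.last k) < M := by
  have h1 := hc.weight_le hΨ h0 hdvd hb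
  have h2 : b (Fin.last k) * (Ψ (Fin.last k)).natDegree ≤ ∑ i, b i * (Ψ i).natDegree :=
    Finset.single_le_sum (f := fun i => b i * (Ψ i).natDegree) (fun _ _ => Nat.zero_le _)
      (Finset.mem_univ _)
  have hg : g ≠ 0 := by
    rintro rfl
    obtain ⟨b₁, hb₁, hmax⟩ := Finset.exists_max_image c.support
      (fun b => ∑ i, b i * (Ψ i).natDegree) ⟨b, hb⟩
    have := hc.coeff_eq hΨ h0 hdvd hb₁ hmax
    rw [Polynomial.coeff_zero] at this
    exact Finsupp.mem_support_iff.1 hb₁ this.symm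
  rw [Polynomial.degree_eq_natDegree hg] at hM
  have hM' : g.natDegree < M * (Ψ (Fin.last k)).natDegree := by exact_mod_cast hM
  exact lt_of_mul_lt_mul_right (lt_of_le_of_lt (le_trans h2 h1) hM') (Nat.zero_le _)

/-- If `deg g = M deg ψₖ` and `g` is monic, then its expansion is `ψₖ ^ M` plus terms with `bₖ < M`.
-/
lemma IsExpansion.of_monic (hc : IsExpansion g Ψ c) (hΨ : ∀ i, (Ψ i).Monic)
    (h0 : 0 < (Ψ 0).natDegree) (hdvd : ∀ i : Fin k, (Ψ i.castSucc).natDegree ∣ (Ψ i.succ).natDegree)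
    (hpos : 0 < (Ψ (Fin.last k)).natDegree)
    {M : ℕ} (hg : g.Monic) (hM : g.natDegree = M * (Ψ (Fin.last k)).natDegree) :
    c (Pi.single (Fin.last k) M) = 1 ∧
      ∀ b ∈ c.support, b ≠ Pi.single (Fin.last k) M → b (Fin.last k) < M := by
  have hs : ∑ i, (Pi.single (Fin.last k) M : Fin (k + 1) → ℕ) i * (Ψ i).natDegree =
      M * (Ψ (Fin.last k)).natDegree := by
    rw [Finset.sum_eq_single (Fin.last k)]
    · simp
    · intro b _ hb
      simp [hb]
    · simp
  have hadm : IsAdmissible (fun i => (Ψ i).natDegree) (Pi.single (Fin.last k) M) := by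
    intro i
    rw [Pi.single_eq_of_ne (Fin.castSucc_lt_last i).ne, zero_mul]
    have : ∀ i, 0 < (Ψ i).natDegree := by
      intro i
      induction i using Fin.reverseInduction with
      | last => exact hpos
      | cast i ih => exact Nat.pos_of_dvd_of_pos (hdvd i) ih
    exact this _
  have hle : ∀ b ∈ c.support, ∑ i, b i * (Ψ i).natDegree ≤ M * (Ψ (Fin.last k)).natDegree := by
    intro b hb
    rw [← hM]
    exact hc.weight_le hΨ h0 hdvd hb
  have heq : ∀ b ∈ c.support, ∑ i, b i * (Ψ i).natDegree = M * (Ψ (Fin.last k)).natDegree →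
      b = Pi.single (Fin.last k) M := fun b hb h =>
    IsAdmissible.injective (D := fun i => (Ψ i).natDegree) (hc.1 b hb) hadm h0 hdvd
      (h.trans hs.symm)
  obtain ⟨b, hb, hbne⟩ : ∃ b ∈ c.support,
      (Polynomial.C (c b) * ∏ i, Ψ i ^ b i).coeff g.natDegree ≠ 0 := by
    refine Finset.exists_ne_zero_of_sum_ne_zero ?_
    have h1 := congrArg (fun p => p.coeff g.natDegree) hc.2
    simp only [Finsupp.sum, Polynomial.finsetSum_coeff] at h1
    rw [← h1, hg.coeff_natDegree]
    exact one_ne_zero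
  have hbw : ∑ i, b i * (Ψ i).natDegree = M * (Ψ (Fin.last k)).natDegree := by
    refine le_antisymm (hle b hb) ?_
    rw [← hM]
    by_contra! hlt
    apply hbne
    rw [Polynomial.coeff_C_mul, Polynomial.coeff_eq_zero_of_natDegree_lt, mul_zero]
    rwa [natDegree_prod_pow hΨ]
  have hb' := heq b hb hbw
  have hcoef := hc.coeff_eq hΨ h0 hdvd hb (by rw [hbw]; exact hle)
  rw [hbw, ← hM, hg.coeff_natDegree] at hcoef
  refine ⟨by rw [← hb', ← hcoef], ?_⟩
  intro b₁ hb₁ hne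
  by_contra! hge
  apply hne
  apply heq b₁ hb₁
  refine le_antisymm (hle b₁ hb₁) (le_trans (Nat.mul_le_mul_right _ hge) ?_)
  exact Finset.single_le_sum (f := fun i => b₁ i * (Ψ i).natDegree) (fun _ _ => Nat.zero_le _)
      (Finset.mem_univ _)

end Expansion

/-! ### Leading forms of adic expansions -/

section Terms

variable {L : Type*} [Field L] {k : ℕ}

lemma pairing_succ (B V : Fin (k + 2) → ℕ) :
    pairing B V = B 0 * V 0 + ∑ i : Fin (k + 1), B i.succ * V i.succ := by
  rw [pairing, Fin.sum_univ_succ]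

lemma pairing_castSucc (B V : Fin (k + 2) → ℕ) :
    pairing B V = ∑ i : Fin (k + 1), B i.castSucc * V i.castSucc +
      B (Fin.last (k + 1)) * V (Fin.last (k + 1)) := by
  rw [pairing, Fin.sum_univ_castSucc]

/-- The list `V` after the choice of a slope: its entries are multiplied by `q`, and `m` is added
to the last one. -/
def slopeV (q m : ℕ) (V : Fin (k + 2) → ℕ) : Fin (k + 2) → ℕ :=
  fun i => if i = Fin.last (k + 1) then q * V i + m else q * V i

lemma slopeV_last (q m : ℕ) (V : Fin (k + 2) → ℕ) :
    slopeV q m V (Fin.last (k + 1)) = q * V (Fin.last (k + 1)) + m := if_pos rfl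

lemma slopeV_castSucc (q m : ℕ) (V : Fin (k + 2) → ℕ) (i : Fin (k + 1)) :
    slopeV q m V i.castSucc = q * V i.castSucc := if_neg (Fin.castSucc_lt_last i).ne

lemma slopeV_zero (q m : ℕ) (V : Fin (k + 2) → ℕ) :
    slopeV q m V 0 = q * V 0 := slopeV_castSucc q m V 0

lemma pairing_slopeV (q m : ℕ) (B V : Fin (k + 2) → ℕ) :
    pairing B (slopeV q m V) = q * pairing B V + m * B (Fin.last (k + 1)) := by
  rw [pairing_castSucc, pairing_castSucc]
  simp only [slopeV_castSucc, slopeV_last]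
  rw [mul_add q, Finset.mul_sum]
  have : ∀ i : Fin (k + 1), B i.castSucc * (q * V i.castSucc) = q * (B i.castSucc * V i.castSucc) :=
    fun i => by ring
  simp only [this]
  ring

open Classical in
/-- The exponents `B` of the terms of an expansion with `⟨B, V⟩ = n`. -/
noncomputable def terms (c : Expansion L k) (V : Fin (k + 2) → ℕ) (n : ℕ) :
    Finset (Fin (k + 2) → ℕ) :=
  (c.support.biUnion fun b => (Finset.range (n + 1)).image fun a =>
    (Fin.cons a b : Fin (k + 2) → ℕ)).filter fun B => c.f B ≠ 0 ∧ pairing B V = n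

lemma tail_mem_support {c : Expansion L k} {B : Fin (k + 2) → ℕ} (h : c.f B ≠ 0) :
    Fin.tail B ∈ c.support := by
  rw [Finsupp.mem_support_iff]
  intro h0
  rw [Expansion.f, h0, map_zero] at h
  exact h rfl

lemma mem_terms {c : Expansion L k} {V : Fin (k + 2) → ℕ} (hV : V 0 ≠ 0) {n : ℕ}
    {B : Fin (k + 2) → ℕ} : B ∈ terms c V n ↔ c.f B ≠ 0 ∧ pairing B V = n := by
  classical
  rw [terms, Finset.mem_filter, and_iff_right_iff_imp]
  rintro ⟨h1, h2⟩
  rw [Finset.mem_biUnion]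
  refine ⟨Fin.tail B, tail_mem_support h1, Finset.mem_image.2 ⟨B 0, ?_, Fin.cons_self_tail B⟩⟩
  rw [Finset.mem_range, ← h2, pairing_succ]
  have : B 0 ≤ B 0 * V 0 := Nat.le_mul_of_pos_right _ (Nat.pos_of_ne_zero hV)
  omega

lemma f_cons (c : Expansion L k) (a : ℕ) (b : Fin (k + 1) → ℕ) :
    c.f (Fin.cons a b) = PowerSeries.coeff a (c b) := by
  rw [Expansion.f, Fin.cons_zero, Fin.tail_cons]

variable {κ : Type*} [Field κ] [Algebra L κ]

/-- The leading form of an expansion under a substitution for which the leading forms of the `Ψᵢ`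
are known. -/
lemma IsExpansion.hasLead {g : L⟦X⟧[X]} {Φ : Fin (k + 1) → L⟦X⟧[X]} {c : Expansion L k}
    (hc : IsExpansion g Φ c) (ρ : L⟦X⟧[X] →+* κ⟦X⟧[X]) (a : κ) (V : Fin (k + 2) → ℕ)
    (hV : V 0 ≠ 0)
    (hρ : ∀ f, ρ (Polynomial.C f) = Polynomial.C (monSubst (algebraMap L κ) a (V 0) hV f))
    (h : Fin (k + 1) → κ[X]) (hlead : ∀ i, HasLead (V i.succ) (h i) (ρ (Φ i))) (n : ℕ)
    (hn : ∀ B, c.f B ≠ 0 → n ≤ pairing B V) :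
    HasLead n (∑ B ∈ terms c V n,
      Polynomial.C (algebraMap L κ (c.f B) * a ^ B 0) * ∏ i, h i ^ B i.succ) (ρ g) := by
  classical
  have hV0 := Nat.pos_of_ne_zero hV
  rw [hc.2, Finsupp.sum, map_sum]
  set t : (Fin (k + 1) → ℕ) → ℕ := fun b => ∑ i, b i * V i.succ with ht
  set coefT : (Fin (k + 1) → ℕ) → κ := fun b => if t b ≤ n then
    PowerSeries.coeff (n - t b) (monSubst (algebraMap L κ) a (V 0) hV (c b)) else 0 with hcoefT
  have hterm : ∀ b ∈ c.support, HasLead n (Polynomial.C (coefT b) * ∏ i, h i ^ b i)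
      (ρ (Polynomial.C (c b) * ∏ i, Φ i ^ b i)) := by
    intro b _
    have h1 : HasLead (t b) (∏ i, h i ^ b i) (∏ i, ρ (Φ i) ^ b i) :=
      HasLead.prod fun i _ => (hlead i).pow (b i)
    rw [map_mul, map_prod, hρ]
    simp only [map_pow]
    rw [hcoefT]
    by_cases hle : t b ≤ n
    · simp only [if_pos hle]
      have h2 : PowerSeries.X ^ (n - t b) ∣ monSubst (algebraMap L κ) a (V 0) hV (c b) := by
        rw [PowerSeries.X_pow_dvd_iff]
        intro j hj
        by_cases hdvd : V 0 ∣ j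
        · obtain ⟨e, rfl⟩ := hdvd
          rw [coeff_monSubst_mul]
          by_cases h0 : PowerSeries.coeff e (c b) = 0
          · rw [h0, map_zero, zero_mul]
          · exfalso
            have := hn (Fin.cons e b) (by rwa [f_cons])
            rw [pairing_succ, Fin.cons_zero] at this
            simp only [Fin.cons_succ] at this
            have h3 : ∑ i, b i * V i.succ = t b := rfl
            rw [h3, mul_comm e] at this
            omega
        · exact coeff_monSubst_of_not_dvd _ _ _ _ _ hdvd
      have h3 := (hasLead_C h2).mul h1
      rwa [Nat.sub_add_cancel hle] at h3
    · simp only [if_neg hle, map_zero, zero_mul]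
      have h4 : HasLead 0 (Polynomial.C (PowerSeries.constantCoeff
          (monSubst (algebraMap L κ) a (V 0) hV (c b))))
          (Polynomial.C (monSubst (algebraMap L κ) a (V 0) hV (c b))) :=
        hasLead_zero_iff.2 (by simp)
      have h5 := h4.mul h1
      rw [zero_add] at h5
      exact h5.of_lt (by omega)
  have hsum := HasLead.sum hterm
  convert hsum using 1
  refine Finset.sum_of_injOn (fun B : Fin (k + 2) → ℕ => (Fin.tail B : Fin (k + 1) → ℕ)) ?_ ?_ ?_ ?_
  · intro B hB B' hB' heq
    have h1 := ((mem_terms hV).1 (Finset.mem_coe.1 hB)).2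
    have h2 := ((mem_terms hV).1 (Finset.mem_coe.1 hB')).2
    rw [← h2, pairing_succ, pairing_succ] at h1
    have h3 : ∀ i : Fin (k + 1), B i.succ = B' i.succ := fun i => congrFun heq i
    simp only [h3] at h1
    have h4 := Nat.eq_of_mul_eq_mul_right hV0 (Nat.add_right_cancel h1)
    beta_reduce at heq
    rw [← Fin.cons_self_tail B, ← Fin.cons_self_tail B', heq, h4]
  · intro B hB
    exact tail_mem_support ((mem_terms hV).1 (Finset.mem_coe.1 hB)).1
  · intro b hb hnot
    have : coefT b = 0 := by
      rw [hcoefT]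
      beta_reduce
      split_ifs with hle
      · by_cases hdvd : V 0 ∣ n - t b
        · obtain ⟨e, he⟩ := hdvd
          rw [he, coeff_monSubst_mul]
          by_contra hne
          apply hnot
          refine ⟨Fin.cons e b, ?_, Fin.tail_cons _ _⟩
          rw [Finset.mem_coe, mem_terms hV]
          refine ⟨?_, ?_⟩
          · rw [f_cons]
            intro h0
            rw [h0, map_zero, zero_mul] at hne
            exact hne rfl
          · rw [pairing_succ, Fin.cons_zero]
            simp only [Fin.cons_succ]
            have h3 : ∑ i, b i * V i.succ = t b := rfl
            rw [h3, mul_comm e]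
            omega
        · exact coeff_monSubst_of_not_dvd _ _ _ _ _ hdvd
      · rfl
    rw [this, map_zero, zero_mul]
  · intro B hB
    obtain ⟨h1, h2⟩ := (mem_terms hV).1 hB
    rw [pairing_succ] at h2
    have h3 : ∑ i : Fin (k + 1), B i.succ * V i.succ = t (Fin.tail B) := rfl
    rw [h3] at h2
    have h4 : coefT (Fin.tail B) = algebraMap L κ (c.f B) * a ^ B 0 := by
      rw [hcoefT]
      simp only
      rw [if_pos (by omega), show n - t (Fin.tail B) = V 0 * B 0 by rw [mul_comm]; omega,
        coeff_monSubst_mul]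
      rfl
    rw [h4]
    rfl

/-- The polynomial `∑ f_B Λ ^ B y ^ bₖ`, where the sum is over the terms with `⟨B, V⟩ = n`. -/
noncomputable def leadingForm (c : Expansion L k) (V : Fin (k + 2) → ℕ) (Λ : Fin (k + 2) → κ)
    (n : ℕ) : κ[X] :=
  ∑ B ∈ terms c V n, Polynomial.C (algebraMap L κ (c.f B) * ∏ j, Λ j ^ B j) *
    Polynomial.X ^ B (Fin.last (k + 1))

/-- For fixed `⟨B, V⟩` and fixed last entry, the `Λ ^ B` with `B` admissible are linearly
independent over `L`. -/
def IsIndep (L : Type*) [Field L] {κ : Type*} [Field κ] [Algebra L κ] {k : ℕ}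
    (D : Fin (k + 1) → ℕ) (V : Fin (k + 2) → ℕ) (Λ : Fin (k + 2) → κ) : Prop :=
  ∀ (n i : ℕ) (s : Finset (Fin (k + 2) → ℕ)) (f : (Fin (k + 2) → ℕ) → L),
    (∀ B ∈ s, IsAdmissible D (Fin.tail B) ∧ pairing B V = n ∧ B (Fin.last (k + 1)) = i) →
    ∑ B ∈ s, algebraMap L κ (f B) * ∏ j, Λ j ^ B j = 0 → ∀ B ∈ s, f B = 0

/-- A substitution `θ` from `L⟦x⟧[y]` to `κ⟦x⟧[y]` adapted to `x, Φ₀, …, Φₖ`: the images of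
`x` and `Φᵢ` are `Λ x ^ V` times a factor which is `1` at the origin, except for an additional
factor `y` in the image of `Φₖ`. -/
structure IsFrame (V : Fin (k + 2) → ℕ) (Λ : Fin (k + 2) → κ) (Φ : Fin (k + 1) → L⟦X⟧[X])
    (θ : L⟦X⟧[X] →+* κ⟦X⟧[X]) : Prop where
  V_zero : V 0 ≠ 0
  Λ_ne : ∀ i, Λ i ≠ 0
  map_C : ∀ f, θ (Polynomial.C f) =
    Polynomial.C (monSubst (algebraMap L κ) (Λ 0) (V 0) V_zero f)
  lead : ∀ i : Fin k, ∃ h, HasLead (V i.castSucc.succ) h (θ (Φ i.castSucc)) ∧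
    h.coeff 0 = Λ i.castSucc.succ
  lead_last : ∃ U : κ⟦X⟧[X], θ (Φ (Fin.last k)) =
    Polynomial.C (PowerSeries.X ^ V (Fin.last (k + 1))) * (Polynomial.X * U) ∧
    (U.map PowerSeries.constantCoeff).coeff 0 = Λ (Fin.last (k + 1))
  monic : ∀ i, (Φ i).Monic
  natDegree_zero : (Φ 0).natDegree = 1
  dvd : ∀ i : Fin k, (Φ i.castSucc).natDegree ∣ (Φ i.succ).natDegree
  pos : ∀ i, 0 < (Φ i).natDegree
  indep : IsIndep L (fun i => (Φ i).natDegree) V Λ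

namespace IsFrame

variable {V : Fin (k + 2) → ℕ} {Λ : Fin (k + 2) → κ} {Φ : Fin (k + 1) → L⟦X⟧[X]}
  {θ : L⟦X⟧[X] →+* κ⟦X⟧[X]}

lemma slopeV_zero_ne (fr : IsFrame V Λ Φ θ) {q : ℕ} (hq : q ≠ 0) (m : ℕ) : slopeV q m V 0 ≠ 0 := by
  rw [slopeV_zero]
  exact mul_ne_zero hq fr.V_zero

/-- The coefficients of a leading form of an expansion are not zero when they have at least one
term: the terms of the same exponent are independent. -/
lemma sum_ne_zero (fr : IsFrame V Λ Φ θ) {g : L⟦X⟧[X]} {c : Expansion L k}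
    (hc : IsExpansion g Φ c) {n i : ℕ} {s : Finset (Fin (k + 2) → ℕ)}
    (hs : ∀ B ∈ s, c.f B ≠ 0 ∧ pairing B V = n ∧ B (Fin.last (k + 1)) = i) (hne : s.Nonempty) :
    ∑ B ∈ s, algebraMap L κ (c.f B) * ∏ j, Λ j ^ B j ≠ 0 := by
  intro h0
  obtain ⟨B, hB⟩ := hne
  refine (hs B hB).1 (fr.indep n i s c.f (fun B hB => ⟨?_, (hs B hB).2⟩) h0 B hB)
  exact hc.1 _ (tail_mem_support (hs B hB).1)

/-- The leading form of an expansion for the weights `q` of `x` and `m` of `y`: as `m > 0`, each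
`Φᵢ` contributes only its constant `Λ`, and `Φₖ` contributes `λ y`. -/
lemma hasLead_weightSubst (fr : IsFrame V Λ Φ θ) {g : L⟦X⟧[X]} {c : Expansion L k}
    (hc : IsExpansion g Φ c) {q m n : ℕ} (hq : q ≠ 0) (hm : m ≠ 0)
    (hn : ∀ B, c.f B ≠ 0 → n ≤ pairing B (slopeV q m V)) :
    HasLead n (leadingForm c (slopeV q m V) Λ n) (weightSubst κ q hq m (θ g)) := by
  have hV' := fr.slopeV_zero_ne hq m
  obtain ⟨U, hU, hUc⟩ := fr.lead_last
  have key := hc.hasLead ((weightSubst κ q hq m).comp θ) (Λ 0) (slopeV q m V) hV' (by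
      intro f
      rw [RingHom.comp_apply, fr.map_C, puiseux_C, monSubst_monSubst]
      congr 1
      exact monSubst_congr _ (by simp) (slopeV_zero q m V).symm _ f)
    (fun i => if i = Fin.last k then Polynomial.C (Λ i.succ) * Polynomial.X
      else Polynomial.C (Λ i.succ)) (by
      intro i
      refine Fin.lastCases ?_ (fun j => ?_) i
      · rw [if_pos rfl, RingHom.comp_apply, hU, Fin.succ_last, slopeV_last, map_mul, map_mul,
          puiseux_X]
        have h1 := (hasLead_C (dvd_refl (PowerSeries.X ^ V (Fin.last (k + 1)) : κ⟦X⟧))).map_puiseux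
          (RingHom.id κ) 1 0 q hq hm
        have h2 : HasLead (m + 0) (Polynomial.X : κ[X]) (Polynomial.C (PowerSeries.X ^ m) *
            (Polynomial.X + Polynomial.C (PowerSeries.C 0))) := by
          rw [hasLead_C_mul_iff, hasLead_zero_iff]
          simp
        have h3 := (hasLead_zero_iff.2 (rfl : U.map PowerSeries.constantCoeff = _)).map_puiseux
          (RingHom.id κ) 1 0 q hq hm
        have h4 := h1.mul (h2.mul h3)
        simp only [mul_zero, add_zero] at h4
        convert h4 using 1
        rw [hUc, PowerSeries.coeff_X_pow_self, Polynomial.coeff_C_zero]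
        simp only [map_one, one_pow, mul_one, one_mul, RingHom.id_apply]
        exact mul_comm _ _
      · have e : slopeV q m V j.castSucc.succ = q * V j.castSucc.succ := by
          rw [Fin.succ_castSucc, slopeV_castSucc]
        rw [if_neg (Fin.castSucc_lt_last j).ne, e]
        obtain ⟨h, h1, h2⟩ := fr.lead j
        have h3 := h1.map_puiseux (RingHom.id κ) 1 0 q hq hm
        rw [h2] at h3
        rw [RingHom.comp_apply]
        simpa only [RingHom.id_apply, one_pow, mul_one] using h3) n hn
  rw [RingHom.comp_apply] at key
  rw [leadingForm]
  convert key using 1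
  refine Finset.sum_congr rfl fun B _ => ?_
  rw [Fin.prod_univ_castSucc (fun i : Fin (k + 1) => _ ^ B i.succ), if_pos rfl, Fin.succ_last,
    mul_pow, Fin.prod_univ_succ (fun j => Λ j ^ B j),
    Fin.prod_univ_castSucc (fun i : Fin (k + 1) => Λ i.succ ^ B i.succ), Fin.succ_last]
  have : ∀ i : Fin k, (if i.castSucc = Fin.last k then
      Polynomial.C (Λ i.castSucc.succ) * Polynomial.X else Polynomial.C (Λ i.castSucc.succ)) ^
        B i.castSucc.succ = Polynomial.C (Λ i.castSucc.succ ^ B i.castSucc.succ) := fun i => by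
    rw [if_neg (Fin.castSucc_lt_last i).ne, Polynomial.C_pow]
  simp only [this]
  rw [← map_prod]
  simp only [Polynomial.C_mul, Polynomial.C_pow]
  ring

/-- The coefficient of `y ^ i` in the leading form of an expansion. -/
lemma coeff_lead (c : Expansion L k) (V' : Fin (k + 2) → ℕ) (Λ : Fin (k + 2) → κ) (n i : ℕ) :
    (leadingForm c V' Λ n).coeff i =
    ∑ B ∈ (terms c V' n).filter fun B => B (Fin.last (k + 1)) = i,
      algebraMap L κ (c.f B) * ∏ j, Λ j ^ B j := by
  rw [leadingForm, Polynomial.finsetSum_coeff, Finset.sum_filter]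
  refine Finset.sum_congr rfl fun B _ => ?_
  rw [Polynomial.coeff_C_mul, Polynomial.coeff_X_pow]
  simp only [eq_comm (a := i)]
  split_ifs <;> simp

lemma coeff_lead_ne_zero_iff (fr : IsFrame V Λ Φ θ) {g : L⟦X⟧[X]} {c : Expansion L k}
    (hc : IsExpansion g Φ c) {q : ℕ} (hq : q ≠ 0) (m n i : ℕ) :
    (leadingForm c (slopeV q m V) Λ n).coeff i ≠ 0 ↔
    ∃ B, c.f B ≠ 0 ∧ pairing B (slopeV q m V) = n ∧ B (Fin.last (k + 1)) = i := by
  rw [coeff_lead]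
  have hmem : ∀ B, B ∈ ((terms c (slopeV q m V) n).filter fun B => B (Fin.last (k + 1)) = i) ↔
      c.f B ≠ 0 ∧ pairing B (slopeV q m V) = n ∧ B (Fin.last (k + 1)) = i := by
    intro B
    rw [Finset.mem_filter, mem_terms (fr.slopeV_zero_ne hq m), and_assoc]
  constructor
  · intro h
    obtain ⟨B, hB, _⟩ := Finset.exists_ne_zero_of_sum_ne_zero h
    exact ⟨B, (hmem B).1 hB⟩
  · rintro ⟨B, hB⟩
    refine fr.sum_ne_zero (n := pairing B V) (i := i) hc (fun B' hB' => ?_) ⟨B, (hmem B).2 hB⟩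
    obtain ⟨h1, h2, h3⟩ := (hmem B').1 hB'
    refine ⟨h1, ?_, h3⟩
    have h4 := hB.2.1
    rw [← h2, pairing_slopeV, pairing_slopeV, hB.2.2, h3] at h4
    exact Nat.eq_of_mul_eq_mul_left (Nat.pos_of_ne_zero hq) (Nat.add_right_cancel h4.symm)

/-- A lower bound for the weighted order is a lower bound for the weights of all the terms. -/
lemma le_pairing (fr : IsFrame V Λ Φ θ) {g : L⟦X⟧[X]} {c : Expansion L k}
    (hc : IsExpansion g Φ c) {q m n : ℕ} (hq : q ≠ 0) (hm : m ≠ 0) {h : κ[X]}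
    (hn : HasLead n h (weightSubst κ q hq m (θ g))) {B : Fin (k + 2) → ℕ} (hB : c.f B ≠ 0) :
    n ≤ pairing B (slopeV q m V) := by
  obtain ⟨B₀, hB₀, hmin⟩ : ∃ B₀, c.f B₀ ≠ 0 ∧ ∀ B, c.f B ≠ 0 →
      pairing B₀ (slopeV q m V) ≤ pairing B (slopeV q m V) := by
    obtain ⟨B₀, h1, h2⟩ := WellFounded.has_min
      (measure fun B => pairing B (slopeV q m V)).wf {B | c.f B ≠ 0} ⟨B, hB⟩
    exact ⟨B₀, h1, fun B hB => not_lt.1 (h2 B hB)⟩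
  refine le_trans ?_ (hmin B hB)
  have h1 := fr.hasLead_weightSubst hc hq hm hmin
  refine h1.order_le hn ?_
  intro h0
  have := (fr.coeff_lead_ne_zero_iff hc hq m (pairing B₀ (slopeV q m V))
    (B₀ (Fin.last (k + 1)))).2 ⟨B₀, hB₀, rfl, rfl⟩
  rw [h0, Polynomial.coeff_zero] at this
  exact this rfl

/-- If the image of `g` has order `M vₖ` in `x`, and then order `M` in `y`, then the terms with
`bₖ < M` of its expansion are strictly above the slope zero. -/
lemma lt_pairing (fr : IsFrame V Λ Φ θ) {g : L⟦X⟧[X]} {c : Expansion L k}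
    (hc : IsExpansion g Φ c) {M : ℕ} {u : κ[X]} (hu : u.coeff 0 ≠ 0)
    (hlead : HasLead (M * V (Fin.last (k + 1))) (Polynomial.X ^ M * u) (θ g))
    {B : Fin (k + 2) → ℕ} (hB : c.f B ≠ 0) (hlast : B (Fin.last (k + 1)) < M) :
    M * V (Fin.last (k + 1)) < pairing B V := by
  obtain ⟨U, hU, hUc⟩ := fr.lead_last
  obtain ⟨B₀, hB₀, hmin⟩ : ∃ B₀, c.f B₀ ≠ 0 ∧ ∀ B, c.f B ≠ 0 → pairing B₀ V ≤ pairing B V := by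
    obtain ⟨B₀, h1, h2⟩ := WellFounded.has_min
      (measure fun B => pairing B V).wf {B | c.f B ≠ 0} ⟨B, hB⟩
    exact ⟨B₀, h1, fun B hB => not_lt.1 (h2 B hB)⟩
  choose h hh1 hh2 using fr.lead
  set hf : Fin (k + 1) → κ[X] := fun i =>
    Fin.lastCases (motive := fun _ => κ[X]) (Polynomial.X * U.map PowerSeries.constantCoeff) h i
    with hhf
  have key := hc.hasLead θ (Λ 0) V fr.V_zero fr.map_C hf (by
    intro i
    refine Fin.lastCases ?_ (fun j => ?_) i
    · rw [hhf]
      simp only [Fin.lastCases_last]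
      rw [hU, Fin.succ_last]
      have h1 : HasLead 0 (Polynomial.X * U.map PowerSeries.constantCoeff) (Polynomial.X * U) :=
        hasLead_zero_iff.2 (by simp)
      simpa using (hasLead_C_mul_iff (a := V (Fin.last (k + 1)))).2 h1
    · rw [hhf]
      simp only [Fin.lastCases_castSucc]
      exact hh1 j) (pairing B₀ V) hmin
  set n₀ := pairing B₀ V with hn₀
  -- among the terms of minimal weight, those with the smallest exponent `i₀` of `ψₖ` determine the
  -- coefficient of `y ^ i₀` of the leading form
  obtain ⟨B₁, hB₁, hmin₁⟩ := Finset.exists_min_image (terms c V n₀)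
    (fun B => B (Fin.last (k + 1))) ⟨B₀, (mem_terms fr.V_zero).2 ⟨hB₀, rfl⟩⟩
  set i₀ := B₁ (Fin.last (k + 1)) with hi₀
  set T := ∑ B ∈ terms c V n₀,
      Polynomial.C (algebraMap L κ (c.f B) * Λ 0 ^ B 0) * ∏ i, hf i ^ B i.succ with hT
  have hcoeff : T.coeff i₀ = ∑ B ∈ (terms c V n₀).filter fun B => B (Fin.last (k + 1)) = i₀,
      algebraMap L κ (c.f B) * ∏ j, Λ j ^ B j := by
    rw [hT, Polynomial.finsetSum_coeff, Finset.sum_filter]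
    refine Finset.sum_congr rfl fun B hB => ?_
    rw [Polynomial.coeff_C_mul, Fin.prod_univ_castSucc (fun i : Fin (k + 1) => _ ^ B i.succ)]
    have e1 : hf (Fin.last k) = Polynomial.X * U.map PowerSeries.constantCoeff := by
      rw [hhf]; simp only [Fin.lastCases_last]
    have e2 : ∀ i : Fin k, hf i.castSucc = h i := by
      intro i; rw [hhf]; simp only [Fin.lastCases_castSucc]
    simp only [e1, e2, Fin.succ_last, mul_pow]
    rw [mul_left_comm, Polynomial.coeff_X_pow_mul']
    have hle := hmin₁ B hB
    split_ifs with h1 h2 h2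
    · rw [h2, Nat.sub_self, Polynomial.coeff_zero_eq_eval_zero, Polynomial.eval_mul,
        Polynomial.eval_prod, Polynomial.eval_pow, ← Polynomial.coeff_zero_eq_eval_zero, hUc,
        Fin.prod_univ_succ (fun j => Λ j ^ B j),
        Fin.prod_univ_castSucc (fun i : Fin (k + 1) => Λ i.succ ^ B i.succ), Fin.succ_last, h2]
      simp only [Polynomial.eval_pow, ← Polynomial.coeff_zero_eq_eval_zero, hh2]
      ring
    · exact absurd (le_antisymm h1 hle) h2
    · exact absurd (le_of_eq h2) h1
    · rw [mul_zero]
  have hne : T.coeff i₀ ≠ 0 := by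
    rw [hcoeff]
    refine fr.sum_ne_zero (n := n₀) (i := i₀) hc (fun B hB => ?_)
      ⟨B₁, Finset.mem_filter.2 ⟨hB₁, rfl⟩⟩
    obtain ⟨h1, h2⟩ := Finset.mem_filter.1 hB
    exact ⟨((mem_terms fr.V_zero).1 h1).1, ((mem_terms fr.V_zero).1 h1).2, h2⟩
  have hT0 : T ≠ 0 := by
    intro h0
    rw [h0, Polynomial.coeff_zero] at hne
    exact hne rfl
  have hXu : Polynomial.X ^ M * u ≠ 0 :=
    mul_ne_zero (pow_ne_zero _ Polynomial.X_ne_zero) (by rintro rfl; simp at hu)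
  have hord : n₀ = M * V (Fin.last (k + 1)) := key.order_eq hlead hT0 hXu
  rw [← hord] at hlead
  have heq := key.unique hlead
  have hMi : M ≤ i₀ := by
    by_contra! hlt
    rw [heq, Polynomial.coeff_X_pow_mul', if_neg (by omega)] at hne
    exact hne rfl
  rw [← hord]
  refine lt_of_le_of_ne (hmin B hB) fun h => ?_
  have := hmin₁ B ((mem_terms fr.V_zero).2 ⟨hB, h.symm⟩)
  omega

end IsFrame

end Terms

/-! ### Slopes of generalised Newton polygons -/

section Slope

/-- In a family of fractions of natural numbers with bounded denominators, one is minimal. -/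
lemma exists_min_fraction {α : Type*} {S : Set α} (hS : S.Nonempty) (x y : α → ℕ) {M : ℕ}
    (hy : ∀ a ∈ S, 0 < y a ∧ y a ≤ M) : ∃ a ∈ S, ∀ b ∈ S, x a * y b ≤ x b * y a := by
  obtain ⟨a, ha, hmin⟩ := WellFounded.has_min
    (measure fun a => x a * (M.factorial / y a)).wf S hS
  refine ⟨a, ha, fun b hb => ?_⟩
  have h1 : x a * (M.factorial / y a) ≤ x b * (M.factorial / y b) := not_lt.1 (hmin b hb)
  have e1 := Nat.div_mul_cancel (Nat.dvd_factorial (hy a ha).1 (hy a ha).2)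
  have e2 := Nat.div_mul_cancel (Nat.dvd_factorial (hy b hb).1 (hy b hb).2)
  refine Nat.le_of_mul_le_mul_left ?_ (Nat.factorial_pos M)
  calc M.factorial * (x a * y b) = x a * (M.factorial / y a) * (y a * y b) := by
        rw [← e1]; simp only [Nat.mul_div_cancel _ (hy a ha).1]; ring
    _ ≤ x b * (M.factorial / y b) * (y a * y b) := Nat.mul_le_mul_right _ h1
    _ = M.factorial * (x b * y a) := by
        rw [← e2]; simp only [Nat.mul_div_cancel _ (hy b hb).1]; ring

variable {L : Type*} [Field L] {k : ℕ} {κ : Type*} [Field κ] [Algebra L κ]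
  {V : Fin (k + 2) → ℕ} {Λ : Fin (k + 2) → κ} {Φ : Fin (k + 1) → L⟦X⟧[X]}
  {θ : L⟦X⟧[X] →+* κ⟦X⟧[X]}

namespace IsFrame

lemma exists_isExpansion (fr : IsFrame V Λ Φ θ) (g : L⟦X⟧[X]) : ∃ c, IsExpansion g Φ c :=
  ApproxRootTest.exists_isExpansion fr.monic fr.natDegree_zero fr.pos g

lemma f_of_monic (fr : IsFrame V Λ Φ θ) {g : L⟦X⟧[X]} {c : Expansion L k}
    (hc : IsExpansion g Φ c) (hg : g.Monic) {M : ℕ}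
    (hM : g.natDegree = M * (Φ (Fin.last k)).natDegree) :
    c.f (Pi.single (Fin.last (k + 1)) M) = 1 ∧
      ∀ B, c.f B ≠ 0 → B = Pi.single (Fin.last (k + 1)) M ∨ B (Fin.last (k + 1)) < M := by
  obtain ⟨h1, h2⟩ := hc.of_monic fr.monic (fr.pos 0) fr.dvd (fr.pos _) hg hM
  have htail : (Pi.single (Fin.last (k + 1)) M : Fin (k + 2) → ℕ) =
      Fin.cons 0 (Pi.single (Fin.last k) M) := by
    funext i
    refine Fin.cases ?_ (fun j => ?_) i
    · rw [Fin.cons_zero, Pi.single_eq_of_ne (Fin.last_pos).ne]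
    · rw [Fin.cons_succ, ← Fin.succ_last]
      by_cases hj : j = Fin.last k
      · rw [hj, Pi.single_eq_same, Pi.single_eq_same]
      · rw [Pi.single_eq_of_ne hj, Pi.single_eq_of_ne fun h => hj (Fin.succ_injective _ h)]
  refine ⟨by rw [htail, f_cons, h1]; simp, fun B hB => ?_⟩
  by_cases hne : Fin.tail B = Pi.single (Fin.last k) M
  · left
    rw [Expansion.f, hne, h1, PowerSeries.coeff_one] at hB
    have h0 : B 0 = 0 := by by_contra h; simp [h] at hB
    rw [htail, ← Fin.cons_self_tail B, hne, h0]
  · right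
    exact h2 _ (tail_mem_support hB) hne

lemma pairing_single (V : Fin (k + 2) → ℕ) (M : ℕ) :
    pairing (Pi.single (Fin.last (k + 1)) M) V = M * V (Fin.last (k + 1)) := by
  rw [pairing, Finset.sum_eq_single (Fin.last (k + 1))]
  · rw [Pi.single_eq_same]
  · intro b _ hb
    rw [Pi.single_eq_of_ne hb, zero_mul]
  · simp

/-- The leading form of a monic polynomial above the slope `m / q` has the expected degree and
leading coefficient. -/
lemma lead_of_monic (fr : IsFrame V Λ Φ θ) {g : L⟦X⟧[X]} (hg : g.Monic) {M : ℕ}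
    (hM : g.natDegree = M * (Φ (Fin.last k)).natDegree) {q m : ℕ} (hq : q ≠ 0) (hm : m ≠ 0)
    {h : κ[X]} (hh : HasLead (M * (q * V (Fin.last (k + 1)) + m)) h (weightSubst κ q hq m (θ g))) :
    h.natDegree ≤ M ∧ h.coeff M = Λ (Fin.last (k + 1)) ^ M := by
  obtain ⟨c, hc⟩ := fr.exists_isExpansion g
  obtain ⟨h1, h2⟩ := fr.f_of_monic hc hg hM
  have h3 := fr.hasLead_weightSubst hc hq hm fun B hB => fr.le_pairing hc hq hm hh hB
  obtain rfl := hh.unique h3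
  refine ⟨?_, ?_⟩
  · rw [Polynomial.natDegree_le_iff_coeff_eq_zero]
    intro i hi
    by_contra hne
    obtain ⟨B, hB, -, hlast⟩ := (fr.coeff_lead_ne_zero_iff hc hq m _ i).1 hne
    rcases h2 B hB with rfl | h
    · rw [Pi.single_eq_same] at hlast
      omega
    · omega
  · rw [coeff_lead, Finset.sum_eq_single (Pi.single (Fin.last (k + 1)) M)]
    · rw [h1, map_one, one_mul, Finset.prod_eq_single (Fin.last (k + 1))]
      · rw [Pi.single_eq_same]
      · intro b _ hb
        rw [Pi.single_eq_of_ne hb, pow_zero]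
      · simp
    · intro B hB hne
      obtain ⟨h4, h5⟩ := Finset.mem_filter.1 hB
      have h6 := ((mem_terms (fr.slopeV_zero_ne hq m)).1 h4).1
      rcases h2 B h6 with h | h
      · exact absurd h hne
      · omega
    · intro hnot
      exfalso
      apply hnot
      rw [Finset.mem_filter, mem_terms (fr.slopeV_zero_ne hq m)]
      refine ⟨⟨by rw [h1]; exact one_ne_zero, ?_⟩, Pi.single_eq_same _ _⟩
      rw [pairing_single, slopeV_last]

lemma lead_degree_lt (fr : IsFrame V Λ Φ θ) {g : L⟦X⟧[X]} {M : ℕ}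
    (hM : g.degree < ((M * (Φ (Fin.last k)).natDegree : ℕ) : WithBot ℕ)) {q m n : ℕ}
    (hq : q ≠ 0) (hm : m ≠ 0) {h : κ[X]} (hh : HasLead n h (weightSubst κ q hq m (θ g))) :
    h.degree < M := by
  obtain ⟨c, hc⟩ := fr.exists_isExpansion g
  have h3 := fr.hasLead_weightSubst hc hq hm fun B hB => fr.le_pairing hc hq hm hh hB
  obtain rfl := hh.unique h3
  rw [Polynomial.degree_lt_iff_coeff_zero]
  intro i hi
  by_contra hne
  obtain ⟨B, hB, -, hlast⟩ := (fr.coeff_lead_ne_zero_iff hc hq m _ i).1 hne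
  have := hc.last_lt fr.monic (fr.pos 0) fr.dvd hM (tail_mem_support hB)
  have e : Fin.tail B (Fin.last k) = B (Fin.last (k + 1)) := rfl
  omega

/-- The leading form of an approximate root is an approximate root of the leading form. -/
lemma lead_approxRoot (fr : IsFrame V Λ Φ θ) {F ψ : L⟦X⟧[X]} {N₁ M : ℕ}
    (hFd : F.natDegree = N₁ * M * (Φ (Fin.last k)).natDegree) (hN₁ : (N₁ : κ) ≠ 0)
    (hψ : IsApproxRoot F N₁ ψ) {q m : ℕ} (hq : q ≠ 0) (hm : m ≠ 0) {h h₀ : κ[X]}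
    (hlead : HasLead (N₁ * M * (q * V (Fin.last (k + 1)) + m)) (h₀ ^ N₁)
      (weightSubst κ q hq m (θ F)))
    (hleadψ : HasLead (M * (q * V (Fin.last (k + 1)) + m)) h (weightSubst κ q hq m (θ ψ)))
    (hd₀ : h₀.natDegree ≤ M) (hc₀ : h₀.coeff M = Λ (Fin.last (k + 1)) ^ M) : h = h₀ := by
  have hpos : 0 < N₁ := Nat.pos_of_ne_zero fun h => hN₁ (by simp [h])
  have hψd : ψ.natDegree = M * (Φ (Fin.last k)).natDegree := by
    rw [hψ.natDegree_eq hpos, hFd, mul_assoc, Nat.mul_div_cancel_left _ hpos]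
  obtain ⟨hd, hc⟩ := fr.lead_of_monic hψ.1 hψd hq hm hleadψ
  refine eq_of_degree_pow_sub_pow_lt hd hd₀ (hc.trans hc₀.symm) (by
    rw [hc₀]; exact pow_ne_zero _ (fr.Λ_ne _)) hN₁ ?_
  have h1 := hleadψ.pow N₁
  rw [← mul_assoc, ← map_pow, ← map_pow] at h1
  have h2 := hlead.sub h1
  rw [← map_sub, ← map_sub] at h2
  have h3 := fr.lead_degree_lt (M := (N₁ - 1) * M) (lt_of_lt_of_eq hψ.2.2 (by
    rw [hFd, mul_assoc, Nat.mul_div_cancel_left _ hpos, Nat.sub_mul, Nat.sub_mul, one_mul,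
      mul_assoc])) hq hm h2
  rwa [← neg_sub, Polynomial.degree_neg]

/-- If `F` is above the slope `m / q`, then so are its approximate roots: otherwise the leading form
of `F` for the slope of the lowest edge of `ψ` would be a monomial, and that of `ψ` would not. -/
lemma exists_lead_approxRoot (fr : IsFrame V Λ Φ θ) {F ψ : L⟦X⟧[X]} {N₁ M : ℕ} (hF : F.Monic)
    (hFd : F.natDegree = N₁ * M * (Φ (Fin.last k)).natDegree) (hN₁ : (N₁ : κ) ≠ 0)
    (hψ : IsApproxRoot F N₁ ψ) {u : κ[X]} (hu : u.coeff 0 ≠ 0)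
    (hlead₀ : HasLead (M * V (Fin.last (k + 1))) (Polynomial.X ^ M * u) (θ ψ))
    {q m : ℕ} (hq : q ≠ 0) (hm : m ≠ 0) {hF' : κ[X]}
    (hlead : HasLead (N₁ * M * (q * V (Fin.last (k + 1)) + m)) hF' (weightSubst κ q hq m (θ F))) :
    ∃ h, HasLead (M * (q * V (Fin.last (k + 1)) + m)) h (weightSubst κ q hq m (θ ψ)) := by
  have hpos : 0 < N₁ := Nat.pos_of_ne_zero fun h => hN₁ (by simp [h])
  have hψd : ψ.natDegree = M * (Φ (Fin.last k)).natDegree := by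
    rw [hψ.natDegree_eq hpos, hFd, mul_assoc, Nat.mul_div_cancel_left _ hpos]
  obtain ⟨c, hc⟩ := fr.exists_isExpansion ψ
  obtain ⟨htop, hlt⟩ := fr.f_of_monic hc hψ.1 hψd
  set v := V (Fin.last (k + 1)) with hv
  by_cases hall : ∀ B, c.f B ≠ 0 → M * (q * v + m) ≤ pairing B (slopeV q m V)
  · exact ⟨_, fr.hasLead_weightSubst hc hq hm hall⟩
  exfalso
  push Not at hall
  obtain ⟨B₁, hB₁, hB₁'⟩ := hall
  have hlast : ∀ B, c.f B ≠ 0 → pairing B (slopeV q m V) < M * (q * v + m) →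
      B (Fin.last (k + 1)) < M := by
    intro B hB h
    rcases hlt B hB with rfl | h'
    · rw [pairing_single, slopeV_last] at h
      exact absurd h (lt_irrefl _)
    · exact h'
  obtain ⟨B₀, ⟨hB₀, hB₀'⟩, hmin⟩ := exists_min_fraction
    (S := {B | c.f B ≠ 0 ∧ B (Fin.last (k + 1)) < M}) ⟨B₁, hB₁, hlast B₁ hB₁ hB₁'⟩
    (fun B => pairing B V - M * v) (fun B => M - B (Fin.last (k + 1))) (M := M)
    (fun B hB => ⟨Nat.sub_pos_of_lt hB.2, Nat.sub_le _ _⟩)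
  have hx : ∀ B, c.f B ≠ 0 → B (Fin.last (k + 1)) < M → ∃ x, 0 < x ∧ pairing B V = M * v + x := by
    intro B hB h
    have : M * v < pairing B V := fr.lt_pairing hc hu hlead₀ hB h
    exact ⟨pairing B V - M * v, by omega, by omega⟩
  obtain ⟨m', hm', hpm'⟩ := hx B₀ hB₀ hB₀'
  obtain ⟨q', hq'⟩ := Nat.exists_eq_add_of_lt hB₀'
  have hmin' : ∀ B, c.f B ≠ 0 → ∀ x y, pairing B V = M * v + x →
      M = B (Fin.last (k + 1)) + y → 0 < y → m' * y ≤ x * (q' + 1) := by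
    intro B hB x y h1 h2 h3
    have := hmin B ⟨hB, by omega⟩
    beta_reduce at this
    rwa [hpm', h1, Nat.add_sub_cancel_left, Nat.add_sub_cancel_left,
      show M - B (Fin.last (k + 1)) = y by omega,
      show M - B₀ (Fin.last (k + 1)) = q' + 1 by omega] at this
  -- the slope `m' / (q' + 1)` is smaller than `m / q`
  have hslope : q * m' < m * (q' + 1) := by
    have h1 := hlast B₁ hB₁ hB₁'
    obtain ⟨x, hx0, hpx⟩ := hx B₁ hB₁ h1
    obtain ⟨y, hy⟩ := Nat.exists_eq_add_of_lt h1
    have h2 := hmin' B₁ hB₁ x (y + 1) hpx (by omega) (by omega)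
    rw [pairing_slopeV, hpx] at hB₁'
    have h3 : q * x < m * (y + 1) := by
      have : M * (q * v + m) = q * (M * v) + m * (B₁ (Fin.last (k + 1)) + y + 1) := by
        rw [← hy]; ring
      rw [this] at hB₁'
      nlinarith
    have h4 : q * m' * (y + 1) < m * (q' + 1) * (y + 1) := by
      calc q * m' * (y + 1) = q * (m' * (y + 1)) := by ring
        _ ≤ q * (x * (q' + 1)) := Nat.mul_le_mul_left _ h2
        _ = q * x * (q' + 1) := by ring
        _ < m * (y + 1) * (q' + 1) := Nat.mul_lt_mul_of_pos_right h3 (by omega)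
        _ = m * (q' + 1) * (y + 1) := by ring
    exact lt_of_mul_lt_mul_right h4 (Nat.zero_le _)
  have hqne : q' + 1 ≠ 0 := by omega
  have hleadψ := fr.hasLead_weightSubst (n := M * ((q' + 1) * v + m')) hc hqne hm'.ne' (by
    intro B hB
    rcases hlt B hB with rfl | h'
    · rw [pairing_single, slopeV_last]
    · obtain ⟨x, hx0, hpx⟩ := hx B hB h'
      obtain ⟨y, hy⟩ := Nat.exists_eq_add_of_lt h'
      have h2 := hmin' B hB x (y + 1) hpx (by omega) (by omega)
      rw [pairing_slopeV, hpx]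
      have : M * ((q' + 1) * v + m') =
          (q' + 1) * (M * v) + m' * (B (Fin.last (k + 1)) + y + 1) := by
        rw [← hy]; ring
      rw [this]
      nlinarith)
  obtain ⟨cF, hcF⟩ := fr.exists_isExpansion F
  obtain ⟨-, hltF⟩ := fr.f_of_monic hcF hF hFd
  have hstrict : ∀ B, cF.f B ≠ 0 → B (Fin.last (k + 1)) < N₁ * M →
      N₁ * M * ((q' + 1) * v + m') < pairing B (slopeV (q' + 1) m' V) := by
    intro B hB h'
    have h1 := fr.le_pairing hcF hq hm hlead hB
    rw [pairing_slopeV] at h1 ⊢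
    set N := N₁ * M
    obtain ⟨y, hy⟩ := Nat.exists_eq_add_of_lt h'
    have e1 : N * (q * v + m) = q * (N * v) + m * (y + 1) + m * B (Fin.last (k + 1)) := by
      conv_lhs => rw [mul_add, hy]
      conv_rhs => rw [hy]
      ring
    have e2 : N * ((q' + 1) * v + m') =
        (q' + 1) * (N * v) + m' * (y + 1) + m' * B (Fin.last (k + 1)) := by
      conv_lhs => rw [mul_add, hy]
      conv_rhs => rw [hy]
      ring
    rw [e1] at h1
    rw [e2]
    have h2 : q * (N * v) + m * (y + 1) ≤ q * pairing B V := Nat.add_le_add_iff_right.1 h1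
    have h3 : (q' + 1) * (N * v) + m' * (y + 1) < (q' + 1) * pairing B V := by
      refine lt_of_mul_lt_mul_left (a := q) ?_ (Nat.zero_le _)
      calc q * ((q' + 1) * (N * v) + m' * (y + 1))
          = (q' + 1) * (q * (N * v)) + q * m' * (y + 1) := by ring
        _ < (q' + 1) * (q * (N * v)) + m * (q' + 1) * (y + 1) :=
          Nat.add_lt_add_left (Nat.mul_lt_mul_of_pos_right hslope (by omega)) _
        _ = (q' + 1) * (q * (N * v) + m * (y + 1)) := by ring
        _ ≤ (q' + 1) * (q * pairing B V) := Nat.mul_le_mul_left _ h2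
        _ = q * ((q' + 1) * pairing B V) := by ring
    exact Nat.add_lt_add_right h3 _
  have hleadF := fr.hasLead_weightSubst (n := N₁ * M * ((q' + 1) * v + m')) hcF hqne hm'.ne' (by
    intro B hB
    rcases hltF B hB with rfl | h'
    · rw [pairing_single, slopeV_last]
    · exact (hstrict B hB h').le)
  obtain ⟨hFd1, hFd2⟩ := fr.lead_of_monic hF hFd hqne hm'.ne' hleadF
  have hFeq : leadingForm cF (slopeV (q' + 1) m' V) Λ (N₁ * M * ((q' + 1) * v + m')) =
      (Polynomial.C (Λ (Fin.last (k + 1)) ^ M) * Polynomial.X ^ M) ^ N₁ := by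
    rw [mul_pow, ← Polynomial.C_pow, ← pow_mul, ← pow_mul, mul_comm M N₁]
    ext i
    rw [Polynomial.coeff_C_mul, Polynomial.coeff_X_pow]
    split_ifs with hi
    · rw [hi, hFd2, mul_one]
    · rw [mul_zero]
      by_contra hne
      obtain ⟨B, hB, hBn, hBl⟩ := (fr.coeff_lead_ne_zero_iff hcF hqne m' _ i).1 hne
      rcases hltF B hB with rfl | h'
      · rw [Pi.single_eq_same] at hBl
        exact hi hBl.symm
      · exact absurd hBn (hstrict B hB h').ne'
  rw [hFeq] at hleadF
  have heq := fr.lead_approxRoot hFd hN₁ hψ hqne hm'.ne' hleadF hleadψ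
    (Polynomial.natDegree_C_mul_X_pow_le _ _)
    (by rw [Polynomial.coeff_C_mul, Polynomial.coeff_X_pow, if_pos rfl, mul_one])
  have hne := (fr.coeff_lead_ne_zero_iff hc hqne m' (M * ((q' + 1) * v + m'))
    (B₀ (Fin.last (k + 1)))).2 ⟨B₀, hB₀, by
      rw [pairing_slopeV, hpm']
      conv_rhs => rw [mul_add]
      conv_rhs => rw [hq']
      conv_lhs => rw [hq']
      ring, rfl⟩
  rw [heq, Polynomial.coeff_C_mul, Polynomial.coeff_X_pow, if_neg (by omega), mul_zero] at hne
  exact hne rfl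

end IsFrame

end Slope

/-! ### The boundary polynomial as a leading form -/

section Boundary

variable {K : Type*} [Field K] {κ : Type*} [Field κ] [Algebra K κ] {k : ℕ}

lemma coeff_boundaryPol (N : ℕ) (V : Fin (k + 2) → ℕ) (Λ : Fin (k + 2) → κ) (c : Expansion K k)
    (i : ℕ) (h : OnLowestEdge (ordinate N V c) N i) : (boundaryPol N V Λ c).coeff i =
      Polynomial.C (boundaryCoeff N V Λ c i (minVal V c i).toNat) *
        Polynomial.X ^ ((ordinate N V c i).untopD 0).toNat := by
  rw [boundaryPol, Polynomial.finsetSum_coeff, Finset.sum_eq_single i]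
  · rw [if_pos h, Polynomial.coeff_C_mul, Polynomial.coeff_X_pow_self, mul_one]
  · intro b _ hb
    split_ifs
    · rw [Polynomial.coeff_C_mul, Polynomial.coeff_X_pow, if_neg hb.symm, mul_zero]
    · rw [Polynomial.coeff_zero]
  · intro hi
    exact absurd (Finset.mem_range.2 (Nat.lt_succ_of_le h.1)) hi

lemma coeff_boundaryPol_of_not (N : ℕ) (V : Fin (k + 2) → ℕ) (Λ : Fin (k + 2) → κ)
    (c : Expansion K k) (i : ℕ) (h : ¬ OnLowestEdge (ordinate N V c) N i) :
    (boundaryPol N V Λ c).coeff i = 0 := by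
  rw [boundaryPol, Polynomial.finsetSum_coeff]
  refine Finset.sum_eq_zero fun j _ => ?_
  split_ifs with hj
  · rw [Polynomial.coeff_C_mul, Polynomial.coeff_X_pow, if_neg, mul_zero]
    rintro rfl
    exact h hj
  · rw [Polynomial.coeff_zero]

lemma minVal_eq_coe_iff {V : Fin (k + 2) → ℕ} {c : Expansion K k} {i n : ℕ} :
    minVal V c i = n ↔ (∃ B, c.f B ≠ 0 ∧ B (Fin.last (k + 1)) = i ∧ pairing B V = n) ∧
      ∀ B, c.f B ≠ 0 → B (Fin.last (k + 1)) = i → n ≤ pairing B V := by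
  have hle : ∀ B, c.f B ≠ 0 → B (Fin.last (k + 1)) = i → minVal V c i ≤ pairing B V :=
    fun B h1 h2 => iInf₂_le B ⟨h2, h1⟩
  constructor
  · intro h
    have hmin : ∀ B, c.f B ≠ 0 → B (Fin.last (k + 1)) = i → n ≤ pairing B V := by
      intro B h1 h2
      have := hle B h1 h2
      rw [h] at this
      exact_mod_cast this
    refine ⟨?_, hmin⟩
    by_contra hne
    push Not at hne
    have : ((n + 1 : ℕ) : ℕ∞) ≤ minVal V c i := by
      refine le_iInf₂ fun B hB => ?_
      have h1 := hmin B hB.2 hB.1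
      have h2 := hne B hB.2 hB.1
      exact_mod_cast (by omega : n + 1 ≤ pairing B V)
    rw [h] at this
    have : n + 1 ≤ n := by exact_mod_cast this
    omega
  · rintro ⟨⟨B, h1, h2, h3⟩, hmin⟩
    refine le_antisymm ((hle B h1 h2).trans (by rw [h3])) (le_iInf₂ fun B hB => ?_)
    exact_mod_cast hmin B hB.2 hB.1

lemma ordinate_eq_coe_iff {N : ℕ} {V : Fin (k + 2) → ℕ} {c : Expansion K k} {i : ℕ} {a : ℤ} :
    ordinate N V c i = a ↔ ∃ n : ℕ, minVal V c i = n ∧ a = n - N * V (Fin.last (k + 1)) := by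
  rw [ordinate]
  generalize minVal V c i = w
  induction w using ENat.recTopCoe with
  | top =>
    constructor
    · intro h; cases h
    · rintro ⟨n, h, -⟩
      exact absurd h (ENat.top_ne_natCast n)
  | coe n =>
    change (((n : ℤ) - N * V (Fin.last (k + 1)) : ℤ) : WithTop ℤ) = a ↔ _
    rw [WithTop.coe_inj]
    constructor
    · intro h; exact ⟨n, rfl, h.symm⟩
    · rintro ⟨n', h1, h2⟩
      rw [h2, Nat.cast_inj.1 h1]

variable {L : Type*} [Field L] [Algebra L κ] {V : Fin (k + 2) → ℕ} {Λ : Fin (k + 2) → κ}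
  {Φ : Fin (k + 1) → L⟦X⟧[X]} {θ : L⟦X⟧[X] →+* κ⟦X⟧[X]}

/-- Along the lowest edge, of slope `-m / q`, the boundary polynomial is the leading form of the
image of `F` for the weights `q` of `x` and `m` of `y`, up to the constant `λ ^ N`. -/
lemma IsFrame.exists_boundary (fr : IsFrame V Λ Φ θ) {F : L⟦X⟧[X]} (hF : F.Monic) {N : ℕ}
    (hFd : F.natDegree = N * (Φ (Fin.last k)).natDegree) {c : Expansion L k}
    (hc : IsExpansion F Φ c) {u : κ[X]} (hu : u.coeff 0 ≠ 0)
    (hlead : HasLead (N * V (Fin.last (k + 1))) (Polynomial.X ^ N * u) (θ F))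
    (hex : ∃ B, c.f B ≠ 0 ∧ B (Fin.last (k + 1)) < N) :
    ∃ (q m : ℕ) (hq : q ≠ 0) (_ : m ≠ 0) (h : κ[X]), q.Coprime m ∧
      HasLead (N * (q * V (Fin.last (k + 1)) + m)) h (weightSubst κ q hq m (θ F)) ∧
      (∃ i < N, h.coeff i ≠ 0) ∧ (∀ i, h.coeff i ≠ 0 → q ∣ N - i) ∧
      ∀ i, (boundaryPol N V Λ c).coeff i =
        Polynomial.C (h.coeff i / Λ (Fin.last (k + 1)) ^ N) *
          Polynomial.X ^ (m * ((N - i) / q)) := by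
  set v := V (Fin.last (k + 1)) with hv
  obtain ⟨htop, hlt⟩ := fr.f_of_monic hc hF hFd
  obtain ⟨B₀, ⟨hB₀, hB₀'⟩, hmin⟩ := exists_min_fraction
    (S := {B | c.f B ≠ 0 ∧ B (Fin.last (k + 1)) < N}) hex
    (fun B => pairing B V - N * v) (fun B => N - B (Fin.last (k + 1))) (M := N)
    (fun B hB => ⟨Nat.sub_pos_of_lt hB.2, Nat.sub_le _ _⟩)
  have hx : ∀ B, c.f B ≠ 0 → B (Fin.last (k + 1)) < N → ∃ x, 0 < x ∧ pairing B V = N * v + x := by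
    intro B hB h
    have : N * v < pairing B V := fr.lt_pairing hc hu hlead hB h
    exact ⟨pairing B V - N * v, by omega, by omega⟩
  obtain ⟨x₀, hx₀, hpx₀⟩ := hx B₀ hB₀ hB₀'
  obtain ⟨y₀, hy₀⟩ : ∃ y, N = B₀ (Fin.last (k + 1)) + y := ⟨_, (Nat.add_sub_of_le hB₀'.le).symm⟩
  have hy₀' : 0 < y₀ := by omega
  have hmin₀ : ∀ B, c.f B ≠ 0 → ∀ x y, pairing B V = N * v + x →
      N = B (Fin.last (k + 1)) + y → 0 < y → x₀ * y ≤ x * y₀ := by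
    intro B hB x y h1 h2 h3
    have := hmin B ⟨hB, by omega⟩
    beta_reduce at this
    rwa [hpx₀, h1, Nat.add_sub_cancel_left, Nat.add_sub_cancel_left,
      show N - B (Fin.last (k + 1)) = y by omega,
      show N - B₀ (Fin.last (k + 1)) = y₀ by omega] at this
  -- the slope in lowest terms
  obtain ⟨g, hg⟩ : ∃ g, g = Nat.gcd y₀ x₀ := ⟨_, rfl⟩
  have hg0 : 0 < g := hg ▸ Nat.gcd_pos_of_pos_left _ hy₀'
  obtain ⟨q, hq⟩ : g ∣ y₀ := hg ▸ Nat.gcd_dvd_left _ _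
  obtain ⟨m, hm⟩ : g ∣ x₀ := hg ▸ Nat.gcd_dvd_right _ _
  have hcop : q.Coprime m := by
    have : g * Nat.gcd q m = g * 1 := by
      rw [← Nat.gcd_mul_left, ← hq, ← hm, ← hg, mul_one]
    exact Nat.eq_of_mul_eq_mul_left hg0 this
  have hq0 : q ≠ 0 := by rintro rfl; omega
  have hm0 : m ≠ 0 := by rintro rfl; omega
  have hmin₁ : ∀ B, c.f B ≠ 0 → ∀ x y, pairing B V = N * v + x →
      N = B (Fin.last (k + 1)) + y → m * y ≤ x * q := by
    intro B hB x y h1 h2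
    rcases Nat.eq_zero_or_pos y with rfl | h3
    · simp
    · have := hmin₀ B hB x y h1 h2 h3
      rw [hq, hm] at this
      refine Nat.le_of_mul_le_mul_left ?_ hg0
      calc g * (m * y) = g * m * y := by ring
        _ ≤ x * (g * q) := this
        _ = g * (x * q) := by ring
  have hxy : ∀ B, c.f B ≠ 0 → ∃ x y, pairing B V = N * v + x ∧ N = B (Fin.last (k + 1)) + y := by
    intro B hB
    rcases hlt B hB with rfl | h
    · exact ⟨0, 0, by rw [pairing_single, add_zero], by rw [Pi.single_eq_same, add_zero]⟩
    · obtain ⟨x, -, hx⟩ := hx B hB h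
      exact ⟨x, N - B (Fin.last (k + 1)), hx, by omega⟩
  have hpair : ∀ B x y, pairing B V = N * v + x → N = B (Fin.last (k + 1)) + y →
      pairing B (slopeV q m V) + m * y = N * (q * v + m) + x * q := by
    intro B x y h1 h2
    rw [pairing_slopeV, h1]
    calc q * (N * v + x) + m * B (Fin.last (k + 1)) + m * y =
        q * (N * v) + m * (B (Fin.last (k + 1)) + y) + x * q := by ring
      _ = _ := by rw [← h2]; ring
  have hle : ∀ B, c.f B ≠ 0 → N * (q * v + m) ≤ pairing B (slopeV q m V) := by
    intro B hB
    obtain ⟨x, y, h1, h2⟩ := hxy B hB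
    have h3 := hmin₁ B hB x y h1 h2
    have h4 := hpair B x y h1 h2
    omega
  have hedge : ∀ B x y, pairing B V = N * v + x → N = B (Fin.last (k + 1)) + y →
      (pairing B (slopeV q m V) = N * (q * v + m) ↔ m * y = x * q) := by
    intro B x y h1 h2
    have h4 := hpair B x y h1 h2
    omega
  have hleadF := fr.hasLead_weightSubst hc hq0 hm0 hle
  obtain ⟨hFd1, hFd2⟩ := fr.lead_of_monic hF hFd hq0 hm0 hleadF
  refine ⟨q, m, hq0, hm0, _, hcop, hleadF, ⟨B₀ (Fin.last (k + 1)), hB₀', ?_⟩, ?_, ?_⟩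
  · refine (fr.coeff_lead_ne_zero_iff hc hq0 m _ _).2 ⟨B₀, hB₀, ?_, rfl⟩
    rw [hedge B₀ x₀ y₀ hpx₀ hy₀, hm, hq]
    ring
  · intro i hi
    obtain ⟨B, hB, h1, rfl⟩ := (fr.coeff_lead_ne_zero_iff hc hq0 m _ i).1 hi
    obtain ⟨x, y, h2, h3⟩ := hxy B hB
    rw [hedge B x y h2 h3] at h1
    rw [show N - B (Fin.last (k + 1)) = y by omega]
    exact hcop.dvd_of_dvd_mul_left ⟨x, by rw [h1]; ring⟩
  · intro i
    have hN : minVal V c N = (N * v : ℕ) := by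
      rw [minVal_eq_coe_iff]
      refine ⟨⟨_, by rw [htop]; exact one_ne_zero, Pi.single_eq_same _ _, pairing_single _ _⟩, ?_⟩
      intro B hB hBN
      obtain ⟨x, y, h2, h3⟩ := hxy B hB
      omega
    have hwN : ordinate N V c N = (0 : ℤ) := by
      rw [ordinate_eq_coe_iff]
      exact ⟨_, hN, by push_cast; ring⟩
    by_cases hi : (leadingForm c (slopeV q m V) Λ (N * (q * v + m))).coeff i = 0
    · rw [hi, zero_div, map_zero, zero_mul]
      refine coeff_boundaryPol_of_not _ _ _ _ _ fun hon => ?_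
      obtain ⟨hiN, a, a', ha, ha', hall⟩ := hon
      obtain rfl : 0 = a' := by rw [hwN] at ha'; exact_mod_cast ha'
      obtain ⟨n, hn, han⟩ := ordinate_eq_coe_iff.1 ha
      obtain ⟨⟨B, hB, rfl, rfl⟩, hBmin⟩ := minVal_eq_coe_iff.1 hn
      refine (fr.coeff_lead_ne_zero_iff hc hq0 m _ _).2 ⟨B, hB, ?_, rfl⟩ hi
      obtain ⟨x, y, h2, h3⟩ := hxy B hB
      rw [hedge B x y h2 h3]
      refine le_antisymm (hmin₁ B hB x y h2 h3) ?_
      have hw₀ : ordinate N V c (B₀ (Fin.last (k + 1))) = (x₀ : ℤ) := by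
        rw [ordinate_eq_coe_iff]
        refine ⟨N * v + x₀, ?_, by push_cast; ring⟩
        rw [minVal_eq_coe_iff]
        refine ⟨⟨B₀, hB₀, rfl, hpx₀⟩, fun B' hB' hB'' => ?_⟩
        obtain ⟨x', y', h2', h3'⟩ := hxy B' hB'
        have := hmin₀ B' hB' x' y' h2' h3' (by omega)
        have hyy : y' = y₀ := by omega
        rw [hyy] at this
        have := Nat.le_of_mul_le_mul_right this hy₀'
        omega
      have := hall _ hB₀'.le _ hw₀
      have e1 : a = x := by rw [han, h2]; push_cast; ring
      have e2 : (N : ℤ) - B₀ (Fin.last (k + 1)) = y₀ := by omega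
      have e3 : (N : ℤ) - B (Fin.last (k + 1)) = y := by omega
      rw [e1, e2, e3, sub_zero, sub_zero] at this
      have : x * y₀ ≤ x₀ * y := by exact_mod_cast this
      rw [hq, hm] at this
      refine Nat.le_of_mul_le_mul_left ?_ hg0
      calc g * (x * q) = x * (g * q) := by ring
        _ ≤ g * m * y := this
        _ = g * (m * y) := by ring
    · obtain ⟨B, hB, h1, rfl⟩ := (fr.coeff_lead_ne_zero_iff hc hq0 m _ i).1 hi
      obtain ⟨x, y, h2, h3⟩ := hxy B hB
      rw [hedge B x y h2 h3] at h1
      have hval : minVal V c (B (Fin.last (k + 1))) = (N * v + x : ℕ) := by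
        rw [minVal_eq_coe_iff]
        refine ⟨⟨B, hB, rfl, h2⟩, fun B' hB' hB'' => ?_⟩
        obtain ⟨x', y', h2', h3'⟩ := hxy B' hB'
        have := hmin₁ B' hB' x' y' h2' h3'
        have hyy : y' = y := by omega
        rw [hyy, h1] at this
        have := Nat.le_of_mul_le_mul_right this (Nat.pos_of_ne_zero hq0)
        omega
      have hord : ordinate N V c (B (Fin.last (k + 1))) = (x : ℤ) :=
        ordinate_eq_coe_iff.2 ⟨_, hval, by push_cast; ring⟩
      have hon : OnLowestEdge (ordinate N V c) N (B (Fin.last (k + 1))) := by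
        refine ⟨by omega, x, 0, hord, hwN, fun j hj b hb => ?_⟩
        obtain ⟨n, hn, han⟩ := ordinate_eq_coe_iff.1 hb
        obtain ⟨⟨B', hB', rfl, rfl⟩, -⟩ := minVal_eq_coe_iff.1 hn
        obtain ⟨x', y', h2', h3'⟩ := hxy B' hB'
        have h4 := hmin₁ B' hB' x' y' h2' h3'
        have e1 : b = x' := by rw [han, h2']; push_cast; ring
        have e2 : (N : ℤ) - B' (Fin.last (k + 1)) = y' := by omega
        have e3 : (N : ℤ) - B (Fin.last (k + 1)) = y := by omega
        rw [e1, e2, e3, sub_zero, sub_zero]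
        have : x * y' ≤ x' * y := by
          refine Nat.le_of_mul_le_mul_left ?_ (Nat.pos_of_ne_zero (mul_ne_zero hq0 hm0))
          calc q * m * (x * y') = x * q * (m * y') := by ring
            _ = m * y * (m * y') := by rw [h1]
            _ ≤ m * y * (x' * q) := Nat.mul_le_mul_left _ h4
            _ = q * m * (x' * y) := by ring
        exact_mod_cast this
      rw [coeff_boundaryPol _ _ _ _ _ hon, hord, hval, ENat.toNat_natCast]
      have hy : N - B (Fin.last (k + 1)) = y := by omega
      have hdiv : m * (y / q) = x := by
        obtain ⟨y', rfl⟩ : q ∣ y := hcop.dvd_of_dvd_mul_left ⟨x, by rw [h1]; ring⟩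
        rw [Nat.mul_div_cancel_left _ (Nat.pos_of_ne_zero hq0)]
        refine Nat.eq_of_mul_eq_mul_right (Nat.pos_of_ne_zero hq0) ?_
        rw [← h1]
        ring
      have hexp : ((WithTop.untopD 0 ((x : ℤ) : WithTop ℤ))).toNat = x := by
        rw [WithTop.untopD_coe, Int.toNat_natCast]
      rw [hy, hdiv, hexp]
      congr 2
      rw [coeff_lead, Finset.sum_div, boundaryCoeff]
      have hset : ∀ B' : Fin (k + 2) → ℕ, c.f B' ≠ 0 →
          ((B' (Fin.last (k + 1)) = B (Fin.last (k + 1)) ∧ pairing B' V = N * v + x) ↔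
          B' ∈ (terms c (slopeV q m V) (N * (q * v + m))).filter
            fun B' => B' (Fin.last (k + 1)) = B (Fin.last (k + 1))) := by
        intro B' hB'
        rw [Finset.mem_filter, mem_terms (fr.slopeV_zero_ne hq0 m)]
        obtain ⟨x', y', h2', h3'⟩ := hxy B' hB'
        rw [hedge B' x' y' h2' h3', h2']
        constructor
        · rintro ⟨h4, h5⟩
          have e1 : x' = x := by omega
          have e2 : y' = y := by omega
          exact ⟨⟨hB', by rw [e1, e2, h1]⟩, h4⟩
        · rintro ⟨⟨-, h4⟩, h5⟩
          have e2 : y' = y := by omega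
          rw [e2, h1] at h4
          exact ⟨h5, by rw [Nat.eq_of_mul_eq_mul_right (Nat.pos_of_ne_zero hq0) h4]⟩
      refine (finsum_mem_eq_sum_of_inter_support_eq (s := {B' : Fin (k + 2) → ℕ |
        B' (Fin.last (k + 1)) = B (Fin.last (k + 1)) ∧ pairing B' V = N * v + x})
        (t := (terms c (slopeV q m V) (N * (q * v + m))).filter
            fun B' => B' (Fin.last (k + 1)) = B (Fin.last (k + 1))) _ ?_).trans ?_
      · ext B'
        simp only [Set.mem_inter_iff, Function.mem_support, Set.mem_ofPred_eq, Finset.mem_coe]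
        refine and_congr_left fun hne => hset B' ?_
        intro h0
        rw [h0, map_zero, zero_mul] at hne
        exact hne rfl
      · simp only [mul_div_assoc]

/-- If the expansion of `F` has no other term than `ψ ^ N`, then `F = ψ ^ N`. -/
lemma IsExpansion.eq_pow {F : L⟦X⟧[X]} {c : Expansion L k} (hc : IsExpansion F Φ c)
    (hΦ : ∀ i, (Φ i).Monic) (h0 : 0 < (Φ 0).natDegree)
    (hdvd : ∀ i : Fin k, (Φ i.castSucc).natDegree ∣ (Φ i.succ).natDegree)
    (hpos : 0 < (Φ (Fin.last k)).natDegree) (hF : F.Monic) {N : ℕ}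
    (hFd : F.natDegree = N * (Φ (Fin.last k)).natDegree)
    (hex : ∀ B, c.f B ≠ 0 → N ≤ B (Fin.last (k + 1))) : F = Φ (Fin.last k) ^ N := by
  obtain ⟨h1, h2⟩ := hc.of_monic hΦ h0 hdvd hpos hF hFd
  have hsupp : c.support = {Pi.single (Fin.last k) N} := by
    ext b
    rw [Finset.mem_singleton]
    constructor
    · intro hb
      by_contra hne
      obtain ⟨n, hn⟩ : ∃ n, PowerSeries.coeff n (c b) ≠ 0 := by
        by_contra hall
        push Not at hall
        exact Finsupp.mem_support_iff.1 hb (PowerSeries.ext fun n => by rw [hall, map_zero])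
      have h3 := hex (Fin.cons n b) (by rwa [f_cons])
      have h4 := h2 b hb hne
      rw [← Fin.succ_last, Fin.cons_succ] at h3
      omega
    · rintro rfl
      rw [Finsupp.mem_support_iff, h1]
      exact one_ne_zero
  rw [hc.2, Finsupp.sum, hsupp, Finset.sum_singleton, h1, map_one, one_mul,
    Finset.prod_eq_single (Fin.last k)]
  · rw [Pi.single_eq_same]
  · intro b _ hb
    rw [Pi.single_eq_of_ne hb, pow_zero]
  · simp

end Boundary

/-! ### Extension of the field of coefficients -/

section Extension

variable {K : Type*} [Field K] {L : Type*} [Field L] [Algebra K L] {k : ℕ}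

/-- The expansion with the images of the coefficients in a larger field. -/
noncomputable def Expansion.baseChange (L : Type*) [Field L] [Algebra K L] (c : Expansion K k) :
    Expansion L k :=
  c.mapRange (PowerSeries.map (algebraMap K L)) (map_zero _)

lemma Expansion.f_baseChange (c : Expansion K k) (B : Fin (k + 2) → ℕ) :
    (c.baseChange L).f B = algebraMap K L (c.f B) := by
  rw [Expansion.f, Expansion.baseChange, Finsupp.mapRange_apply, PowerSeries.coeff_map,
    Expansion.f]

lemma powerSeries_map_injective :
    Function.Injective (PowerSeries.map (algebraMap K L)) := by
  intro f g h
  ext n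
  have := congrArg (PowerSeries.coeff n) h
  simpa only [PowerSeries.coeff_map, (algebraMap K L).injective.eq_iff] using this

lemma IsExpansion.baseChange {F : K⟦X⟧[X]} {Ψ : Fin (k + 1) → K⟦X⟧[X]} {c : Expansion K k}
    (hc : IsExpansion F Ψ c) :
    IsExpansion (F.map (PowerSeries.map (algebraMap K L)))
      (fun i => (Ψ i).map (PowerSeries.map (algebraMap K L))) (c.baseChange L) := by
  refine ⟨fun b hb i => ?_, ?_⟩
  · rw [Polynomial.natDegree_map_eq_of_injective powerSeries_map_injective,
      Polynomial.natDegree_map_eq_of_injective powerSeries_map_injective]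
    exact hc.1 b (Finsupp.support_mapRange hb) i
  · rw [Expansion.baseChange, Finsupp.sum_mapRange_index (fun b => by simp)]
    conv_lhs => rw [hc.2]
    rw [Finsupp.sum, Finsupp.sum, Polynomial.map_sum]
    refine Finset.sum_congr rfl fun b _ => ?_
    rw [Polynomial.map_mul, Polynomial.map_C, Polynomial.map_prod]
    simp only [Polynomial.map_pow]

lemma boundaryPol_baseChange {κ : Type*} [Field κ] [Algebra K κ] [Algebra L κ]
    [IsScalarTower K L κ] (N : ℕ) (V : Fin (k + 2) → ℕ) (Λ : Fin (k + 2) → κ)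
    (c : Expansion K k) : boundaryPol N V Λ (c.baseChange L) = boundaryPol N V Λ c := by
  have h1 : minVal V (c.baseChange L) = minVal V c := by
    funext i
    simp only [minVal, Expansion.f_baseChange, ne_eq, map_eq_zero]
  have h2 : ordinate N V (c.baseChange L) = ordinate N V c := by
    funext i
    rw [ordinate, h1, ordinate]
  have h3 : ∀ i n, boundaryCoeff N V Λ (c.baseChange L) i n = boundaryCoeff N V Λ c i n := by
    intro i n
    simp only [boundaryCoeff, Expansion.f_baseChange, ← IsScalarTower.algebraMap_apply]
  simp only [boundaryPol, h1, h3]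
  refine Finset.sum_congr rfl fun i _ => ?_
  by_cases h : OnLowestEdge (ordinate N V c) N i
  · rw [if_pos h, if_pos (h2.symm ▸ h), h2]
  · rw [if_neg h, if_neg (h2.symm ▸ h)]

end Extension

/-! ### Edge data and leading forms -/

section EdgeData

variable {κ : Type*} [Field κ]

/-- The substitution `x ↦ x ^ q`, `y ↦ x ^ m y` in `κ[x][y]`. -/
noncomputable def weightSubstPol (κ : Type*) [Field κ] (q m : ℕ) : κ[X][X] →+* κ[X][X] :=
  Polynomial.eval₂RingHom (Polynomial.C.comp (Polynomial.expand κ q : κ[X] →+* κ[X]))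
    (Polynomial.C (Polynomial.X ^ m) * Polynomial.X)

lemma weightSubstPol_C (q m : ℕ) (p : κ[X]) :
    weightSubstPol κ q m (Polynomial.C p) = Polynomial.C (Polynomial.expand κ q p) := by
  simp [weightSubstPol]

lemma weightSubstPol_X (q m : ℕ) :
    weightSubstPol κ q m Polynomial.X = Polynomial.C (Polynomial.X ^ m) * Polynomial.X := by
  simp [weightSubstPol]

lemma coeff_weightSubstPol (q m : ℕ) (p : κ[X][X]) (i : ℕ) :
    (weightSubstPol κ q m p).coeff i =
      Polynomial.X ^ (m * i) * Polynomial.expand κ q (p.coeff i) := by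
  induction p using Polynomial.induction_on' with
  | add p p' h h' => rw [map_add, Polynomial.coeff_add, h, h', Polynomial.coeff_add, map_add]; ring
  | monomial n a =>
    rw [← Polynomial.C_mul_X_pow_eq_monomial, map_mul, map_pow, weightSubstPol_C,
      weightSubstPol_X, mul_pow, ← Polynomial.C_pow, ← pow_mul, Polynomial.coeff_C_mul,
      Polynomial.coeff_C_mul, Polynomial.coeff_C_mul, Polynomial.coeff_X_pow]
    split_ifs with h
    · rw [h, mul_one, mul_one, mul_comm]
    · simp

lemma weightSubstPol_injective {q : ℕ} (hq : q ≠ 0) (m : ℕ) :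
    Function.Injective (weightSubstPol κ q m) := by
  intro p p' h
  ext1 i
  have h1 := congrArg (fun r => Polynomial.coeff r i) h
  simp only [coeff_weightSubstPol] at h1
  exact Polynomial.expand_injective (Nat.pos_of_ne_zero hq)
    (mul_left_cancel₀ (pow_ne_zero _ Polynomial.X_ne_zero) h1)

lemma weightSubstPol_quasiHom (q m : ℕ) (P : κ[X]) :
    weightSubstPol κ q m (quasiHom q m P) =
      Polynomial.C (Polynomial.X ^ (q * (m * P.natDegree))) *
        (Polynomial.expand κ q P).map Polynomial.C := by
  obtain ⟨J, hJ⟩ : ∃ J, P.natDegree = J := ⟨_, rfl⟩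
  rw [quasiHom, map_sum, hJ]
  conv_rhs => rw [P.as_sum_range_C_mul_X_pow, hJ]
  rw [map_sum, Polynomial.map_sum, Finset.mul_sum]
  refine Finset.sum_congr rfl fun j hj => ?_
  have hj' := Nat.lt_succ_iff.1 (Finset.mem_range.1 hj)
  simp only [map_mul, map_pow, weightSubstPol_C, weightSubstPol_X, Polynomial.expand_C,
    Polynomial.expand_X, Polynomial.map_mul, Polynomial.map_pow, Polynomial.map_C,
    Polynomial.map_X]
  obtain ⟨i, hi⟩ := Nat.exists_eq_add_of_le hj'
  rw [hi, Nat.add_sub_cancel_left]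
  ring_nf

lemma expand_monic {q : ℕ} (hq : q ≠ 0) {P : κ[X]} (hP : P.Monic) :
    (Polynomial.expand κ q P).Monic := hP.expand (Nat.pos_of_ne_zero hq)

lemma coeff_zero_ne_zero_of_irreducible {P : κ[X]} (hPm : P.Monic) (hP : Irreducible P)
    (hPX : P ≠ Polynomial.X) : P.coeff 0 ≠ 0 := by
  intro h
  have h5 := (Polynomial.irreducible_X (R := κ)).associated_of_dvd hP (Polynomial.X_dvd_iff.2 h)
  exact hPX (Polynomial.eq_of_monic_of_associated Polynomial.monic_X hPm h5).symm

lemma exists_eq_expand {q : ℕ} (hq : q ≠ 0) {h : κ[X]} (hh : ∀ i, h.coeff i ≠ 0 → q ∣ i) :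
    ∃ R, h = Polynomial.expand κ q R := by
  refine ⟨Polynomial.contract q h, ?_⟩
  ext i
  rw [Polynomial.coeff_expand (Nat.pos_of_ne_zero hq)]
  split_ifs with hi
  · rw [Polynomial.coeff_contract hq, Nat.div_mul_cancel hi]
  · by_contra hne
    exact hi (hh i hne)

variable {H : κ[X][X]} {h : κ[X]} {N q m : ℕ} {lam : κ}

/-- The edge data of a boundary polynomial can be read off from the leading form. -/
lemma IsEdgeData.eq_of_lead (hq : q ≠ 0) (hm : m ≠ 0) (hqm : q.Coprime m) (hlam : lam ≠ 0)
    (hdeg : h.natDegree ≤ N) (hlc : h.coeff N = lam ^ N) (hex : ∃ i < N, h.coeff i ≠ 0)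
    (hdvd : ∀ i, h.coeff i ≠ 0 → q ∣ N - i)
    (hH : ∀ i, H.coeff i = Polynomial.C (h.coeff i / lam ^ N) *
      Polynomial.X ^ (m * ((N - i) / q)))
    {q' m' N' : ℕ} {P : κ[X]} (hE : IsEdgeData H q' m' P N') :
    q' = q ∧ m' = m ∧ P ≠ Polynomial.X ∧ N = q * P.natDegree * N' ∧
      h = Polynomial.C (lam ^ N) * Polynomial.expand κ q (P ^ N') := by
  obtain ⟨hq', hqm', hPm, -, -, hPX, c, hc, hHc⟩ := hE
  have hlamN := pow_ne_zero N hlam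
  set E := Polynomial.expand κ q' (P ^ N') with hE
  have hEm : E.Monic := expand_monic hq'.ne' (hPm.pow N')
  have hEd : E.natDegree = q' * P.natDegree * N' := by
    rw [hE, Polynomial.natDegree_expand, hPm.natDegree_pow]; ring
  -- after the substitution with weights `q'` and `m'`, both sides have monomials in `x` as
  -- coefficients: their constants give `h`, and their exponents give the slope
  have key : ∀ i, Polynomial.C (h.coeff i / lam ^ N) *
      Polynomial.X ^ (m' * i + q' * (m * ((N - i) / q))) =
      Polynomial.C (c * E.coeff i) * (Polynomial.X : κ[X]) ^ (q' * (m' * P.natDegree) * N') := by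
    intro i
    have h1 := congrArg (fun r => (weightSubstPol κ q' m' r).coeff i) hHc
    beta_reduce at h1
    rw [coeff_weightSubstPol, hH, map_mul, map_mul, map_pow (weightSubstPol κ q' m'),
      weightSubstPol_quasiHom, mul_pow, ← Polynomial.C_pow, ← pow_mul, ← Polynomial.map_pow,
      ← map_pow (Polynomial.expand κ q'), weightSubstPol_C, Polynomial.coeff_C_mul,
      Polynomial.coeff_C_mul, Polynomial.coeff_map, ← hE] at h1
    simp only [map_pow, Polynomial.expand_C, Polynomial.expand_X] at h1
    rw [map_mul, pow_add, pow_mul _ q', mul_left_comm, h1]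
    ring
  have hcoef : ∀ i, h.coeff i = lam ^ N * (c * E.coeff i) := by
    intro i
    have h1 := congrArg (Polynomial.eval 1) (key i)
    simp only [Polynomial.eval_mul, Polynomial.eval_C, Polynomial.eval_pow, Polynomial.eval_X,
      one_pow, mul_one] at h1
    rw [← h1, mul_div_cancel₀ _ hlamN]
  have hhE : h = Polynomial.C (lam ^ N * c) * E := by
    ext i
    rw [Polynomial.coeff_C_mul, hcoef, mul_assoc]
  have hN : N = q' * P.natDegree * N' := by
    have h1 : h.natDegree = N := le_antisymm hdeg
      (Polynomial.le_natDegree_of_ne_zero (by rw [hlc]; exact hlamN))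
    rw [← hEd, ← h1, hhE, Polynomial.natDegree_C_mul (mul_ne_zero hlamN hc)]
  have hc1 : c = 1 := by
    have h1 := hcoef N
    rw [hlc, show E.coeff N = 1 by rw [hN, ← hEd]; exact hEm.coeff_natDegree, mul_one] at h1
    exact mul_left_cancel₀ hlamN (by rw [← h1, mul_one])
  obtain ⟨i, hiN, hi⟩ := hex
  have hexp : m' * i + q' * (m * ((N - i) / q)) = q' * (m' * P.natDegree) * N' := by
    have h1 := congrArg Polynomial.natDegree (key i)
    have h2 : h.coeff i / lam ^ N ≠ 0 := div_ne_zero hi hlamN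
    have h3 : c * E.coeff i ≠ 0 := by
      intro h0
      rw [hcoef, h0, mul_zero] at hi
      exact hi rfl
    rwa [Polynomial.natDegree_C_mul_X_pow _ _ h2, Polynomial.natDegree_C_mul_X_pow _ _ h3] at h1
  obtain ⟨e, he⟩ := hdvd i hi
  have he0 : 0 < e := by
    rcases Nat.eq_zero_or_pos e with rfl | h
    · rw [mul_zero] at he; omega
    · exact h
  have hqq : q' * m = m' * q := by
    rw [he, Nat.mul_div_cancel_left _ (Nat.pos_of_ne_zero hq)] at hexp
    have h1 : q' * (m' * P.natDegree) * N' = m' * N := by rw [hN]; ring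
    have h2 : N = i + q * e := by omega
    rw [h1, h2, mul_add] at hexp
    have h3 : q' * m * e = m' * q * e := by
      rw [mul_assoc, mul_assoc]; exact Nat.add_left_cancel hexp
    exact Nat.eq_of_mul_eq_mul_right he0 h3
  obtain rfl : q' = q := by
    refine Nat.dvd_antisymm (hqm'.dvd_of_dvd_mul_left ⟨m, hqq.symm⟩)
      (hqm.dvd_of_dvd_mul_right ⟨m', by rw [hqq, mul_comm]⟩)
  obtain rfl : m' = m := by
    rw [mul_comm m'] at hqq
    exact (Nat.eq_of_mul_eq_mul_left hq' hqq).symm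
  refine ⟨rfl, rfl, fun hX => hm (hPX hX).2, hN, ?_⟩
  rw [hhE, hc1, mul_one]

/-- A boundary polynomial is degenerated if the leading form is, up to a constant, a power of
`P(y ^ q)` with `P` irreducible. -/
lemma degenerated_of_lead (hq : q ≠ 0) (hqm : q.Coprime m) (hlam : lam ≠ 0)
    (hdvd : ∀ i, h.coeff i ≠ 0 → q ∣ N - i)
    (hH : ∀ i, H.coeff i = Polynomial.C (h.coeff i / lam ^ N) *
      Polynomial.X ^ (m * ((N - i) / q)))
    {P : κ[X]} (hPm : P.Monic) (hP : Irreducible P) (hPX : P ≠ Polynomial.X) {N' : ℕ}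
    (hN' : 0 < N') (hN : N = q * P.natDegree * N')
    (hh : h = Polynomial.C (lam ^ N) * Polynomial.expand κ q (P ^ N')) : Degenerated H := by
  refine ⟨q, m, P, N', Nat.pos_of_ne_zero hq, hqm, hPm, hP, hN', fun h => absurd h hPX, 1,
    one_ne_zero, ?_⟩
  refine weightSubstPol_injective hq m ?_
  rw [map_mul, map_pow, weightSubstPol_quasiHom, map_one, map_one, map_one, one_mul, mul_pow,
    ← Polynomial.C_pow, ← pow_mul, ← Polynomial.map_pow, ← map_pow]
  ext1 i
  rw [coeff_weightSubstPol, hH, Polynomial.coeff_C_mul, Polynomial.coeff_map]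
  have h1 : h.coeff i / lam ^ N = (Polynomial.expand κ q (P ^ N')).coeff i := by
    rw [hh, Polynomial.coeff_C_mul, mul_div_cancel_left₀ _ (pow_ne_zero N hlam)]
  rw [h1]
  by_cases h0 : h.coeff i = 0
  · rw [← h1, h0, zero_div, map_zero, zero_mul, map_zero, mul_zero, mul_zero]
  · obtain ⟨e, he⟩ := hdvd i h0
    have hi : i ≤ N := by
      have h2 : (Polynomial.expand κ q (P ^ N')).coeff i ≠ 0 := by
        rw [← h1]; exact div_ne_zero h0 (pow_ne_zero N hlam)
      have h3 := Polynomial.le_natDegree_of_ne_zero h2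
      rw [Polynomial.natDegree_expand, hPm.natDegree_pow] at h3
      rw [hN]
      calc i ≤ N' * P.natDegree * q := h3
        _ = q * P.natDegree * N' := by ring
    rw [he, Nat.mul_div_cancel_left _ (Nat.pos_of_ne_zero hq), map_mul, Polynomial.expand_C,
      map_pow (Polynomial.expand κ q) Polynomial.X, Polynomial.expand_X, mul_left_comm, ← pow_mul,
      ← pow_add, mul_comm]
    congr 2
    have h2 : N = i + q * e := by omega
    calc m * i + q * (m * e) = m * (i + q * e) := by ring
      _ = m * (q * P.natDegree * N') := by rw [← h2, hN]
      _ = _ := by ring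

end EdgeData

/-! ### The invariant of the loop -/

section State

variable {L : Type*} [Field L] {κ : Type*} [Field κ] [Algebra L κ] {k : ℕ}

/-- The invariant of the loop for the polynomial `F` over `L⟦x⟧`: the ring homomorphism `π` from
`L⟦x⟧[y]` to `κ⟦x⟧[y]` is the composition of the Puiseux substitutions of the previous rounds, and
the lists `V` and `Λ` contain the exponents and the coefficients of the leading terms of the images
of `x`, of the approximate roots of the list `Ψ`, and of the next one (`map_C`, `lead`, `root`). The
field `root` concerns all the approximate roots `ψ` of `F` whose order `N₁` divides `N`, because
those of the following rounds, and `F` itself for `N₁ = 1`, have to be followed as well: the leading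
form of `π ψ` has order `M = N / N₁` in `y`, as if `ψ` were the `M`-th power of the next one. The
residue field `κ` and the ramification account for the degree `d / N` of the next approximate root
(`span`, `indep`), and this number divides the degrees of all the factors of `F` (`factor`). -/
structure IsState (F : L⟦X⟧[X]) (N : ℕ) (V : Fin (k + 2) → ℕ) (Λ : Fin (k + 2) → κ)
    (Ψ : Fin k → L⟦X⟧[X]) (π : L⟦X⟧[X] →+* κ⟦X⟧[X]) : Prop where
  N_pos : 0 < N
  N_dvd : N ∣ F.natDegree
  V_zero : V 0 ≠ 0
  Λ_ne : ∀ i, Λ i ≠ 0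
  map_C : ∀ f, π (Polynomial.C f) =
    Polynomial.C (monSubst (algebraMap L κ) (Λ 0) (V 0) V_zero f)
  monic : ∀ i, (Ψ i).Monic
  deg_zero : append (fun i => (Ψ i).natDegree) (F.natDegree / N) 0 = 1
  deg_dvd : ∀ i : Fin k, append (fun i => (Ψ i).natDegree) (F.natDegree / N) i.castSucc ∣
    append (fun i => (Ψ i).natDegree) (F.natDegree / N) i.succ
  deg_pos : ∀ i, 0 < append (fun i => (Ψ i).natDegree) (F.natDegree / N) i
  lead : ∀ i : Fin k, ∃ h, HasLead (V i.castSucc.succ) h (π (Ψ i)) ∧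
    h.coeff 0 = Λ i.castSucc.succ
  root : ∀ N₁ M ψ, N = N₁ * M → IsApproxRoot F N₁ ψ →
    ∃ u, HasLead (M * V (Fin.last (k + 1))) (Polynomial.X ^ M * u) (π ψ) ∧
      u.coeff 0 = Λ (Fin.last (k + 1)) ^ M
  factor : ∀ G : L⟦X⟧[X], G.Monic → G ∣ F → F.natDegree ∣ N * G.natDegree
  span : ∃ (σ : Type) (_ : Fintype σ) (b : σ → κ⟦X⟧), Fintype.card σ * N = F.natDegree ∧
    ∀ f, ∃ a : σ → L⟦X⟧, f = ∑ j, b j * monSubst (algebraMap L κ) (Λ 0) (V 0) V_zero (a j)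
  indep : IsIndep L (append (fun i => (Ψ i).natDegree) (F.natDegree / N)) V Λ

lemma append_last {A : Type*} (Ψ : Fin k → A) (ψ : A) : append Ψ ψ (Fin.last k) = ψ :=
  Fin.snoc_last _ _

lemma append_castSucc {A : Type*} (Ψ : Fin k → A) (ψ : A) (i : Fin k) :
    append Ψ ψ i.castSucc = Ψ i :=
  Fin.snoc_castSucc _ _ _

lemma apply_append {A B : Type*} (f : A → B) (Ψ : Fin k → A) (ψ : A) (i : Fin (k + 1)) :
    f (append Ψ ψ i) = append (fun i => f (Ψ i)) (f ψ) i := by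
  refine Fin.lastCases ?_ (fun j => ?_) i
  · rw [append_last, append_last]
  · rw [append_castSucc, append_castSucc]

/-- A translation of `y` by an element of the maximal ideal does not change the leading forms. -/
lemma HasLead.comp_X_add_C {n : ℕ} {h : κ[X]} {p : κ⟦X⟧[X]} (H : HasLead n h p) {β : κ⟦X⟧}
    (hβ : PowerSeries.constantCoeff β = 0) :
    HasLead n h (p.comp (Polynomial.X + Polynomial.C β)) := by
  obtain ⟨p₁, rfl, rfl⟩ := H
  refine ⟨p₁.comp (Polynomial.X + Polynomial.C β), ?_, ?_⟩
  · rw [Polynomial.mul_comp, Polynomial.C_comp]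
  · rw [Polynomial.map_comp, Polynomial.map_add, Polynomial.map_X, Polynomial.map_C, hβ, map_zero,
      add_zero, Polynomial.comp_X]

variable {F : L⟦X⟧[X]} {N : ℕ} {V : Fin (k + 2) → ℕ} {Λ : Fin (k + 2) → κ}
    {Ψ : Fin k → L⟦X⟧[X]} {π : L⟦X⟧[X] →+* κ⟦X⟧[X]}

namespace IsState

/-- The image of the next approximate root is, up to a power of `x`, a polynomial whose reduction
has a simple root at zero. Hensel's lemma gives a root in the maximal ideal, which is translated to
zero. -/
lemma exists_isFrame (st : IsState F N V Λ Ψ π) {ψ : L⟦X⟧[X]} (hψ : IsApproxRoot F N ψ) :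
    ∃ θ : L⟦X⟧[X] →+* κ⟦X⟧[X], IsState F N V Λ Ψ θ ∧ IsFrame V Λ (append Ψ ψ) θ := by
  obtain ⟨u, hu, hu0⟩ := st.root N 1 ψ (mul_one N).symm hψ
  rw [one_mul, pow_one] at hu
  rw [pow_one] at hu0
  obtain ⟨W, hW, hWc⟩ := hu
  obtain ⟨β, hβ, hWβ⟩ := exists_root_of_simple hWc (by rw [hu0]; exact st.Λ_ne _)
  set τ := Polynomial.compRingHom (Polynomial.X + Polynomial.C β) with hτ
  have hlead : ∀ {n h p}, HasLead n h (π p) → HasLead n h ((τ.comp π) p) :=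
    fun H => H.comp_X_add_C hβ
  have hmapC : ∀ f, (τ.comp π) (Polynomial.C f) =
      Polynomial.C (monSubst (algebraMap L κ) (Λ 0) (V 0) st.V_zero f) := by
    intro f
    rw [RingHom.comp_apply, st.map_C, hτ, Polynomial.coe_compRingHom_apply, Polynomial.C_comp]
  have hdeg : (fun i => (append Ψ ψ i).natDegree) =
      append (fun i => (Ψ i).natDegree) (F.natDegree / N) := by
    funext i
    rw [apply_append Polynomial.natDegree, hψ.natDegree_eq st.N_pos]
  have hdeg' : ∀ i, (append Ψ ψ i).natDegree =
      append (fun i => (Ψ i).natDegree) (F.natDegree / N) i := fun i => congrFun hdeg i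
  refine ⟨τ.comp π, ?_, ?_⟩
  · exact {
      N_pos := st.N_pos
      N_dvd := st.N_dvd
      V_zero := st.V_zero
      Λ_ne := st.Λ_ne
      map_C := hmapC
      monic := st.monic
      deg_zero := st.deg_zero
      deg_dvd := st.deg_dvd
      deg_pos := st.deg_pos
      lead := fun i => by
        obtain ⟨h, h1, h2⟩ := st.lead i
        exact ⟨h, hlead h1, h2⟩
      root := fun N₁ M ψ h hψ => by
        obtain ⟨u, h1, h2⟩ := st.root N₁ M ψ h hψ
        exact ⟨u, hlead h1, h2⟩
      factor := st.factor
      span := st.span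
      indep := st.indep }
  · exact {
      V_zero := st.V_zero
      Λ_ne := st.Λ_ne
      map_C := hmapC
      lead := fun i => by
        obtain ⟨h, h1, h2⟩ := st.lead i
        rw [append_castSucc]
        exact ⟨h, hlead h1, h2⟩
      lead_last := by
        have hdvd : Polynomial.X ∣ W.comp (Polynomial.X + Polynomial.C β) := by
          rw [Polynomial.X_dvd_iff, Polynomial.coeff_zero_eq_eval_zero, Polynomial.eval_comp]
          simpa using hWβ
        obtain ⟨U, hU⟩ := hdvd
        refine ⟨U, ?_, ?_⟩
        · rw [append_last, RingHom.comp_apply, hW, hτ, Polynomial.coe_compRingHom_apply,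
            Polynomial.mul_comp, Polynomial.C_comp, hU]
        · have h1 := (hasLead_zero_iff.2 hWc).comp_X_add_C hβ
          rw [hU, hasLead_zero_iff, Polynomial.map_mul, Polynomial.map_X] at h1
          rw [mul_left_cancel₀ Polynomial.X_ne_zero h1, hu0]
      monic := fun i => by
        refine Fin.lastCases ?_ (fun j => ?_) i
        · rw [append_last]; exact hψ.1
        · rw [append_castSucc]; exact st.monic j
      natDegree_zero := by rw [hdeg']; exact st.deg_zero
      dvd := fun i => by rw [hdeg', hdeg']; exact st.deg_dvd i
      pos := fun i => by rw [hdeg']; exact st.deg_pos i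
      indep := by rw [hdeg]; exact st.indep }

end IsState

namespace IsFrame

variable {Φ : Fin (k + 1) → L⟦X⟧[X]} {θ : L⟦X⟧[X] →+* κ⟦X⟧[X]}

/-- If the leading form of the image of `F` is, up to a constant, a power of `P(y ^ q)`, then so is
that of a factor `G` of `F`, and this restricts the degree of `G`. -/
lemma exists_degree_eq_of_dvd (fr : IsFrame V Λ Φ θ) {q m N' : ℕ} (hq : q ≠ 0) (hm : m ≠ 0)
    (hqm : q.Coprime m) {P : κ[X]} (hPm : P.Monic) (hP : Irreducible P) (hPX : P ≠ Polynomial.X)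
    (hN : N = q * P.natDegree * N') (hF : F.Monic)
    (hFd : F.natDegree = N * (Φ (Fin.last k)).natDegree)
    (hlead : HasLead (N * (q * V (Fin.last (k + 1)) + m))
      (Polynomial.C (Λ (Fin.last (k + 1)) ^ N) * Polynomial.expand κ q (P ^ N'))
      (weightSubst κ q hq m (θ F)))
    {G : L⟦X⟧[X]} (hG : G.Monic) (hGF : G ∣ F) {n : ℕ}
    (hGd : G.natDegree = n * (Φ (Fin.last k)).natDegree) : ∃ a, n = q * P.natDegree * a := by
  have hlam := pow_ne_zero N (fr.Λ_ne (Fin.last (k + 1)))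
  obtain ⟨G', hFG⟩ := hGF
  have hG' : G'.Monic := hG.of_mul_monic_left (hFG ▸ hF)
  have hD := fr.pos (Fin.last k)
  have hdd : n * (Φ (Fin.last k)).natDegree + G'.natDegree = N * (Φ (Fin.last k)).natDegree := by
    rw [← hGd, ← hFd, hFG, hG.natDegree_mul hG']
  have hnN : n ≤ N := by
    refine Nat.le_of_mul_le_mul_right ?_ hD
    omega
  obtain ⟨n', rfl⟩ := Nat.exists_eq_add_of_le hnN
  have hGd' : G'.natDegree = n' * (Φ (Fin.last k)).natDegree := by
    rw [add_mul] at hdd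
    exact Nat.add_left_cancel hdd
  have hEm : (Polynomial.expand κ q (P ^ N')).Monic := expand_monic hq (hPm.pow N')
  have hE0 : Polynomial.C (Λ (Fin.last (k + 1)) ^ (n + n')) *
      Polynomial.expand κ q (P ^ N') ≠ 0 :=
    mul_ne_zero (Polynomial.C_ne_zero.2 hlam) hEm.ne_zero
  have hEd : (Polynomial.C (Λ (Fin.last (k + 1)) ^ (n + n')) *
      Polynomial.expand κ q (P ^ N')).natDegree = n + n' := by
    rw [Polynomial.natDegree_C_mul hlam, Polynomial.natDegree_expand, hPm.natDegree_pow, hN]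
    ring
  have hθF : weightSubst κ q hq m (θ F) ≠ 0 := by
    intro h0
    rw [h0] at hlead
    exact hE0 (hlead.unique (HasLead.zero _))
  have hmul : weightSubst κ q hq m (θ F) =
      weightSubst κ q hq m (θ G) * weightSubst κ q hq m (θ G') := by
    rw [hFG, map_mul, map_mul]
  obtain ⟨o, h, h0, hh⟩ := exists_hasLead (left_ne_zero_of_mul (hmul ▸ hθF))
  obtain ⟨o', h', h0', hh'⟩ := exists_hasLead (right_ne_zero_of_mul (hmul ▸ hθF))
  have hprod := hh.mul hh'
  rw [← hmul] at hprod
  have hoo := hprod.order_eq hlead (mul_ne_zero h0 h0') hE0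
  rw [hoo] at hprod
  have heq := hprod.unique hlead
  -- both leading forms have the largest possible degree
  have hdle : ∀ {g : L⟦X⟧[X]} {r : ℕ} {o : ℕ} {h : κ[X]}, g.Monic →
      g.natDegree = r * (Φ (Fin.last k)).natDegree →
      HasLead o h (weightSubst κ q hq m (θ g)) → h.natDegree ≤ r := by
    intro g r o h hg hgd hh
    have := fr.lead_degree_lt (M := r + 1) (lt_of_le_of_lt Polynomial.degree_le_natDegree
      (by rw [hgd]; exact_mod_cast Nat.mul_lt_mul_of_pos_right (Nat.lt_succ_self r) hD)) hq hm hh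
    rw [Polynomial.natDegree_le_iff_degree_le]
    exact Order.le_of_lt_succ (by exact_mod_cast this)
  have hd1 := hdle hG hGd hh
  have hd2 := hdle hG' hGd' hh'
  have hd3 : h.natDegree + h'.natDegree = n + n' := by
    rw [← Polynomial.natDegree_mul h0 h0', heq, hEd]
  have hdn : h.natDegree = n := by omega
  obtain ⟨c, hc⟩ := fr.exists_isExpansion G
  obtain ⟨htop, hlt⟩ := fr.f_of_monic hc hG hGd
  have hform := fr.hasLead_weightSubst hc hq hm fun B hB => fr.le_pairing hc hq hm hh hB
  obtain rfl := hh.unique hform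
  have ho : n * (q * V (Fin.last (k + 1)) + m) = o := by
    have h1 : (leadingForm c (slopeV q m V) Λ o).coeff n ≠ 0 := by
      conv_lhs => rw [← hdn]
      rw [Polynomial.coeff_natDegree]
      exact Polynomial.leadingCoeff_ne_zero.2 h0
    obtain ⟨B, hB, hB1, hB2⟩ := (fr.coeff_lead_ne_zero_iff hc hq m _ _).1 h1
    rcases hlt B hB with rfl | h'
    · rw [← hB1, pairing_single, slopeV_last]
    · omega
  have hdvd : ∀ i, (leadingForm c (slopeV q m V) Λ o).coeff i ≠ 0 → q ∣ n - i := by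
    intro i hi
    have hin : i ≤ n := hdn ▸ Polynomial.le_natDegree_of_ne_zero hi
    obtain ⟨B, hB, hB1, hB2⟩ := (fr.coeff_lead_ne_zero_iff hc hq m _ _).1 hi
    rw [pairing_slopeV, hB2, ← ho] at hB1
    obtain ⟨e, rfl⟩ := Nat.exists_eq_add_of_le hin
    rw [Nat.add_sub_cancel_left]
    refine hqm.dvd_of_dvd_mul_left (m := m) ?_
    have h1 : q * pairing B V = q * ((i + e) * V (Fin.last (k + 1))) + m * e := by
      refine Nat.add_right_cancel (m := m * i) ?_
      rw [hB1]
      ring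
    exact (Nat.dvd_add_right (Dvd.intro _ rfl)).1 (h1 ▸ Dvd.intro _ rfl)
  have hcoeff0 : (leadingForm c (slopeV q m V) Λ o).coeff 0 ≠ 0 := by
    intro h1
    have h2 := congrArg (Polynomial.eval 0) heq
    rw [Polynomial.eval_mul, ← Polynomial.coeff_zero_eq_eval_zero, h1, zero_mul,
      Polynomial.eval_mul, Polynomial.eval_C, Polynomial.expand_eval, zero_pow hq,
      Polynomial.eval_pow] at h2
    have h3 := (mul_eq_zero.1 h2.symm).resolve_left hlam
    apply coeff_zero_ne_zero_of_irreducible hPm hP hPX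
    rw [Polynomial.coeff_zero_eq_eval_zero]
    exact eq_zero_of_pow_eq_zero h3
  have hqn : q ∣ n := by simpa using hdvd 0 hcoeff0
  -- hence the leading form is a polynomial in `y ^ q`, which divides the power of `P`
  obtain ⟨R, hR⟩ : ∃ R, leadingForm c (slopeV q m V) Λ o = Polynomial.expand κ q R := by
    refine exists_eq_expand hq fun i hi => ?_
    have hin : i ≤ n := hdn ▸ Polynomial.le_natDegree_of_ne_zero hi
    exact (Nat.dvd_sub_iff_right hin hqn).1 (hdvd i hi)
  have hRdvd : R ∣ P ^ N' := by
    rw [hR, ← Polynomial.expand_C q, ← map_mul, mul_comm] at heq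
    have h1 := congrArg (Polynomial.contract q) heq
    rw [Polynomial.contract_mul_expand hq, Polynomial.contract_expand _ hq] at h1
    have h2 : R ∣ Polynomial.C (Λ (Fin.last (k + 1)) ^ (n + n')) * P ^ N' :=
      Dvd.intro_left _ h1
    exact (IsUnit.dvd_mul_left (Polynomial.isUnit_C.2 hlam.isUnit)).1 h2
  obtain ⟨a, -, ha⟩ := (dvd_prime_pow hP.prime N').1 hRdvd
  refine ⟨a, ?_⟩
  rw [← hdn, hR, Polynomial.natDegree_expand, Polynomial.natDegree_eq_of_degree_eq
    (Polynomial.degree_eq_degree_of_associated ha), hPm.natDegree_pow]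
  ring

end IsFrame

end State

/-! ### The field generated by a root of the edge polynomial -/

section Root

variable {κ : Type*} [Field κ] {P : κ[X]} [hPf : Fact (Irreducible P)]

lemma root_ne_zero (hPm : P.Monic) (hPX : P ≠ Polynomial.X) : AdjoinRoot.root P ≠ 0 := by
  intro h0
  have h1 : AdjoinRoot.mk P Polynomial.X = 0 := by rw [AdjoinRoot.mk_X, h0]
  rw [AdjoinRoot.mk_eq_zero] at h1
  have h2 := hPf.out.associated_of_dvd Polynomial.irreducible_X h1
  exact hPX (Polynomial.eq_of_monic_of_associated hPm Polynomial.monic_X h2)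

/-- A polynomial which vanishes at the root and has smaller degree than `P` is zero. -/
lemma eq_zero_of_aeval_root {r : κ[X]} (hr : r.degree < P.degree)
    (h : Polynomial.aeval (AdjoinRoot.root P) r = 0) : r = 0 := by
  rw [AdjoinRoot.aeval_eq, AdjoinRoot.mk_eq_zero] at h
  by_contra hne
  exact absurd (Polynomial.degree_le_of_dvd h hne) (not_le.2 hr)

lemma aeval_root_derivative_ne_zero (hPm : P.Monic) (hPd : (P.natDegree : κ) ≠ 0) :
    Polynomial.aeval (AdjoinRoot.root P) (Polynomial.derivative P) ≠ 0 := by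
  have hpos : P.natDegree ≠ 0 := fun h => hPd (by rw [h, Nat.cast_zero])
  intro h
  have h1 := eq_zero_of_aeval_root (Polynomial.degree_derivative_lt hPm.ne_zero) h
  have h2 := congrArg (fun r => Polynomial.coeff r (P.natDegree - 1)) h1
  simp only [Polynomial.coeff_derivative, Polynomial.coeff_zero] at h2
  rw [Nat.sub_add_cancel (Nat.pos_of_ne_zero hpos), Polynomial.coeff_natDegree,
    hPm.leadingCoeff, one_mul] at h2
  apply hPd
  rw [← h2]
  exact_mod_cast congrArg (Nat.cast : ℕ → κ) (Nat.sub_add_cancel (Nat.pos_of_ne_zero hpos)).symm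

lemma exists_eq_sum_root (hPm : P.Monic) (w : AdjoinRoot P) :
    ∃ r : Fin P.natDegree → κ, w = ∑ i, AdjoinRoot.of P (r i) * AdjoinRoot.root P ^ (i : ℕ) := by
  refine ⟨fun i => (AdjoinRoot.powerBasisAux' hPm).repr w i, ?_⟩
  conv_lhs => rw [← (AdjoinRoot.powerBasis' hPm).basis.sum_repr w]
  refine Finset.sum_congr rfl fun i _ => ?_
  rw [PowerBasis.basis_eq_pow, Algebra.smul_def]
  rfl

/-- The polynomial `P(z ^ (-t m) (y + z ^ s) ^ q)` has a simple root at the origin. -/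
lemma exists_comp_eq_X_mul (hz : AdjoinRoot.root P ≠ 0) {q m s t : ℕ}
    (hst : q * s = m * t + 1) : ∃ w : (AdjoinRoot P)[X],
      (P.map (AdjoinRoot.of P)).comp (Polynomial.C (((AdjoinRoot.root P ^ t) ^ m)⁻¹) *
        (Polynomial.X + Polynomial.C (AdjoinRoot.root P ^ s)) ^ q) = Polynomial.X * w ∧
      w.coeff 0 = ((AdjoinRoot.root P ^ t) ^ m)⁻¹ * (q * (AdjoinRoot.root P ^ s) ^ (q - 1)) *
        Polynomial.aeval (AdjoinRoot.root P) (Polynomial.derivative P) := by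
  set z := AdjoinRoot.root P with hzdef
  set g : (AdjoinRoot P)[X] := Polynomial.C (((z ^ t) ^ m)⁻¹) *
    (Polynomial.X + Polynomial.C (z ^ s)) ^ q with hg
  have hg0 : g.eval 0 = z := by
    rw [hg]
    simp only [Polynomial.eval_mul, Polynomial.eval_C, Polynomial.eval_pow, Polynomial.eval_add,
      Polynomial.eval_X, zero_add]
    rw [← pow_mul, ← pow_mul, mul_comm s q, hst, mul_comm t m, pow_succ,
      inv_mul_cancel_left₀ (pow_ne_zero _ hz)]
  have hroot : ((P.map (AdjoinRoot.of P)).comp g).eval 0 = 0 := by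
    rw [Polynomial.eval_comp, hg0, Polynomial.eval_map, AdjoinRoot.eval₂_root]
  obtain ⟨w, hw⟩ : Polynomial.X ∣ (P.map (AdjoinRoot.of P)).comp g := by
    rw [Polynomial.X_dvd_iff, Polynomial.coeff_zero_eq_eval_zero, hroot]
  refine ⟨w, hw, ?_⟩
  have h1 := congrArg (fun r => (Polynomial.derivative r).eval 0) hw
  simp only [Polynomial.derivative_comp, Polynomial.derivative_mul, Polynomial.derivative_X,
    Polynomial.eval_add, Polynomial.eval_mul, Polynomial.eval_X, one_mul,
    zero_mul, add_zero, Polynomial.eval_comp, hg0] at h1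
  rw [Polynomial.coeff_zero_eq_eval_zero, ← h1]
  congr 1
  · rw [hg, Polynomial.derivative_C_mul, Polynomial.derivative_X_add_C_pow]
    simp
  · rw [Polynomial.derivative_map, Polynomial.eval_map, Polynomial.aeval_def,
      AdjoinRoot.algebraMap_eq]

end Root

/-! ### The updated lists -/

section Update

variable {κ : Type*} [Field κ] {k : ℕ} {P : κ[X]} [Fact (Irreducible P)]

lemma updateV_castSucc (q m ℓ : ℕ) (V : Fin (k + 2) → ℕ) (i : Fin (k + 2)) :
    updateV q m ℓ V i.castSucc = slopeV q m V i := Fin.snoc_castSucc _ _ _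

lemma updateV_last (q m ℓ : ℕ) (V : Fin (k + 2) → ℕ) :
    updateV q m ℓ V (Fin.last (k + 2)) = q * ℓ * (q * V (Fin.last (k + 1)) + m) :=
  Fin.snoc_last _ _

lemma updateV_zero (q m ℓ : ℕ) (V : Fin (k + 2) → ℕ) :
    updateV q m ℓ V 0 = q * V 0 := by
  rw [← slopeV_zero q m V]
  exact updateV_castSucc q m ℓ V 0

lemma updateΛ_castSucc_castSucc (q s t : ℕ) (V : Fin (k + 2) → ℕ) (Λ : Fin (k + 2) → κ)
    (i : Fin (k + 1)) : updateΛ q s t P V Λ i.castSucc.castSucc =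
      AdjoinRoot.of P (Λ i.castSucc) * AdjoinRoot.root P ^ (t * V i.castSucc) := by
  rw [updateΛ, Fin.snoc_castSucc, if_neg (Fin.castSucc_lt_last i).ne]

lemma updateΛ_castSucc_last (q s t : ℕ) (V : Fin (k + 2) → ℕ) (Λ : Fin (k + 2) → κ) :
    updateΛ q s t P V Λ (Fin.last (k + 1)).castSucc =
      AdjoinRoot.of P (Λ (Fin.last (k + 1))) *
        AdjoinRoot.root P ^ (t * V (Fin.last (k + 1)) + s) := by
  rw [updateΛ, Fin.snoc_castSucc, if_pos rfl]

lemma updateΛ_last (q s t : ℕ) (V : Fin (k + 2) → ℕ) (Λ : Fin (k + 2) → κ) :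
    updateΛ q s t P V Λ (Fin.last (k + 2)) =
      (q : AdjoinRoot P) * AdjoinRoot.root P ^ (1 - (s : ℤ) - (P.natDegree : ℤ)) *
      Polynomial.aeval (AdjoinRoot.root P) (Polynomial.derivative P) *
      (AdjoinRoot.of P (Λ (Fin.last (k + 1))) *
        AdjoinRoot.root P ^ (t * V (Fin.last (k + 1)) + s)) ^ (q * P.natDegree) := by
  rw [updateΛ, Fin.snoc_last]
  beta_reduce
  rw [if_pos rfl]

lemma updateΛ_zero (q s t : ℕ) (V : Fin (k + 2) → ℕ) (Λ : Fin (k + 2) → κ) :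
    updateΛ q s t P V Λ 0 = AdjoinRoot.of P (Λ 0) * AdjoinRoot.root P ^ (t * V 0) :=
  updateΛ_castSucc_castSucc q s t V Λ 0

lemma updateΛ_ne_zero (hz : AdjoinRoot.root P ≠ 0) (hPm : P.Monic) {q : ℕ}
    (hq : (q : κ) ≠ 0) (hPd : (P.natDegree : κ) ≠ 0) (s t : ℕ) (V : Fin (k + 2) → ℕ)
    {Λ : Fin (k + 2) → κ} (hΛ : ∀ i, Λ i ≠ 0) (i : Fin (k + 3)) :
    updateΛ q s t P V Λ i ≠ 0 := by
  have h1 : ∀ i, AdjoinRoot.of P (Λ i) ≠ 0 := fun i => (map_ne_zero _).2 (hΛ i)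
  have hq' : (q : AdjoinRoot P) ≠ 0 := by
    rw [← map_natCast (AdjoinRoot.of P)]
    exact (map_ne_zero _).2 hq
  refine Fin.lastCases ?_ (fun j => Fin.lastCases ?_ (fun j => ?_) j) i
  · rw [updateΛ_last]
    exact mul_ne_zero (mul_ne_zero (mul_ne_zero hq' (zpow_ne_zero _ hz))
      (aeval_root_derivative_ne_zero hPm hPd))
      (pow_ne_zero _ (mul_ne_zero (h1 _) (pow_ne_zero _ hz)))
  · rw [updateΛ_castSucc_last]
    exact mul_ne_zero (h1 _) (pow_ne_zero _ hz)
  · rw [updateΛ_castSucc_castSucc]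
    exact mul_ne_zero (h1 _) (pow_ne_zero _ hz)

lemma pairing_updateV (q m ℓ : ℕ) (V : Fin (k + 2) → ℕ) (B : Fin (k + 3) → ℕ) :
    pairing B (updateV q m ℓ V) = q * pairing (fun i => B i.castSucc) V +
      m * B (Fin.last (k + 1)).castSucc +
        B (Fin.last (k + 2)) * (q * ℓ * (q * V (Fin.last (k + 1)) + m)) := by
  rw [pairing_castSucc, updateV_last, ← pairing_slopeV q m (fun i => B i.castSucc) V, pairing]
  simp only [updateV_castSucc]

lemma prod_updateΛ (q s t : ℕ) (V : Fin (k + 2) → ℕ) (Λ : Fin (k + 2) → κ)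
    (B : Fin (k + 3) → ℕ) : ∏ j, updateΛ q s t P V Λ j ^ B j =
      AdjoinRoot.of P (∏ j, Λ j ^ B j.castSucc) *
        AdjoinRoot.root P ^ (t * pairing (fun i => B i.castSucc) V +
          s * B (Fin.last (k + 1)).castSucc) *
        updateΛ q s t P V Λ (Fin.last (k + 2)) ^ B (Fin.last (k + 2)) := by
  rw [Fin.prod_univ_castSucc, Fin.prod_univ_castSucc, updateΛ_castSucc_last,
    Fin.prod_univ_castSucc (fun j => Λ j ^ B j.castSucc), pairing_castSucc]
  simp only [updateΛ_castSucc_castSucc, mul_pow, Finset.prod_mul_distrib, map_mul, map_prod,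
    map_pow, ← pow_mul]
  rw [Finset.prod_pow_eq_pow_sum]
  have : ∑ i : Fin (k + 1), t * V i.castSucc * B i.castSucc.castSucc =
      t * ∑ i : Fin (k + 1), B i.castSucc.castSucc * V i.castSucc := by
    rw [Finset.mul_sum]
    exact Finset.sum_congr rfl fun i _ => by ring
  rw [this]
  ring

/-- The leading coefficient of the image of the next approximate root. -/
lemma updateΛ_last_eq (hz : AdjoinRoot.root P ≠ 0) {q m s t : ℕ} (hq : q ≠ 0)
    (hst : q * s = m * t + 1) (V : Fin (k + 2) → ℕ) (Λ : Fin (k + 2) → κ) :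
    AdjoinRoot.of P (Λ (Fin.last (k + 1))) ^ (q * P.natDegree) *
      (AdjoinRoot.root P ^ t) ^ (q * P.natDegree * V (Fin.last (k + 1))) *
      ((AdjoinRoot.root P ^ t) ^ (m * P.natDegree) *
        (((AdjoinRoot.root P ^ t) ^ m)⁻¹ * (q * (AdjoinRoot.root P ^ s) ^ (q - 1)) *
        Polynomial.aeval (AdjoinRoot.root P) (Polynomial.derivative P))) =
      updateΛ q s t P V Λ (Fin.last (k + 2)) := by
  rw [updateΛ_last]
  set z := AdjoinRoot.root P
  set ℓ := P.natDegree
  set v := V (Fin.last (k + 1))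
  have key : (z ^ t) ^ (q * ℓ * v) * ((z ^ t) ^ (m * ℓ) * (((z ^ t) ^ m)⁻¹ * (z ^ s) ^ (q - 1))) =
      z ^ (1 - (s : ℤ) - (ℓ : ℤ)) * (z ^ (t * v + s)) ^ (q * ℓ) := by
    simp only [← pow_mul]
    simp only [← zpow_natCast]
    simp only [← zpow_neg, ← zpow_add₀ hz]
    congr 1
    have h1 : ((q - 1 : ℕ) : ℤ) = q - 1 := by
      rw [Nat.cast_sub (Nat.pos_of_ne_zero hq), Nat.cast_one]
    have h2 : (q : ℤ) * s = m * t + 1 := by exact_mod_cast hst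
    push_cast [h1]
    linear_combination (1 - (ℓ : ℤ)) * h2
  rw [mul_pow (AdjoinRoot.of P (Λ (Fin.last (k + 1))))]
  linear_combination (AdjoinRoot.of P (Λ (Fin.last (k + 1))) ^ (q * ℓ) * q *
    Polynomial.aeval z (Polynomial.derivative P)) * key

variable {L : Type*} [Field L] [Algebra L κ]

/-- The monomials `Λ ^ B` remain independent after an update: the exponents of `z` which appear are
bounded by the degree of `P` up to a shift. -/
lemma IsIndep.update {D' : Fin (k + 2) → ℕ} {V : Fin (k + 2) → ℕ} {Λ : Fin (k + 2) → κ}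
    (hind : IsIndep L (fun i => D' i.castSucc) V Λ) (hz : AdjoinRoot.root P ≠ 0) {q m s t : ℕ}
    (hq : q ≠ 0) (hst : q * s = m * t + 1)
    (hD : D' (Fin.last (k + 1)) = q * P.natDegree * D' (Fin.last k).castSucc)
    (hΛ : updateΛ q s t P V Λ (Fin.last (k + 2)) ≠ 0) :
    IsIndep L D' (updateV q m P.natDegree V) (updateΛ q s t P V Λ) := by
  classical
  intro n i S f hS hsum
  have hq0 := Nat.pos_of_ne_zero hq
  set z := AdjoinRoot.root P with hzdef
  set ℓ := P.natDegree with hℓ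
  set W := q * ℓ * (q * V (Fin.last (k + 1)) + m) with hW
  set A : (Fin (k + 3) → ℕ) → Fin (k + 2) → ℕ := fun B i => B i.castSucc with hA
  set E : (Fin (k + 3) → ℕ) → ℕ := fun B =>
    t * pairing (A B) V + s * B (Fin.last (k + 1)).castSucc with hE
  obtain ⟨n', hn'⟩ : ∃ n', ∀ B ∈ S,
      q * pairing (A B) V + m * B (Fin.last (k + 1)).castSucc = n' := by
    refine ⟨n - i * W, fun B hB => ?_⟩
    obtain ⟨-, h1, h2⟩ := hS B hB
    rw [pairing_updateV, h2] at h1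
    replace h1 : q * pairing (A B) V + m * B (Fin.last (k + 1)).castSucc + i * W = n := h1
    omega
  -- the exponent `E B` of `z` and the entry `bₖ` determine each other, as `q s - m t = 1`
  have hqE : ∀ B ∈ S, q * E B = t * n' + B (Fin.last (k + 1)).castSucc := by
    intro B hB
    rw [← hn' B hB, hE]
    beta_reduce
    rw [mul_add, ← mul_assoc q s, hst]
    ring
  have hbk : ∀ B ∈ S, B (Fin.last (k + 1)).castSucc < q * ℓ := by
    intro B hB
    have h1 := (hS B hB).1 (Fin.last k)
    rw [Fin.succ_last, hD] at h1
    exact lt_of_mul_lt_mul_right h1 (Nat.zero_le _)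
  -- the smallest integer which is at least `t n' / q`
  set E₀ := (t * n' + q - 1) / q with hE₀
  have hE₀1 : t * n' ≤ q * E₀ := by
    have := Nat.div_add_mod (t * n' + q - 1) q
    have h2 := Nat.mod_lt (t * n' + q - 1) hq0
    rw [← hE₀] at this
    omega
  have hE₀2 : ∀ x, t * n' ≤ q * x → E₀ ≤ x := by
    intro x hx
    rw [hE₀]
    refine Nat.le_of_lt_succ ((Nat.div_lt_iff_lt_mul hq0).2 ?_)
    rw [Nat.succ_mul, mul_comm x]
    omega
  have hEB : ∀ B ∈ S, E B = E₀ + (E B - E₀) ∧ E B - E₀ < ℓ := by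
    intro B hB
    have h1 := hqE B hB
    have h2 := hE₀2 (E B) (by omega)
    obtain ⟨c, hc⟩ := Nat.exists_eq_add_of_le h2
    refine ⟨by omega, ?_⟩
    have h3 := hbk B hB
    have h4 : q * c < q * ℓ := by
      rw [hc, mul_add] at h1
      omega
    have := lt_of_mul_lt_mul_left h4 (Nat.zero_le _)
    omega
  set r : κ[X] := ∑ B ∈ S, Polynomial.C (algebraMap L κ (f B) * ∏ j, Λ j ^ A B j) *
    Polynomial.X ^ (E B - E₀) with hr
  have hr0 : r = 0 := by
    refine eq_zero_of_aeval_root (P := P) ?_ ?_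
    · rw [Polynomial.degree_eq_natDegree (Fact.out : Irreducible P).ne_zero,
        Polynomial.degree_lt_iff_coeff_zero]
      intro j hj
      rw [hr, Polynomial.finsetSum_coeff]
      refine Finset.sum_eq_zero fun B hB => ?_
      have := (hEB B hB).2
      rw [Polynomial.coeff_C_mul, Polynomial.coeff_X_pow, if_neg (by omega), mul_zero]
    · have h1 : (z ^ E₀ * updateΛ q s t P V Λ (Fin.last (k + 2)) ^ i) *
          Polynomial.aeval z r = 0 := by
        rw [← hsum, hr, map_sum, Finset.mul_sum]
        refine Finset.sum_congr rfl fun B hB => ?_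
        rw [prod_updateΛ, (hS B hB).2.2]
        have h2 : z ^ (t * pairing (fun i => B i.castSucc) V +
            s * B (Fin.last (k + 1)).castSucc) = z ^ E₀ * z ^ (E B - E₀) := by
          rw [← pow_add, ← (hEB B hB).1]
        rw [h2, map_mul, map_pow, Polynomial.aeval_X, Polynomial.aeval_C, AdjoinRoot.algebraMap_eq,
          map_mul, IsScalarTower.algebraMap_apply L κ (AdjoinRoot P), AdjoinRoot.algebraMap_eq]
        ring
      exact (mul_eq_zero.1 h1).resolve_left
        (mul_ne_zero (pow_ne_zero _ hz) (pow_ne_zero _ hΛ))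
  intro B₀ hB₀
  -- the terms with the same exponent of `z` as `B₀`
  set T := S.filter fun B => E B = E B₀ with hT
  have hinj : Set.InjOn A T := by
    intro B hB B' hB' h
    have h1 := (hS B (Finset.mem_filter.1 hB).1).2.2
    have h2 := (hS B' (Finset.mem_filter.1 hB').1).2.2
    funext j
    refine Fin.lastCases ?_ (fun j => congrFun h j) j
    rw [h1, h2]
  have hsumT : ∑ B ∈ T, algebraMap L κ (f B) * ∏ j, Λ j ^ A B j = 0 := by
    have h1 := congrArg (fun p => Polynomial.coeff p (E B₀ - E₀)) hr0
    simp only [hr, Polynomial.finsetSum_coeff, Polynomial.coeff_C_mul, Polynomial.coeff_X_pow,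
      Polynomial.coeff_zero] at h1
    rw [← h1, hT, Finset.sum_filter]
    refine Finset.sum_congr rfl fun B hB => ?_
    have h2 := (hEB B hB).1
    have h3 := (hEB B₀ hB₀).1
    by_cases h4 : E B = E B₀
    · rw [if_pos h4, if_pos (by rw [h4]), mul_one]
    · rw [if_neg h4, if_neg (by omega), mul_zero]
  have hfin := hind (pairing (A B₀) V) (A B₀ (Fin.last (k + 1))) (T.image A)
    (fun B => f (Fin.snoc (α := fun _ => ℕ) B i)) (by
      intro B hB
      obtain ⟨B', hB', rfl⟩ := Finset.mem_image.1 hB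
      obtain ⟨hB'S, hBE⟩ := Finset.mem_filter.1 hB'
      have h1 := hqE B' hB'S
      have h2 := hqE B₀ hB₀
      rw [hBE] at h1
      have h3 : B' (Fin.last (k + 1)).castSucc = B₀ (Fin.last (k + 1)).castSucc := by omega
      refine ⟨(hS B' hB'S).1.castSucc, ?_, h3⟩
      have h4 := hn' B' hB'S
      rw [← hn' B₀ hB₀, h3] at h4
      exact Nat.eq_of_mul_eq_mul_left hq0 (Nat.add_right_cancel h4)) (by
      rw [Finset.sum_image hinj, ← hsumT]
      refine Finset.sum_congr rfl fun B hB => ?_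
      have h1 : (Fin.snoc (α := fun _ => ℕ) (A B) i) = B := by
        rw [← (hS B (Finset.mem_filter.1 hB).1).2.2]
        exact Fin.snoc_init_self B
      rw [h1])
  have h1 := hfin (A B₀) (Finset.mem_image_of_mem A (Finset.mem_filter.2 ⟨hB₀, rfl⟩))
  have h2 : (Fin.snoc (α := fun _ => ℕ) (A B₀) i) = B₀ := by
    rw [← (hS B₀ hB₀).2.2]
    exact Fin.snoc_init_self B₀
  rwa [h2] at h1

end Update

/-! ### One round of the loop -/

section Round

variable {L : Type*} [Field L] {κ : Type*} [Field κ] [Algebra L κ] {k : ℕ}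
  {P : κ[X]} [hPf : Fact (Irreducible P)]

lemma monSubst_of_monSubst (q m ℓ s t : ℕ) (hq : q ≠ 0) (V : Fin (k + 2) → ℕ) (hV : V 0 ≠ 0)
    (hV' : updateV q m ℓ V 0 ≠ 0) (Λ : Fin (k + 2) → κ) (f : L⟦X⟧) :
    monSubst (AdjoinRoot.of P) (AdjoinRoot.root P ^ t) q hq
      (monSubst (algebraMap L κ) (Λ 0) (V 0) hV f) =
    monSubst (algebraMap L (AdjoinRoot P)) (updateΛ q s t P V Λ 0) (updateV q m ℓ V 0) hV' f := by
  rw [monSubst_monSubst, ← AdjoinRoot.algebraMap_eq, ← IsScalarTower.algebraMap_eq L κ]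
  exact monSubst_congr _ (by rw [updateΛ_zero, ← pow_mul, AdjoinRoot.algebraMap_eq])
    (updateV_zero q m ℓ V).symm _ f

/-- A power series over `κ(z)` is a combination of the products `x ^ j z ^ i`, with `j < q` and
`i < deg P`, with coefficients in the image of `κ⟦x⟧`. -/
lemma exists_eq_sum_monSubst (hPm : P.Monic) {q : ℕ} (hq : q ≠ 0) {a : AdjoinRoot P} (ha : a ≠ 0)
    (f : (AdjoinRoot P)⟦X⟧) : ∃ g : Fin q → Fin P.natDegree → κ⟦X⟧,
      f = ∑ j : Fin q, ∑ i : Fin P.natDegree, PowerSeries.X ^ (j : ℕ) *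
        (PowerSeries.C (AdjoinRoot.root P ^ (i : ℕ)) *
          monSubst (AdjoinRoot.of P) a q hq (g j i)) := by
  choose r hr using fun w : AdjoinRoot P => exists_eq_sum_root hPm w
  refine ⟨fun j i => PowerSeries.mk fun n =>
    r (PowerSeries.coeff (q * n + j) f * (a ^ n)⁻¹) i, ?_⟩
  ext e
  obtain ⟨n, j₀, rfl⟩ : ∃ (n : ℕ) (j₀ : Fin q), e = q * n + j₀ :=
    ⟨e / q, ⟨e % q, Nat.mod_lt _ (Nat.pos_of_ne_zero hq)⟩, (Nat.div_add_mod e q).symm⟩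
  rw [map_sum, Finset.sum_eq_single j₀]
  · rw [map_sum]
    have h1 := hr (PowerSeries.coeff (q * n + j₀) f * (a ^ n)⁻¹)
    rw [← div_eq_mul_inv, div_eq_iff (pow_ne_zero _ ha), Finset.sum_mul] at h1
    rw [h1]
    refine Finset.sum_congr rfl fun i _ => ?_
    rw [PowerSeries.coeff_X_pow_mul, PowerSeries.coeff_C_mul, coeff_monSubst_mul,
      PowerSeries.coeff_mk, div_eq_mul_inv]
    ring
  · intro j _ hj
    rw [map_sum]
    refine Finset.sum_eq_zero fun i _ => ?_
    rw [PowerSeries.coeff_X_pow_mul']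
    split_ifs with hle
    · rw [PowerSeries.coeff_C_mul, coeff_monSubst_of_not_dvd, mul_zero]
      intro hdvd
      have h1 : (j : ℕ) ≡ q * n + j₀ [MOD q] := (Nat.modEq_iff_dvd' hle).2 hdvd
      have h2 : (j : ℕ) ≡ j₀ [MOD q] := by
        refine h1.trans ?_
        rw [Nat.ModEq, Nat.mul_add_mod]
      exact hj (Fin.ext (Nat.ModEq.eq_of_lt_of_lt h2 j.2 j₀.2))
    · rfl
  · simp

variable {F : L⟦X⟧[X]} {N : ℕ} {V : Fin (k + 2) → ℕ} {Λ : Fin (k + 2) → κ}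
    {Ψ : Fin k → L⟦X⟧[X]} {θ : L⟦X⟧[X] →+* κ⟦X⟧[X]}

/-- The invariant of the loop is preserved: if the leading form of the image of `F` for the slope
`m / q` is a power of `P(y ^ q)`, then the Puiseux substitution `x ↦ z ^ t x ^ q`,
`y ↦ x ^ m (y + z ^ s)`, where `z` is a root of `P`, gives the next state. -/
theorem IsState.next (st : IsState F N V Λ Ψ θ) {ψ : L⟦X⟧[X]} (hψ : IsApproxRoot F N ψ)
    (fr : IsFrame V Λ (append Ψ ψ) θ) (hF : F.Monic) (hchar : (F.natDegree : κ) ≠ 0)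
    {q m N' : ℕ} (hq : q ≠ 0) (hm : m ≠ 0) (hqm : q.Coprime m) (hPm : P.Monic)
    (hPX : P ≠ Polynomial.X) (hN : N = q * P.natDegree * N')
    (hlead : HasLead (N * (q * V (Fin.last (k + 1)) + m))
      (Polynomial.C (Λ (Fin.last (k + 1)) ^ N) * Polynomial.expand κ q (P ^ N'))
      (weightSubst κ q hq m (θ F))) {s t : ℕ} (hst : q * s = m * t + 1) :
    ∃ π, IsState F N' (updateV q m P.natDegree V) (updateΛ q s t P V Λ) (append Ψ ψ) π := by
  have hz : AdjoinRoot.root P ≠ 0 := root_ne_zero hPm hPX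
  have hzt : AdjoinRoot.root P ^ t ≠ 0 := pow_ne_zero _ hz
  have hd : N * ψ.natDegree = F.natDegree := by rw [mul_comm]; exact hψ.2.1
  have hlast : (append Ψ ψ (Fin.last k)).natDegree = ψ.natDegree := by rw [append_last]
  have hN' : 0 < N' := by
    rcases Nat.eq_zero_or_pos N' with rfl | h
    · have := st.N_pos
      rw [hN, mul_zero] at this
      omega
    · exact h
  have hcast : ∀ {a : ℕ}, a ∣ F.natDegree → (a : κ) ≠ 0 := by
    rintro a ⟨b, hb⟩ h0
    rw [hb, Nat.cast_mul, h0, zero_mul] at hchar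
    exact hchar rfl
  have hNF : N ∣ F.natDegree := st.N_dvd
  have hqκ : (q : κ) ≠ 0 := hcast (dvd_trans ⟨P.natDegree * N', by rw [hN]; ring⟩ hNF)
  have hPκ : (P.natDegree : κ) ≠ 0 := hcast (dvd_trans ⟨q * N', by rw [hN]; ring⟩ hNF)
  have hN'F : N' ∣ F.natDegree := dvd_trans ⟨q * P.natDegree, by rw [hN]; ring⟩ hNF
  have hPpos : 0 < P.natDegree := Nat.pos_of_ne_zero fun h => hPκ (by rw [h, Nat.cast_zero])
  have hdN' : F.natDegree / N' = q * P.natDegree * ψ.natDegree := by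
    rw [← hd, hN]
    exact Nat.div_eq_of_eq_mul_right hN' (by ring)
  have hΛ := updateΛ_ne_zero hz hPm hqκ hPκ s t V fr.Λ_ne
  have hV' : updateV q m P.natDegree V 0 ≠ 0 := by
    rw [updateV_zero]
    exact mul_ne_zero hq fr.V_zero
  refine ⟨(puiseux (AdjoinRoot.of P) (AdjoinRoot.root P ^ t) (AdjoinRoot.root P ^ s) q hq m).comp θ,
    ?_⟩
  exact {
    N_pos := hN'
    N_dvd := hN'F
    V_zero := hV'
    Λ_ne := hΛ
    map_C := fun f => by
      rw [RingHom.comp_apply, fr.map_C, puiseux_C, monSubst_of_monSubst]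
    monic := fr.monic
    deg_zero := fr.natDegree_zero
    deg_dvd := fun i => by
      rw [append_castSucc]
      refine Fin.lastCases ?_ (fun j => ?_) i
      · rw [Fin.succ_last, append_last, append_last, hdN']
        exact Dvd.intro_left _ rfl
      · have h1 := append_castSucc (fun i => (append Ψ ψ i).natDegree) (F.natDegree / N') j.succ
        rw [Fin.succ_castSucc, h1]
        exact fr.dvd j
    deg_pos := fun i => by
      refine Fin.lastCases ?_ (fun j => ?_) i
      · rw [append_last, hdN', ← hlast]
        exact Nat.mul_pos (Nat.mul_pos (Nat.pos_of_ne_zero hq) hPpos) (fr.pos _)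
      · rw [append_castSucc]
        exact fr.pos j
    lead := fun i => by
      refine Fin.lastCases ?_ (fun j => ?_) i
      · obtain ⟨U, hU, hUc⟩ := fr.lead_last
        have h1 := (hasLead_C (dvd_refl
          (PowerSeries.X ^ V (Fin.last (k + 1)) : κ⟦X⟧))).map_puiseux
          (AdjoinRoot.of P) (AdjoinRoot.root P ^ t) (AdjoinRoot.root P ^ s) q hq hm
        have h2 : HasLead (m + 0) (Polynomial.X + Polynomial.C (AdjoinRoot.root P ^ s))
            (Polynomial.C (PowerSeries.X ^ m) * (Polynomial.X +
              Polynomial.C (PowerSeries.C (AdjoinRoot.root P ^ s)))) := by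
          rw [hasLead_C_mul_iff, hasLead_zero_iff]
          simp
        have h3 := (hasLead_zero_iff.2 (rfl : U.map PowerSeries.constantCoeff = _)).map_puiseux
          (AdjoinRoot.of P) (AdjoinRoot.root P ^ t) (AdjoinRoot.root P ^ s) q hq hm
        have h4 := h1.mul (h2.mul h3)
        rw [← puiseux_X (AdjoinRoot.of P) (AdjoinRoot.root P ^ t) (AdjoinRoot.root P ^ s) q hq m,
          ← map_mul, ← map_mul, ← hU, mul_zero, add_zero, add_zero] at h4
        have e : updateV q m P.natDegree V (Fin.last k).castSucc.succ =
            q * V (Fin.last (k + 1)) + m := by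
          rw [Fin.succ_castSucc, Fin.succ_last, updateV_castSucc, slopeV_last]
        rw [e]
        refine ⟨_, h4, ?_⟩
        rw [Fin.succ_castSucc, Fin.succ_last, updateΛ_castSucc_last, hUc,
          PowerSeries.coeff_X_pow_self, Polynomial.coeff_C_zero]
        simp only [Polynomial.coeff_zero_eq_eval_zero, Polynomial.eval_mul, Polynomial.eval_C,
          Polynomial.eval_add, Polynomial.eval_X, zero_add, map_one, one_mul, pow_zero, mul_one]
        rw [← pow_mul, pow_add]
        ring
      · obtain ⟨h, h1, h2⟩ := fr.lead j
        have h3 := h1.map_puiseux (AdjoinRoot.of P) (AdjoinRoot.root P ^ t)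
          (AdjoinRoot.root P ^ s) q hq hm
        have e : updateV q m P.natDegree V j.castSucc.castSucc.succ = q * V j.castSucc.succ := by
          rw [Fin.succ_castSucc, Fin.succ_castSucc, updateV_castSucc, slopeV_castSucc]
        rw [e]
        refine ⟨_, h3, ?_⟩
        · have e : updateΛ q s t P V Λ j.castSucc.castSucc.succ = AdjoinRoot.of P
              (Λ j.castSucc.succ) * AdjoinRoot.root P ^ (t * V j.castSucc.succ) := by
            rw [Fin.succ_castSucc, Fin.succ_castSucc, updateΛ_castSucc_castSucc]
          rw [e, h2, Polynomial.coeff_C_zero, pow_mul]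
    root := fun N₁ M ψ₁ hNM hψ₁ => by
      have hN₁ : (N₁ : κ) ≠ 0 := hcast (dvd_trans ⟨M, hNM⟩ hN'F)
      have hNM' : N = N₁ * (q * P.natDegree * M) := by rw [hN, hNM]; ring
      obtain ⟨u, hu, hu0⟩ := st.root N₁ (q * P.natDegree * M) ψ₁ hNM' hψ₁
      have hFd' : F.natDegree = N₁ * (q * P.natDegree * M) *
          (append Ψ ψ (Fin.last k)).natDegree := by rw [hlast, ← hNM', hd]
      have hlead' : HasLead (N₁ * (q * P.natDegree * M) * (q * V (Fin.last (k + 1)) + m))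
          ((Polynomial.C (Λ (Fin.last (k + 1)) ^ (q * P.natDegree * M)) *
            Polynomial.expand κ q (P ^ M)) ^ N₁) (weightSubst κ q hq m (θ F)) := by
        rw [← hNM', mul_pow, ← Polynomial.C_pow, ← pow_mul, ← map_pow, ← pow_mul, mul_comm _ N₁,
          ← hNM', mul_comm M, ← hNM]
        exact hlead
      obtain ⟨h, hh⟩ := fr.exists_lead_approxRoot hF hFd' hN₁ hψ₁
        (by rw [hu0]; exact pow_ne_zero _ (fr.Λ_ne _)) hu hq hm hlead'
      have hPMm : (Polynomial.expand κ q (P ^ M)).Monic := expand_monic hq (hPm.pow M)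
      have hPMd : (Polynomial.expand κ q (P ^ M)).natDegree = q * P.natDegree * M := by
        rw [Polynomial.natDegree_expand, hPm.natDegree_pow]; ring
      have heq := fr.lead_approxRoot hFd' hN₁ hψ₁ hq hm hlead' hh
        (by rw [← hPMd]; exact Polynomial.natDegree_C_mul_le _ _)
        (by
          rw [Polynomial.coeff_C_mul]
          have h1 := hPMm.coeff_natDegree
          rw [hPMd] at h1
          rw [h1, mul_one])
      rw [heq, show q * P.natDegree * M * (q * V (Fin.last (k + 1)) + m) =
        q * (q * P.natDegree * M * V (Fin.last (k + 1))) + m * (q * (M * P.natDegree)) by ring]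
        at hh
      -- the substitution turns `P(y ^ q)` into `y w`, so that `M` factors `y` appear
      have htw := hh.puiseux_of_weightSubst (hPm.natDegree_pow M).le (AdjoinRoot.of P) hzt
        (AdjoinRoot.root P ^ s)
      obtain ⟨w, hw, hw0⟩ := exists_comp_eq_X_mul (P := P) hz hst
      rw [Polynomial.map_pow, Polynomial.pow_comp, hw] at htw
      refine ⟨Polynomial.C (AdjoinRoot.of P (Λ (Fin.last (k + 1)) ^ (q * P.natDegree * M)) *
        (AdjoinRoot.root P ^ t) ^ (q * P.natDegree * M * V (Fin.last (k + 1)))) *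
        (Polynomial.C ((AdjoinRoot.root P ^ t) ^ (m * (M * P.natDegree))) * w ^ M), ?_, ?_⟩
      · rw [updateV_last, RingHom.comp_apply, show M * (q * P.natDegree *
          (q * V (Fin.last (k + 1)) + m)) = q * (q * P.natDegree * M * V (Fin.last (k + 1))) +
            m * (q * (M * P.natDegree)) by ring]
        convert htw using 1
        ring
      · rw [← updateΛ_last_eq hz hq hst]
        rw [Polynomial.coeff_zero_eq_eval_zero] at hw0
        simp only [Polynomial.coeff_zero_eq_eval_zero, Polynomial.eval_mul, Polynomial.eval_C,
          Polynomial.eval_pow, hw0, map_pow]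
        ring
    factor := fun G hG hGF => by
      have h1 := st.factor G hG hGF
      rw [← hd] at h1
      obtain ⟨n, hn⟩ := Nat.dvd_of_mul_dvd_mul_left st.N_pos h1
      rw [mul_comm] at hn
      obtain ⟨a, ha⟩ := fr.exists_degree_eq_of_dvd hq hm hqm hPm hPf.out hPX hN hF
        (by rw [hlast, hd]) hlead hG hGF (n := n) (by rw [hlast, hn])
      refine ⟨a, ?_⟩
      rw [hn, ha, ← hd, hN]
      ring
    span := by
      obtain ⟨σ, hσ, b, hcard, hb⟩ := st.span
      refine ⟨Fin q × Fin P.natDegree × σ, inferInstance, fun x => PowerSeries.X ^ (x.1 : ℕ) *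
        (PowerSeries.C (AdjoinRoot.root P ^ (x.2.1 : ℕ)) *
          monSubst (AdjoinRoot.of P) (AdjoinRoot.root P ^ t) q hq (b x.2.2)), ?_, fun f => ?_⟩
      · rw [Fintype.card_prod, Fintype.card_prod, Fintype.card_fin, Fintype.card_fin, ← hcard, hN]
        ring
      · obtain ⟨g, hg⟩ := exists_eq_sum_monSubst hPm hq hzt f
        choose a ha using hb
        refine ⟨fun x => a (g x.1 x.2.1) x.2.2, ?_⟩
        rw [Fintype.sum_prod_type]
        simp only [Fintype.sum_prod_type]
        conv_lhs => rw [hg]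
        refine Finset.sum_congr rfl fun j _ => Finset.sum_congr rfl fun i _ => ?_
        conv_lhs => rw [ha (g j i)]
        rw [map_sum, Finset.mul_sum, Finset.mul_sum]
        refine Finset.sum_congr rfl fun x _ => ?_
        rw [map_mul, monSubst_of_monSubst q m P.natDegree s t hq V st.V_zero hV']
        ring
    indep := by
      refine IsIndep.update (D' := append (fun i => (append Ψ ψ i).natDegree) (F.natDegree / N'))
        ?_ hz hq hst ?_ (hΛ _)
      · simp only [append_castSucc]
        exact fr.indep
      · rw [append_last, append_castSucc, hlast, hdN'] }

end Round

/-! ### Factors over an extension of the ring of coefficients -/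

section Descent

/-- Let `R` be generated by `σ` as a module over `A`, and `ϑ : A[y] → R[y]` be a ring homomorphism
which extends `A → R`. Modulo a monic polynomial `G` over `R`, the image of `y` under `ϑ` is
integral over `A`, of degree at most `|σ| deg G`. -/
lemma exists_monic_dvd_map {A R : Type*} [CommRing A] [CommRing R] {ϑ : A[X] →+* R[X]}
    {φ : A →+* R} (hC : ∀ a, ϑ (Polynomial.C a) = Polynomial.C (φ a)) {σ : Type*} [Fintype σ]
    {b : σ → R} (hb : ∀ f, ∃ a : σ → A, f = ∑ j, b j * φ (a j)) {G : R[X]} (hG : G.Monic) :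
    ∃ Q : A[X], Q.Monic ∧ Q.natDegree ≤ Fintype.card σ * G.natDegree ∧ G ∣ ϑ Q := by
  classical
  set S := AdjoinRoot G
  let _ : Algebra A S := ((AdjoinRoot.of G).comp φ).toAlgebra
  have hsmul : ∀ (a : A) (x : S), a • x = AdjoinRoot.of G (φ a) * x := fun a x => rfl
  set v : σ × Fin G.natDegree → S := fun x =>
    AdjoinRoot.of G (b x.1) * AdjoinRoot.root G ^ (x.2 : ℕ) with hv
  have hspan : Submodule.span A (Set.range v) = ⊤ := by
    rw [eq_top_iff]
    intro x _
    rw [← (AdjoinRoot.powerBasis' hG).basis.sum_repr x]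
    refine Submodule.sum_mem _ fun i _ => ?_
    obtain ⟨a, ha⟩ := hb ((AdjoinRoot.powerBasis' hG).basis.repr x i)
    rw [PowerBasis.basis_eq_pow, Algebra.smul_def, ha, map_sum, Finset.sum_mul]
    refine Submodule.sum_mem _ fun j _ => ?_
    have h1 : algebraMap R S (b j * φ (a j)) * (AdjoinRoot.powerBasis' hG).gen ^ (i : ℕ) =
        a j • v (j, i) := by
      rw [hsmul, hv, map_mul]
      change AdjoinRoot.of G (b j) * AdjoinRoot.of G (φ (a j)) * AdjoinRoot.root G ^ (i : ℕ) = _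
      ring
    rw [h1]
    exact Submodule.smul_mem _ _ (Submodule.subset_span ⟨_, rfl⟩)
  have : Module.Finite A S := ⟨hspan ▸ Submodule.fg_span (Set.finite_range v)⟩
  set Y : S := AdjoinRoot.mk G (ϑ Polynomial.X) with hY
  obtain ⟨Q, hQm, hQd, hQ⟩ := LinearMap.exists_monic_and_natDegree_eq_and_aeval_eq_zero A
    (Algebra.lmul A S Y)
  refine ⟨Q, hQm, ?_, ?_⟩
  · rw [hQd, ← hspan]
    refine (Submodule.spanFinrank_span_le_ncard_of_finite (Set.finite_range v)).trans ?_
    rw [← Set.image_univ]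
    refine (Set.ncard_image_le Set.finite_univ).trans ?_
    rw [Set.ncard_univ, Nat.card_eq_fintype_card, Fintype.card_prod, Fintype.card_fin]
  · rw [← AdjoinRoot.mk_eq_zero]
    have h1 : Polynomial.aeval Y Q = 0 := by
      rw [Polynomial.aeval_algHom_apply] at hQ
      have := LinearMap.congr_fun hQ 1
      simpa using this
    have h2 : ((AdjoinRoot.mk G).comp ϑ) = (Polynomial.aeval Y : A[X] →ₐ[A] S).toRingHom := by
      refine Polynomial.ringHom_ext (fun a => ?_) ?_
      · rw [RingHom.comp_apply, hC]
        simp only [AlgHom.toRingHom_eq_coe, RingHom.coe_coe, Polynomial.aeval_C]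
        rfl
      · simp [hY]
    have h3 := congrArg (fun f => f Q) h2
    simp only [RingHom.comp_apply, AlgHom.toRingHom_eq_coe, RingHom.coe_coe] at h3
    rw [h3, h1]

/-- A nonzero constant is a combination of a monic prime polynomial and a nonzero polynomial of
smaller degree. -/
lemma exists_C_eq_combination {A : Type*} [CommRing A] [Nontrivial A] {F Q : A[X]} (hF : F.Monic)
    (hp : Prime F) (hQ : Q ≠ 0) (hd : Q.natDegree < F.natDegree) :
    ∃ (c : A) (a b : A[X]), c ≠ 0 ∧ Polynomial.C c = a * F + b * Q := by
  have := AdjoinRoot.isDomain_of_prime hp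
  have := hF.finite_adjoinRoot
  have hne : AdjoinRoot.mk F Q ≠ 0 := by
    rw [Ne, AdjoinRoot.mk_eq_zero]
    intro hdvd
    have h1 := hF.not_dvd_of_natDegree_lt hQ hd
    exact h1 hdvd
  have h1 := Ideal.comap_ne_bot_of_integral_mem (R := A) hne
    (Ideal.mem_span_singleton_self (AdjoinRoot.mk F Q)) (Algebra.IsIntegral.isIntegral _)
  obtain ⟨c, hc, hc0⟩ := Submodule.exists_mem_ne_zero_of_ne_bot h1
  obtain ⟨x, hx⟩ := Ideal.mem_span_singleton'.1 (Ideal.mem_comap.1 hc)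
  obtain ⟨b, rfl⟩ := AdjoinRoot.mk_surjective x
  have h2 : AdjoinRoot.mk F (Polynomial.C c) = AdjoinRoot.mk F (b * Q) := by
    rw [map_mul, hx]
    rfl
  rw [AdjoinRoot.mk_eq_mk] at h2
  obtain ⟨a, ha⟩ := h2
  exact ⟨c, a, b, hc0, by rw [mul_comm a, ← ha]; ring⟩

variable {L : Type*} [Field L] {κ : Type*} [Field κ] [Algebra L κ] {k : ℕ}
  {F : L⟦X⟧[X]} {N : ℕ} {V : Fin (k + 2) → ℕ} {Λ : Fin (k + 2) → κ}
  {Ψ : Fin k → L⟦X⟧[X]} {θ : L⟦X⟧[X] →+* κ⟦X⟧[X]}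

/-- If `F` is irreducible, then its image cannot have a monic factor of positive degree smaller than
`N`: the image of `y` modulo this factor would be integral over `L⟦x⟧` of degree smaller than that
of `F`. -/
lemma IsState.not_irreducible_of_dvd (st : IsState F N V Λ Ψ θ) (hF : F.Monic) {G : κ⟦X⟧[X]}
    (hG : G.Monic) (hGF : G ∣ θ F) (hG0 : 0 < G.natDegree) (hGN : G.natDegree < N) :
    ¬ Irreducible F := by
  intro hirr
  obtain ⟨σ, hσ, b, hcard, hb⟩ := st.span
  obtain ⟨Q, hQm, hQd, hQ⟩ := exists_monic_dvd_map st.map_C hb hG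
  have hpos : 0 < F.natDegree := by
    by_contra h
    rw [not_lt, Nat.le_zero, hF.natDegree_eq_zero] at h
    exact hirr.not_isUnit (h ▸ isUnit_one)
  have hσ0 : 0 < Fintype.card σ := by
    rcases Nat.eq_zero_or_pos (Fintype.card σ) with h | h
    · rw [h, zero_mul] at hcard; omega
    · exact h
  have hlt : Q.natDegree < F.natDegree := by
    rw [← hcard]
    exact lt_of_le_of_lt hQd (Nat.mul_lt_mul_of_pos_left hGN hσ0)
  obtain ⟨c, a, b', hc, hcomb⟩ := exists_C_eq_combination hF hirr.prime hQm.ne_zero hlt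
  have h1 : G ∣ θ (Polynomial.C c) := by
    rw [hcomb, map_add, map_mul, map_mul]
    exact dvd_add (dvd_mul_of_dvd_right hGF _) (dvd_mul_of_dvd_right hQ _)
  rw [st.map_C] at h1
  have h2 : monSubst (algebraMap L κ) (Λ 0) (V 0) st.V_zero c ≠ 0 := by
    rw [Ne, map_eq_zero_iff _ (monSubst_injective _ (st.Λ_ne 0) _ _)]
    exact hc
  refine hG.not_dvd_of_natDegree_lt (Polynomial.C_ne_zero.2 h2) ?_ h1
  rw [Polynomial.natDegree_C]
  exact hG0

end Descent

/-! ### Leading forms which are not degenerated -/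

section Coprime

variable {κ : Type*} [Field κ] {H : κ[X][X]} {h : κ[X]} {N q m : ℕ} {lam : κ}

lemma isGraded_of_dvd {r : ℕ} {g : κ[X]} (h1 : ∀ i, g.coeff i ≠ 0 → (i : ZMod q) = r)
    (h2 : (g.natDegree : ZMod q) = r) : IsGraded q m (m * g.natDegree) g := by
  intro i hi
  rw [h1 i hi, h2]

/-- If the boundary polynomial is not degenerated, then the leading form is a product of two
coprime quasi-homogeneous factors. -/
lemma exists_coprime_factors (hq : q ≠ 0) (hqm : q.Coprime m) (hlam : lam ≠ 0)
    (hdeg : h.natDegree ≤ N) (hlc : h.coeff N = lam ^ N) (hex : ∃ i < N, h.coeff i ≠ 0)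
    (hdvd : ∀ i, h.coeff i ≠ 0 → q ∣ N - i)
    (hH : ∀ i, H.coeff i = Polynomial.C (h.coeff i / lam ^ N) *
      Polynomial.X ^ (m * ((N - i) / q))) (hnd : ¬ Degenerated H) :
    ∃ h₁ h₂ : κ[X], h = h₁ * h₂ ∧ h₁.Monic ∧ IsCoprime h₁ h₂ ∧
      IsGraded q m (m * h₁.natDegree) h₁ ∧ IsGraded q m (m * h₂.natDegree) h₂ ∧
      0 < h₁.natDegree ∧ h₁.natDegree < N ∧ h₁.natDegree + h₂.natDegree = N := by
  have hq0 := Nat.pos_of_ne_zero hq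
  have hlamN : lam ^ N ≠ 0 := pow_ne_zero N hlam
  have hle : ∀ i, h.coeff i ≠ 0 → i ≤ N :=
    fun i hi => (Polynomial.le_natDegree_of_ne_zero hi).trans hdeg
  have hdN : h.natDegree = N := le_antisymm hdeg
    (Polynomial.le_natDegree_of_ne_zero (by rw [hlc]; exact hlamN))
  obtain ⟨r, J, hr, hNr⟩ : ∃ r J, r < q ∧ N = q * J + r :=
    ⟨N % q, N / q, Nat.mod_lt _ hq0, (Nat.div_add_mod N q).symm⟩
  obtain ⟨h', hh'⟩ : Polynomial.X ^ r ∣ h := by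
    rw [Polynomial.X_pow_dvd_iff]
    intro i hi
    by_contra hne
    obtain ⟨e, he⟩ := hdvd i hne
    have h1 := hle i hne
    have h2 : q * J + r = q * e + i := by omega
    have h3 := congrArg (· % q) h2
    simp only [Nat.mul_add_mod, Nat.mod_eq_of_lt hr, Nat.mod_eq_of_lt (hi.trans hr)] at h3
    omega
  have hcoef : ∀ i, h.coeff (i + r) = h'.coeff i := fun i => by
    rw [hh', mul_comm, Polynomial.coeff_mul_X_pow]
  obtain ⟨R, rfl⟩ : ∃ R, h' = Polynomial.expand κ q R := by
    refine exists_eq_expand hq fun i hi => ?_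
    rw [← hcoef] at hi
    have h1 := hle _ hi
    have h2 := hdvd _ hi
    rw [show N - (i + r) = q * J - i by omega] at h2
    exact (Nat.dvd_sub_iff_right (by omega) (Dvd.intro _ rfl)).1 h2
  have hR0 : R ≠ 0 := by
    rintro rfl
    rw [map_zero, mul_zero] at hh'
    rw [hh', Polynomial.coeff_zero] at hlc
    exact hlamN hlc.symm
  -- the part of `R` which is prime to `y` is not constant
  obtain ⟨R₁, hR₁, hR₁X⟩ := (FiniteMultiplicity.of_not_isUnit
    Polynomial.irreducible_X.not_isUnit hR0).exists_eq_pow_mul_and_not_dvd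
  set a := multiplicity Polynomial.X R
  have hR₁u : ¬ IsUnit R₁ := by
    intro hu
    obtain ⟨c, hc, rfl⟩ := Polynomial.isUnit_iff.1 hu
    have h1 : h = Polynomial.C c * Polynomial.X ^ (r + q * a) := by
      rw [hh', hR₁, map_mul, map_pow, Polynomial.expand_X, Polynomial.expand_C, ← pow_mul]
      ring
    have h2 : ∀ i, h.coeff i ≠ 0 → i = r + q * a := by
      intro i hi
      by_contra hne
      rw [h1, Polynomial.coeff_C_mul, Polynomial.coeff_X_pow, if_neg hne, mul_zero] at hi
      exact hi rfl
    obtain ⟨i, hi, hi'⟩ := hex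
    have h3 := h2 i hi'
    have h4 := h2 N (by rw [hlc]; exact hlamN)
    omega
  obtain ⟨P, hPm, hP, hPR₁⟩ := Polynomial.exists_monic_irreducible_factor R₁ hR₁u
  have hPX : P ≠ Polynomial.X := by
    rintro rfl
    exact hR₁X hPR₁
  obtain ⟨R₂, hR₂, hPR₂⟩ := (FiniteMultiplicity.of_not_isUnit
    hP.not_isUnit hR0).exists_eq_pow_mul_and_not_dvd
  set b := multiplicity P R
  have hb : 0 < b := by
    rcases Nat.eq_zero_or_pos b with h0 | h0
    · exfalso
      rw [h0, pow_zero, one_mul] at hR₂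
      exact hPR₂ (hR₂ ▸ (hR₁ ▸ dvd_mul_of_dvd_right hPR₁ _))
    · exact h0
  have hPb : (P ^ b).Monic := hPm.pow b
  have hPpos : 0 < P.natDegree := hP.natDegree_pos
  have hd1 : (Polynomial.expand κ q (P ^ b)).natDegree = q * (b * P.natDegree) := by
    rw [Polynomial.natDegree_expand, hPm.natDegree_pow, mul_comm]
  have hR₂0 : R₂ ≠ 0 := by
    rintro rfl
    rw [mul_zero] at hR₂
    exact hR0 hR₂
  have hE₂ : Polynomial.expand κ q R₂ ≠ 0 := (Polynomial.expand_ne_zero hq0).2 hR₂0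
  have hd2 : (Polynomial.X ^ r * Polynomial.expand κ q R₂).natDegree =
      r + q * R₂.natDegree := by
    rw [Polynomial.natDegree_mul (pow_ne_zero _ Polynomial.X_ne_zero) hE₂,
      Polynomial.natDegree_X_pow, Polynomial.natDegree_expand, mul_comm q]
  have hprod : h = Polynomial.expand κ q (P ^ b) *
      (Polynomial.X ^ r * Polynomial.expand κ q R₂) := by
    rw [hh', hR₂, map_mul]
    ring
  have hsum : (Polynomial.expand κ q (P ^ b)).natDegree +
      (Polynomial.X ^ r * Polynomial.expand κ q R₂).natDegree = N := by
    rw [← hdN, hprod, Polynomial.natDegree_mul (expand_monic hq hPb).ne_zero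
      (mul_ne_zero (pow_ne_zero _ Polynomial.X_ne_zero) hE₂)]
  refine ⟨_, _, hprod, expand_monic hq hPb, ?_, ?_, ?_, ?_, ?_, hsum⟩
  · refine IsCoprime.mul_right (IsCoprime.pow_right ?_) ?_
    · refine IsCoprime.symm ((Polynomial.irreducible_X.coprime_iff_not_dvd).2 ?_)
      rw [Polynomial.X_dvd_iff, Polynomial.coeff_zero_eq_eval_zero, Polynomial.expand_eval,
        zero_pow hq, Polynomial.eval_pow, ← Polynomial.coeff_zero_eq_eval_zero]
      exact pow_ne_zero _ (coeff_zero_ne_zero_of_irreducible hPm hP hPX)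
    · exact (((hP.coprime_iff_not_dvd).2 hPR₂).pow_left (m := b)).map
        (Polynomial.expand κ q : κ[X] →+* κ[X])
  · refine isGraded_of_dvd (r := 0) (fun i hi => ?_) ?_
    · rw [Polynomial.coeff_expand hq0] at hi
      have hqi : q ∣ i := by
        by_contra hne
        rw [if_neg hne] at hi
        exact hi rfl
      rw [(ZMod.natCast_eq_zero_iff i q).2 hqi, Nat.cast_zero]
    · rw [hd1, Nat.cast_mul, ZMod.natCast_self, zero_mul, Nat.cast_zero]
  · refine isGraded_of_dvd (r := r) (fun i hi => ?_) ?_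
    · rw [Polynomial.coeff_X_pow_mul'] at hi
      by_cases hri : r ≤ i
      · rw [if_pos hri, Polynomial.coeff_expand hq0] at hi
        have hqi : q ∣ i - r := by
          by_contra hne
          rw [if_neg hne] at hi
          exact hi rfl
        obtain ⟨e, he⟩ := hqi
        rw [show i = r + q * e by omega, Nat.cast_add, Nat.cast_mul, ZMod.natCast_self, zero_mul,
          add_zero]
      · rw [if_neg hri] at hi
        exact absurd rfl hi
    · rw [hd2, Nat.cast_add, Nat.cast_mul, ZMod.natCast_self, zero_mul, add_zero]
  · rw [hd1]
    exact Nat.mul_pos hq0 (Nat.mul_pos hb hPpos)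
  · refine lt_of_le_of_ne (by omega) fun hN => hnd ?_
    -- otherwise the second factor is constant
    have h1 : (Polynomial.X ^ r * Polynomial.expand κ q R₂).natDegree = 0 := by omega
    obtain ⟨c, hc⟩ := Polynomial.natDegree_eq_zero.1 h1
    have h2 : c = lam ^ N := by
      have h3 := expand_monic hq hPb
      rw [← hlc, hprod, ← hc, mul_comm, Polynomial.coeff_C_mul, ← hN, h3.coeff_natDegree, mul_one]
    refine degenerated_of_lead (N' := b) hq hqm hlam hdvd hH hPm hP hPX hb ?_ ?_
    · rw [← hN, hd1]
      ring
    · rw [hprod, ← hc, h2, mul_comm]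

end Coprime

/-! ### The initial state -/

section Initial

variable {L : Type*} [Field L]

lemma isState_initial {F : L⟦X⟧[X]} (hF : F.Monic)
    (hF0 : F.map PowerSeries.constantCoeff = Polynomial.X ^ F.natDegree)
    (hchar : (F.natDegree : L) ≠ 0) :
    IsState (κ := L) F F.natDegree ![1, 0] ![1, 1] Fin.elim0 (RingHom.id _) := by
  have hd : 0 < F.natDegree := Nat.pos_of_ne_zero fun h => hchar (by rw [h, Nat.cast_zero])
  have hdd : F.natDegree / F.natDegree = 1 := Nat.div_self hd
  have hmon : ∀ f : L⟦X⟧, monSubst (algebraMap L L) ((![1, 1] : Fin 2 → L) 0)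
      ((![1, 0] : Fin 2 → ℕ) 0) one_ne_zero f = f := fun f => monSubst_id f
  have happ : ∀ i, append (fun i : Fin 0 => (Fin.elim0 i : L⟦X⟧[X]).natDegree)
      (F.natDegree / F.natDegree) i = 1 := by
    intro i
    refine Fin.lastCases ?_ (fun j => j.elim0) i
    rw [append_last, hdd]
  exact {
    N_pos := hd
    N_dvd := dvd_rfl
    V_zero := one_ne_zero
    Λ_ne := fun i => by fin_cases i <;> exact one_ne_zero
    map_C := fun f => by rw [hmon]; rfl
    monic := fun i => i.elim0
    deg_zero := happ 0
    deg_dvd := fun i => i.elim0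
    deg_pos := fun i => by rw [happ]; exact one_pos
    lead := fun i => i.elim0
    root := fun N₁ M ψ hN hψ => by
      have hN₁ : (N₁ : L) ≠ 0 := by
        intro h
        rw [hN, Nat.cast_mul, h, zero_mul] at hchar
        exact hchar rfl
      have hN₁0 : 0 < N₁ := Nat.pos_of_ne_zero fun h => hN₁ (by rw [h, Nat.cast_zero])
      have hψd : ψ.natDegree = M := by
        rw [hψ.natDegree_eq hN₁0, hN, Nat.mul_div_cancel_left _ hN₁0]
      have hψ' := hψ.map (PowerSeries.constantCoeff (R := L)) hF
      have h1 : ψ.map PowerSeries.constantCoeff = Polynomial.X ^ M := by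
        refine eq_of_degree_pow_sub_pow_lt (M := M) (n := N₁) ?_ ?_ ?_ ?_ hN₁ ?_
        · rw [hψ.1.natDegree_map, hψd]
        · exact Polynomial.natDegree_X_pow_le M
        · rw [Polynomial.coeff_X_pow_self, ← hψd, Polynomial.coeff_map,
            Polynomial.coeff_natDegree, hψ.1.leadingCoeff, map_one]
        · rw [Polynomial.coeff_X_pow_self]
          exact one_ne_zero
        · have h2 := hψ'.2.2
          rw [hF.natDegree_map, hF0, hN, Nat.mul_div_cancel_left _ hN₁0, mul_comm N₁, pow_mul,
            mul_comm M] at h2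
          rw [← neg_sub, Polynomial.degree_neg]
          refine lt_of_lt_of_eq h2 ?_
          rw [Nat.sub_mul, one_mul]
      refine ⟨1, ?_, ?_⟩
      · have h2 : (![1, 0] : Fin 2 → ℕ) (Fin.last 1) = 0 := rfl
        rw [h2, mul_zero, mul_one, ← h1]
        exact hasLead_zero_iff.2 rfl
      · have h2 : (![1, 1] : Fin 2 → L) (Fin.last 1) = 1 := rfl
        rw [h2, one_pow, Polynomial.coeff_one_zero]
    factor := fun G _ _ => Dvd.intro _ rfl
    span := ⟨Unit, inferInstance, fun _ => 1, by rw [Fintype.card_unit, one_mul], fun f =>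
      ⟨fun _ => f, by rw [Finset.univ_unique, Finset.sum_singleton, hmon, one_mul]⟩⟩
    indep := by
      intro n i s f hs hsum B hB
      have huniq : ∀ B' ∈ s, B' = B := by
        have hval : ∀ B' ∈ s, B' 0 = n ∧ B' 1 = i := by
          intro B' hB'
          obtain ⟨-, h1, h2⟩ := hs B' hB'
          rw [pairing, Fin.sum_univ_two] at h1
          refine ⟨?_, h2⟩
          simpa using h1
        intro B' hB'
        funext j
        have h1 := hval B' hB'
        have h2 := hval B hB
        fin_cases j
        · exact h1.1.trans h2.1.symm
        · exact h1.2.trans h2.2.symm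
      rw [Finset.eq_singleton_iff_unique_mem.2 ⟨hB, huniq⟩, Finset.sum_singleton,
        Fin.prod_univ_two] at hsum
      simpa using hsum }

end Initial

/-! ### Correctness of the algorithm -/

section Correctness

universe u v

variable {K : Type u} [Field K] {L : Type v} [Field L] [Algebra K L]

lemma map_append {A B : Type*} [CommRing A] [CommRing B] (f : A →+* B) {k : ℕ} (Ψ : Fin k → A[X])
    (ψ : A[X]) : (fun i => (append Ψ ψ i).map f) =
      append (fun i => (Ψ i).map f) (ψ.map f) :=
  funext fun i => apply_append (Polynomial.map f) Ψ ψ i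

/-- In a state with `N = 1` the degree of every factor of `F` is a multiple of that of `F`. -/
lemma IsState.irreducible {κ : Type*} [Field κ] [Algebra L κ] {k : ℕ} {F : L⟦X⟧[X]}
    {V : Fin (k + 2) → ℕ} {Λ : Fin (k + 2) → κ} {Ψ : Fin k → L⟦X⟧[X]}
    {θ : L⟦X⟧[X] →+* κ⟦X⟧[X]} (st : IsState F 1 V Λ Ψ θ) (hF : F.Monic) (hd : 0 < F.natDegree) :
    Irreducible F := by
  rw [hF.irreducible_iff_natDegree]
  refine ⟨fun h => ?_, fun f g hf hg hfg => ?_⟩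
  · rw [h, Polynomial.natDegree_one] at hd
    exact lt_irrefl _ hd
  · have h1 := st.factor f hf (Dvd.intro _ hfg)
    rw [one_mul] at h1
    have h2 : f.natDegree + g.natDegree = F.natDegree := by rw [← hfg, hf.natDegree_mul hg]
    rcases Nat.eq_zero_or_pos f.natDegree with h | h
    · exact Or.inl h
    · have := Nat.le_of_dvd h h1
      right
      omega

/-- If `q = 1` and `P` were linear, the leading form of the image of `Φₖ`, the `N`-th approximate
root of `F`, would be `P(y)`, up to a constant, which does not vanish at zero, whereas this image is
divisible by `y`. Hence `N` decreases at each round. -/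
lemma IsFrame.one_lt_mul {κ : Type*} [Field κ] [Algebra L κ] {k : ℕ} {F : L⟦X⟧[X]} {N : ℕ}
    {V : Fin (k + 2) → ℕ} {Λ : Fin (k + 2) → κ} {Φ : Fin (k + 1) → L⟦X⟧[X]}
    {θ : L⟦X⟧[X] →+* κ⟦X⟧[X]} (fr : IsFrame V Λ Φ θ) (hF : F.Monic)
    (hFd : F.natDegree = N * (Φ (Fin.last k)).natDegree) (hNκ : (N : κ) ≠ 0)
    (hψ : IsApproxRoot F N (Φ (Fin.last k))) {q m N' : ℕ} (hq : q ≠ 0) (hm : m ≠ 0) {P : κ[X]}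
    (hPm : P.Monic) (hP : Irreducible P) (hPX : P ≠ Polynomial.X)
    (hN : N = q * P.natDegree * N')
    (hlead : HasLead (N * (q * V (Fin.last (k + 1)) + m))
      (Polynomial.C (Λ (Fin.last (k + 1)) ^ N) * Polynomial.expand κ q (P ^ N'))
      (weightSubst κ q hq m (θ F))) : 1 < q * P.natDegree := by
  by_contra hle
  have hPpos : 0 < P.natDegree := hP.natDegree_pos
  have hqP : q * P.natDegree = 1 := by
    have := Nat.mul_pos (Nat.pos_of_ne_zero hq) hPpos
    omega
  rw [hqP, one_mul] at hN
  subst hN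
  obtain ⟨U, hU, hUc⟩ := fr.lead_last
  have hlead₀ : HasLead (1 * V (Fin.last (k + 1)))
      (Polynomial.X ^ 1 * U.map PowerSeries.constantCoeff) (θ (Φ (Fin.last k))) := by
    rw [hU, pow_one, one_mul]
    exact ⟨_, rfl, by simp⟩
  have hFd' : F.natDegree = N * 1 * (Φ (Fin.last k)).natDegree := by rw [mul_one, hFd]
  have hlead' : HasLead (N * 1 * (q * V (Fin.last (k + 1)) + m))
      ((Polynomial.C (Λ (Fin.last (k + 1))) * Polynomial.expand κ q P) ^ N)
      (weightSubst κ q hq m (θ F)) := by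
    rw [mul_one, mul_pow, ← Polynomial.C_pow, ← map_pow]
    exact hlead
  obtain ⟨h, hh⟩ := fr.exists_lead_approxRoot hF hFd' hNκ hψ
    (by rw [hUc]; exact fr.Λ_ne _) hlead₀ hq hm hlead'
  have hEd : (Polynomial.expand κ q P).natDegree = 1 := by
    rw [Polynomial.natDegree_expand, mul_comm, hqP]
  have heq := fr.lead_approxRoot hFd' hNκ hψ hq hm hlead' hh
    ((Polynomial.natDegree_C_mul_le _ _).trans hEd.le)
    (by
      have h1 := (expand_monic hq hPm).coeff_natDegree
      rw [hEd] at h1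
      rw [Polynomial.coeff_C_mul, h1, mul_one, pow_one])
  have h0 : h.coeff 0 = 0 := by
    rw [← hh.coeff_coeff, coeff_weightSubst, hU, Polynomial.coeff_C_mul,
      Polynomial.coeff_X_mul_zero]
    simp
  rw [heq, Polynomial.coeff_C_mul, Polynomial.coeff_zero_eq_eval_zero, Polynomial.expand_eval,
    zero_pow hq, ← Polynomial.coeff_zero_eq_eval_zero] at h0
  exact mul_ne_zero (fr.Λ_ne _) (coeff_zero_ne_zero_of_irreducible hPm hP hPX) h0

variable {F : K⟦X⟧[X]} {κ : Type v} [Field κ] [Algebra K κ] [Algebra L κ] [IsScalarTower K L κ]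
  {k N : ℕ} {V : Fin (k + 2) → ℕ} {Λ : Fin (k + 2) → κ} {Ψ : Fin k → K⟦X⟧[X]}
  {π : L⟦X⟧[X] →+* κ⟦X⟧[X]}

/-- A squarefree polynomial is not the `N`-th power of its approximate root. -/
lemma exists_last_lt (hF : F.Monic) (hsq : Squarefree F) (hFd : 0 < F.natDegree) (hN : 1 < N)
    {ψ : K⟦X⟧[X]} (hψ : IsApproxRoot F N ψ) {Φ : Fin (k + 1) → K⟦X⟧[X]}
    (hΦ : Φ (Fin.last k) = ψ) (hmonic : ∀ i, (Φ i).Monic) (h0 : 0 < (Φ 0).natDegree)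
    (hdvd : ∀ i : Fin k, (Φ i.castSucc).natDegree ∣ (Φ i.succ).natDegree)
    {c : Expansion K k} (hc : IsExpansion F Φ c) :
    ∃ B, c.f B ≠ 0 ∧ B (Fin.last (k + 1)) < N := by
  have hψd : 0 < ψ.natDegree := by
    rcases Nat.eq_zero_or_pos ψ.natDegree with h | h
    · have := hψ.2.1
      rw [h, zero_mul] at this
      omega
    · exact h
  by_contra hall
  push Not at hall
  have h1 := hc.eq_pow hmonic h0 hdvd (by rw [hΦ]; exact hψd) hF (N := N)
    (by rw [hΦ, mul_comm]; exact hψ.2.1.symm) hall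
  rw [hΦ] at h1
  have h2 : IsUnit ψ := hsq ψ (by
    rw [h1, ← pow_two]
    exact pow_dvd_pow _ hN)
  have h3 := hψ.1.natDegree_eq_zero.2 ((hψ.1.isUnit_iff).1 h2)
  omega

/-- In the round which starts from a given state, the boundary polynomial is the leading form of the
image of `F` for the slope of the lowest edge. -/
lemma IsState.exists_boundary
    (st : IsState (F.map (PowerSeries.map (algebraMap K L))) N V Λ
      (fun i => (Ψ i).map (PowerSeries.map (algebraMap K L))) π)
    (hF : F.Monic) (hsq : Squarefree F) (hd : 0 < F.natDegree) (hN : 1 < N) {ψ : K⟦X⟧[X]}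
    (hψ : IsApproxRoot F N ψ) {c : Expansion K k} (hc : IsExpansion F (append Ψ ψ) c) :
    ∃ θ : L⟦X⟧[X] →+* κ⟦X⟧[X],
      IsState (F.map (PowerSeries.map (algebraMap K L))) N V Λ
        (fun i => (Ψ i).map (PowerSeries.map (algebraMap K L))) θ ∧
      IsFrame V Λ (append (fun i => (Ψ i).map (PowerSeries.map (algebraMap K L)))
        (ψ.map (PowerSeries.map (algebraMap K L)))) θ ∧
      ∃ (q m : ℕ) (hq : q ≠ 0) (_ : m ≠ 0) (h : κ[X]), q.Coprime m ∧
        HasLead (N * (q * V (Fin.last (k + 1)) + m)) h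
          (weightSubst κ q hq m (θ (F.map (PowerSeries.map (algebraMap K L))))) ∧
        h.natDegree ≤ N ∧ h.coeff N = Λ (Fin.last (k + 1)) ^ N ∧
        (∃ i < N, h.coeff i ≠ 0) ∧ (∀ i, h.coeff i ≠ 0 → q ∣ N - i) ∧
        ∀ i, (boundaryPol N V Λ c).coeff i =
          Polynomial.C (h.coeff i / Λ (Fin.last (k + 1)) ^ N) *
            Polynomial.X ^ (m * ((N - i) / q)) := by
  set ρ := PowerSeries.map (algebraMap K L) with hρ
  have hFL : (F.map ρ).Monic := hF.map ρ
  have hψL : IsApproxRoot (F.map ρ) N (ψ.map ρ) := hψ.map ρ hF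
  obtain ⟨θ, hst, fr⟩ := st.exists_isFrame hψL
  have hFd : (F.map ρ).natDegree =
      N * (append (fun i => (Ψ i).map ρ) (ψ.map ρ) (Fin.last k)).natDegree := by
    rw [append_last, mul_comm]
    exact hψL.2.1.symm
  have hcL := hc.baseChange (L := L)
  rw [map_append] at hcL
  obtain ⟨u, hu, hu0⟩ := hst.root 1 N (F.map ρ) (one_mul N).symm (isApproxRoot_one hFL)
  have hnat : ∀ i, (append (fun i => (Ψ i).map ρ) (ψ.map ρ) i).natDegree =
      (append Ψ ψ i).natDegree := fun i => by
    rw [← map_append, Polynomial.natDegree_map_eq_of_injective powerSeries_map_injective]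
  have hmonic : ∀ i, (append Ψ ψ i).Monic := by
    intro i
    have h1 := fr.monic i
    rw [← map_append] at h1
    exact Polynomial.monic_of_injective powerSeries_map_injective h1
  obtain ⟨B, hB, hBN⟩ := exists_last_lt hF hsq hd hN hψ (append_last Ψ ψ) hmonic
    (by rw [← hnat, fr.natDegree_zero]; exact one_pos)
    (fun i => by rw [← hnat, ← hnat]; exact fr.dvd i) hc
  obtain ⟨q, m, hq, hm, h, hqm, hh, hex, hdvd, hbd⟩ := fr.exists_boundary hFL hFd hcL
    (by rw [hu0]; exact pow_ne_zero _ (fr.Λ_ne _)) hu ⟨B, by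
      rw [Expansion.f_baseChange]
      exact (map_ne_zero _).2 hB, hBN⟩
  rw [boundaryPol_baseChange] at hbd
  obtain ⟨h1, h2⟩ := fr.lead_of_monic hFL hFd hq hm hh
  exact ⟨θ, hst, fr, q, m, hq, hm, h, hqm, hh, h1, h2, hex, hdvd, hbd⟩

/-- The value returned by the loop is correct if it is entered in a state which satisfies the
invariant. -/
theorem LoopReturns.correct (hF : F.Monic) (hsq : Squarefree F)
    (hchar : (F.natDegree : K) ≠ 0) {κ : Type v} [Field κ] [Algebra K κ] {k N : ℕ}
    {V : Fin (k + 2) → ℕ} {Λ : Fin (k + 2) → κ} {Ψ : Fin k → K⟦X⟧[X]} {r : Bool}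
    (hrun : LoopReturns F κ k N V Λ Ψ r) : ∀ [Algebra L κ] [IsScalarTower K L κ]
    {π : L⟦X⟧[X] →+* κ⟦X⟧[X]}
    (_ : IsState (F.map (PowerSeries.map (algebraMap K L))) N V Λ
      (fun i => (Ψ i).map (PowerSeries.map (algebraMap K L))) π),
    (r = true ↔ Irreducible (F.map (PowerSeries.map (algebraMap K L)))) := by
  have hd : 0 < F.natDegree := Nat.pos_of_ne_zero fun h => hchar (by rw [h, Nat.cast_zero])
  have hFL := hF.map (PowerSeries.map (algebraMap K L))
  have hFLd : (F.map (PowerSeries.map (algebraMap K L))).natDegree = F.natDegree :=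
    hF.natDegree_map _
  induction hrun with
  | exit κ k N V Λ Ψ hN =>
    intro _ _ π st
    obtain rfl : N = 1 := le_antisymm hN st.N_pos
    exact iff_of_true rfl (st.irreducible hFL (by rw [hFLd]; exact hd))
  | notDegenerated κ k N V Λ Ψ hN ψ hψ c hc hH =>
    intro _ _ π st
    refine iff_of_false Bool.false_ne_true ?_
    obtain ⟨θ, hst, fr, q, m, hq, hm, h, hqm, hh, hdeg, hlc, hex, hdvd, hbd⟩ :=
      st.exists_boundary hF hsq hd hN hψ hc
    obtain ⟨h₁, h₂, rfl, hmon, hcop, hg₁, hg₂, hpos, hlt, hsum⟩ :=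
      exists_coprime_factors hq hqm (fr.Λ_ne _) hdeg hlc hex hdvd hbd hH
    obtain ⟨u, ⟨W, hW, -⟩, -⟩ := hst.root 1 N _ (one_mul N).symm (isApproxRoot_one hFL)
    rw [hW, map_mul, puiseux_C_X_pow, one_pow, map_one, map_one, mul_one, mul_add,
      show N * (q * V (Fin.last (k + 1))) = q * (N * V (Fin.last (k + 1))) by ring,
      hasLead_C_mul_iff, ← hsum, mul_comm _ m] at hh
    obtain ⟨G, hG, hGd, hGW⟩ := exists_factor_of_hasLead hq hh hmon hcop hg₁ hg₂
    exact hst.not_irreducible_of_dvd hFL hG (hW ▸ dvd_mul_of_dvd_right hGW _)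
      (by rw [hGd]; exact hpos) (by rw [hGd]; exact hlt)
  | next κ k N V Λ Ψ hN ψ hψ c hc q m P N' hH s t hst' ht r hrun ih =>
    intro _ _ π st
    obtain ⟨θ, hst, fr, q₀, m₀, hq, hm, h, hqm, hh, hdeg, hlc, hex, hdvd, hbd⟩ :=
      st.exists_boundary hF hsq hd hN hψ hc
    obtain ⟨rfl, rfl, hPX, hNeq, rfl⟩ := hH.eq_of_lead hq hm hqm (fr.Λ_ne _) hdeg hlc hex hdvd hbd
    have hcharκ : ((F.map (PowerSeries.map (algebraMap K L))).natDegree : κ) ≠ 0 := by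
      rw [hFLd, ← map_natCast (algebraMap K κ)]
      exact (map_ne_zero _).2 hchar
    obtain ⟨π', hst''⟩ := hst.next (hψ.map _ hF) fr hFL hcharκ hq hm hqm hH.2.2.1 hPX hNeq hh hst'
    rw [← map_append] at hst''
    exact ih hst''

/-- The loop terminates if it is entered in a state which satisfies the invariant: the value of `N`
decreases. -/
theorem exists_loopReturns (hF : F.Monic) (hsq : Squarefree F) (hchar : (F.natDegree : K) ≠ 0)
    (N : ℕ) : ∀ {κ : Type v} [Field κ] [Algebra K κ] [Algebra L κ] [IsScalarTower K L κ]
    {k : ℕ} {V : Fin (k + 2) → ℕ} {Λ : Fin (k + 2) → κ} {Ψ : Fin k → K⟦X⟧[X]}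
    {π : L⟦X⟧[X] →+* κ⟦X⟧[X]}
    (_ : IsState (F.map (PowerSeries.map (algebraMap K L))) N V Λ
      (fun i => (Ψ i).map (PowerSeries.map (algebraMap K L))) π),
    ∃ r, LoopReturns F κ k N V Λ Ψ r := by
  have hd : 0 < F.natDegree := Nat.pos_of_ne_zero fun h => hchar (by rw [h, Nat.cast_zero])
  have hFL := hF.map (PowerSeries.map (algebraMap K L))
  have hFLd : (F.map (PowerSeries.map (algebraMap K L))).natDegree = F.natDegree :=
    hF.natDegree_map _
  induction N using Nat.strong_induction_on with
  | _ N ih =>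
  intro κ _ _ _ _ k V Λ Ψ π st
  rcases le_or_gt N 1 with hN | hN
  · exact ⟨true, .exit κ k N V Λ Ψ hN⟩
  have hNF : N ∣ F.natDegree := hFLd ▸ st.N_dvd
  have hNK : (N : K) ≠ 0 := by
    intro h0
    obtain ⟨e, he⟩ := hNF
    rw [he, Nat.cast_mul, h0, zero_mul] at hchar
    exact hchar rfl
  have hNκ : (N : κ) ≠ 0 := by
    rw [← map_natCast (algebraMap K κ)]
    exact (map_ne_zero _).2 hNK
  have hunit : IsUnit (N : K⟦X⟧) := by
    rw [PowerSeries.isUnit_iff_constantCoeff, map_natCast]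
    exact hNK.isUnit
  obtain ⟨ψ, hψ⟩ := exists_isApproxRoot hF hNF hunit
  have hψL := hψ.map (PowerSeries.map (algebraMap K L)) hF
  obtain ⟨θ₀, -, fr₀⟩ := st.exists_isFrame hψL
  have hnat : ∀ i, (append (fun i => (Ψ i).map (PowerSeries.map (algebraMap K L)))
      (ψ.map (PowerSeries.map (algebraMap K L))) i).natDegree =
      (append Ψ ψ i).natDegree := fun i => by
    rw [← map_append, Polynomial.natDegree_map_eq_of_injective powerSeries_map_injective]
  obtain ⟨c, hc⟩ := exists_isExpansion (Ψ := append Ψ ψ) (fun i => by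
      have h1 := fr₀.monic i
      rw [← map_append] at h1
      exact Polynomial.monic_of_injective powerSeries_map_injective h1)
    (by rw [← hnat]; exact fr₀.natDegree_zero) (fun i => by rw [← hnat]; exact fr₀.pos i) F
  by_cases hH : Degenerated (boundaryPol N V Λ c)
  swap
  · exact ⟨false, .notDegenerated κ k N V Λ Ψ hN ψ hψ c hc hH⟩
  obtain ⟨q, m, P, N', hE⟩ := hH
  have hP : Fact (Irreducible P) := ⟨hE.2.2.2.1⟩
  obtain ⟨θ, hst, fr, q₀, m₀, hq, hm, h, hqm, hh, hdeg, hlc, hex, hdvd, hbd⟩ :=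
    st.exists_boundary hF hsq hd hN hψ hc
  obtain ⟨rfl, rfl, hPX, hNeq, rfl⟩ := hE.eq_of_lead hq hm hqm (fr.Λ_ne _) hdeg hlc hex hdvd hbd
  -- `t` is the opposite of the inverse of `m` modulo `q`
  obtain ⟨s, t, hst', ht⟩ : ∃ s t, q * s = m * t + 1 ∧ t < q := by
    have : NeZero q := ⟨hq⟩
    have h1 : ((m * (-(m : ZMod q)⁻¹).val + 1 : ℕ) : ZMod q) = 0 := by
      push_cast
      rw [ZMod.natCast_zmod_val, mul_neg, ZMod.coe_mul_inv_eq_one m hqm.symm, neg_add_cancel]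
    obtain ⟨s, hs⟩ := (ZMod.natCast_eq_zero_iff _ _).1 h1
    exact ⟨s, _, hs.symm, ZMod.val_lt _⟩
  have hcharκ : ((F.map (PowerSeries.map (algebraMap K L))).natDegree : κ) ≠ 0 := by
    rw [hFLd, ← map_natCast (algebraMap K κ)]
    exact (map_ne_zero _).2 hchar
  obtain ⟨π', hst''⟩ := hst.next hψL fr hFL hcharκ hq hm hqm hE.2.2.1 hPX hNeq hh hst'
  rw [← map_append] at hst''
  have hlt : N' < N := by
    have h1 := fr.one_lt_mul hFL (by rw [append_last, mul_comm]; exact hψL.2.1.symm)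
      hNκ (by rw [append_last]; exact hψL) hq hm hE.2.2.1 hP.out hPX hNeq hh
    have h2 := hst''.N_pos
    rw [hNeq]
    nlinarith
  obtain ⟨r, hr⟩ := ih N' hlt hst''
  exact ⟨r, .next κ k N V Λ Ψ hN ψ hψ c hc q m P N' hE s t hst' ht r hr⟩

end Correctness

end ApproxRootTest

theorem mainTheorem2 {K : Type*} [Field K] [PerfectField K] {L : Type*} [Field L] [Algebra K L]
    (F : K⟦X⟧[X])
    (hF : F.IsDistinguishedAt (Ideal.span {(PowerSeries.X : K⟦X⟧)}))
    (hsq : Squarefree F)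
    (hd : (F.natDegree : K) ≠ 0) :
    (ApproxRootTest.AlgorithmReturns F L true ↔
      Irreducible (F.map (PowerSeries.map (algebraMap K L)))) ∧
    (ApproxRootTest.AlgorithmReturns F L false ↔
      ¬ Irreducible (F.map (PowerSeries.map (algebraMap K L)))) := by
  have hFLd : (F.map (PowerSeries.map (algebraMap K L))).natDegree = F.natDegree :=
    hF.monic.natDegree_map _
  have hF0 : (F.map (PowerSeries.map (algebraMap K L))).map PowerSeries.constantCoeff =
      Polynomial.X ^ (F.map (PowerSeries.map (algebraMap K L))).natDegree := by
    rw [hFLd]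
    ext i
    rw [Polynomial.coeff_map, Polynomial.coeff_map, Polynomial.coeff_X_pow,
      ← PowerSeries.coeff_zero_eq_constantCoeff_apply, PowerSeries.coeff_map,
      PowerSeries.coeff_zero_eq_constantCoeff_apply]
    split_ifs with hi
    · rw [hi, Polynomial.coeff_natDegree, hF.monic.leadingCoeff, map_one, map_one]
    · rcases lt_or_gt_of_ne hi with h | h
      · obtain ⟨g, hg⟩ := Ideal.mem_span_singleton.1 (hF.mem h)
        rw [hg, map_mul, PowerSeries.constantCoeff_X, zero_mul, map_zero]
      · rw [Polynomial.coeff_eq_zero_of_natDegree_lt h, map_zero, map_zero]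
  have st := ApproxRootTest.isState_initial (hF.monic.map (PowerSeries.map (algebraMap K L))) hF0
    (by rw [hFLd, ← map_natCast (algebraMap K L)]; exact (map_ne_zero _).2 hd)
  rw [hFLd] at st
  have hΨ : (Fin.elim0 : Fin 0 → L⟦X⟧[X]) =
      fun i => ((Fin.elim0 i : K⟦X⟧[X])).map (PowerSeries.map (algebraMap K L)) :=
    funext fun i => i.elim0
  rw [hΨ] at st
  have hcorrect : ∀ r, ApproxRootTest.AlgorithmReturns F L r →
      (r = true ↔ Irreducible (F.map (PowerSeries.map (algebraMap K L)))) :=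
    fun r h => ApproxRootTest.LoopReturns.correct hF.monic hsq hd h st
  obtain ⟨r, hr⟩ : ∃ r, ApproxRootTest.AlgorithmReturns F L r :=
    ApproxRootTest.exists_loopReturns hF.monic hsq hd F.natDegree st
  refine ⟨⟨fun h => (hcorrect _ h).1 rfl, fun h => ?_⟩,
    ⟨fun h h' => Bool.false_ne_true ((hcorrect _ h).2 h'), fun h => ?_⟩⟩
  · rw [← (hcorrect r hr).2 h]
    exact hr
  · cases r with
    | false => exact hr
    | true => exact absurd ((hcorrect _ hr).1 rfl) h
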